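/- **Conventions.** A *forest* on a finite set $I$ is a set of non-planar rooted binary trees whose leaves are, all together, bijectively labelled by $I$. $V(F)$ is the set of inner vertices of the forest $F$. An *orientation* of a finite set $X$ is a generator of $\Lambda^{|X|}\mathbb{Z}X$; its degree is the number of its wedge signs. *Operads (over $\mathbb{Q}$).* $\operatorname{Det}(I)$ is the line spanned by the orientations of $I$, in degree $|I|-1$, with composition $(x\wedge\star)\circ_\star y=x\wedge y$. $\operatorname{Gri}(I)$, in degree $0$, has as basis the rooted binary trees with leaves labelled by $I$, with composition given by grafting; it is freely generated by the tree $\omega_{i,j}$ with two leaves $i,j$. $B$ is the operad on $\operatorname{Det}\circ\operatorname{Gri}$ defined by the distributive law $$\omega_{i,\star}\circ_\star e_{j,k}=e_{j,\star}\circ_\star\omega_{i,k}-e_{k,\star}\circ_\star\omega_{i,j},\qquad e_{j,k}=j\wedge k ;$$ $B(I)$ has as basis the tensor products $o\otimes F$ of a forest $F$ on $I$ with an orientation $o$ of its set of roots (one for each $F$). $\operatorname{Bess}=\operatorname{Det}\otimes B$ is the tensor product of graded operads, with $(a\otimes x)\circ_i(b\otimes y)=(-1)^{\deg x\deg b}(a\circ_i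 b)\otimes(x\circ_i y)$, and $\Omega_{\star,\#}=(\star\wedge\#)\otimes\omega_{\star,\#}\in\operatorname{Bess}(\{\star,\#\})$. *Inner-oriented forests.* An inner-oriented forest $o\otimes F$ is a forest $F$ with a global orientation $o$, i.e. an orientation of $V(F)\sqcup\{R\}$ where $R=R_F$ is an auxiliary element, and with (implicit) local orientations $o_v$, i.e. orientations of the set of the three half-edges at $v$, for all $v\in V(F)$. It is identified with the following element $o'\otimes o''\otimes F$ of $\operatorname{Bess}(I)$, where $o'$ is an orientation of $I$ and $o''$ an orientation of the set of roots. In $o'\wedge R\wedge o''$, remove all pairs $\ell\wedge r$ where $\ell$ is a leaf and $r$ a root that are related by an edge, and add the pairs $e^+\wedge e^-$ (upper and lower half-edge) for all edges $e$ between two inner vertices; here a leaf or a root adjacent to an inner vertex stands for the corresponding half-edge at this vertex. The result is required to be the exterior product obtained from $o$ by replacing each $v\in V(F)$ by $o_v$. This determines $o'\otimes o''$. *The operation $\vee$.* For trees $T_1,T_2$, $T_1\vee T_2$ is the tree obtained by grafting $T_1$ and $T_2$ on the two leaves of the tree with one inner vertex $v$. For forests $F_1=T_1^1\sqcup\dots\sqcup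 T_1^m$ and $F_2=T_2^1\sqcup\dots\sqcup T_2^n$, with trees $T^a_1$, $T^b_2$, $F_1\vee F_2$ is the sum of forests $$F_1\vee F_2=\sum_{a=1}^m\sum_{b=1}^n\Big((T_1^a\vee T_2^b)\sqcup\bigsqcup_{a'\neq a}T_1^{a'}\sqcup\bigsqcup_{b'\neq b}T_2^{b'}\Big).$$ **Proposition.** Let $o_1\otimes F_1$ and $o_2\otimes F_2$ be two inner-oriented forests, on finite sets $I_1$ and $I_2$. Then, in $\operatorname{Bess}(I_1\sqcup I_2)$, $$\Omega_{\star,\#}\circ_\star(o_1\otimes F_1)\circ_\#(o_2\otimes F_2)=(o_1\vee o_2)\otimes(F_1\vee F_2),$$ where in each term of $F_1\vee F_2$ the global orientation $o_1\vee o_2$ is $(-1)^{\deg o_1}\,o_1\wedge o_2$ with $R_{F_1}\wedge R_{F_2}$ replaced by $R\wedge v$, $v$ being the new inner vertex of the term; the local orientations are unchanged at the vertices of $F_1$ and $F_2$, and the local orientation at $v$ is the one of $\Omega$, namely $v^+\wedge e_1^-\wedge e_2^-$, where $v^+$ is the outgoing half-edge at $v$ and $e_1^-$, $e_2^-$ are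 the incoming half-edges on the side of $F_1$ and of $F_2$. -/

import Mathlib

open scoped TensorProduct

noncomputable section

namespace BesselOperad

/-! ### Exterior algebras and orientations of finite sets -/

/-- The exterior algebra of the rational vector space with basis `X`. -/
abbrev Ext (X : Type*) : Type _ := ExteriorAlgebra ℚ (X →₀ ℚ)

/-- The generator of the exterior algebra given by an element of `X`. -/
def gen {X : Type*} (x : X) : Ext X := ExteriorAlgebra.ι ℚ (Finsupp.single x 1)

/-- The exterior product `x₁ ∧ ⋯ ∧ xₙ` of a list of elements. -/
def wedge {X : Type*} (l : List X) : Ext X := (l.map gen).prod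

/-- `o` is an orientation of the finite set `s`: up to sign it is the exterior product of all
elements of `s` (in some order), i.e. a generator of the top exterior power of `ℤ s`. -/
def IsOrientation {X : Type*} (s : Finset X) (o : Ext X) : Prop :=
  ∃ l : List X, l.Nodup ∧ (∀ x, x ∈ l ↔ x ∈ s) ∧ (o = wedge l ∨ o = -wedge l)

/-- The determinant line of the finite set `s`, spanned by the orientations of `s`. -/
def detSpace {X : Type*} (s : Finset X) : Submodule ℚ (Ext X) :=
  Submodule.span ℚ {o | IsOrientation s o}

section exterior

variable {X Y Z : Type*}

@[simp] theorem wedge_nil : wedge ([] : List X) = 1 := rfl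

@[simp] theorem wedge_cons (x : X) (l : List X) : wedge (x :: l) = gen x * wedge l := by
  simp [wedge]

@[simp] theorem wedge_append (l l' : List X) : wedge (l ++ l') = wedge l * wedge l' := by
  simp [wedge]

theorem gen_mul_self (x : X) : gen x * gen x = 0 := ExteriorAlgebra.ι_sq_zero _

theorem gen_swap (x y : X) : gen x * gen y = -(gen y * gen x) :=
  eq_neg_of_add_eq_zero_left (ExteriorAlgebra.ι_add_mul_swap _ _)

theorem wedge_perm {l l' : List X} (h : l.Perm l') : wedge l = wedge l' ∨ wedge l = -wedge l' := by
  induction h with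
  | nil => simp
  | cons x _ ih => rcases ih with h | h <;> simp [h]
  | swap x y l => right; simp only [wedge_cons, ← mul_assoc, gen_swap y x, neg_mul]
  | trans _ _ h1 h2 => rcases h1 with h1 | h1 <;> rcases h2 with h2 | h2 <;> simp [h1, h2]

theorem contractLeft_wedge [DecidableEq X] (x : X) (l : List X) (h : x ∉ l) :
    CliffordAlgebra.contractLeft (Finsupp.lapply x) (wedge l) = 0 := by
  induction l with
  | nil => simp
  | cons y l ih =>
    simp only [List.mem_cons, not_or] at h
    rw [wedge_cons, gen]
    have := CliffordAlgebra.contractLeft_ι_mul (Q := (0 : QuadraticForm ℚ (X →₀ ℚ)))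
      (Finsupp.lapply x) (Finsupp.single y 1) (wedge l)
    refine this.trans ?_
    rw [ih h.2]
    simp [Ne.symm h.1]

theorem contractRight_wedge [DecidableEq X] (x : X) (l : List X) (h : x ∉ l) :
    CliffordAlgebra.contractRight (wedge l) (Finsupp.lapply x) = 0 := by
  induction l using List.reverseRecOn with
  | nil => simp
  | append_singleton l y ih =>
    simp only [List.mem_append, List.mem_singleton, not_or] at h
    rw [wedge_append, wedge_cons, wedge_nil, mul_one, gen]
    have := CliffordAlgebra.contractRight_mul_ι (Q := (0 : QuadraticForm ℚ (X →₀ ℚ)))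
      (Finsupp.lapply x) (Finsupp.single y 1) (wedge l)
    refine this.trans ?_
    rw [ih h.1]
    simp [Ne.symm h.2]

theorem contractRight_wedge_append [DecidableEq X] (x : X) (l : List X) (h : x ∉ l) :
    CliffordAlgebra.contractRight (wedge (l ++ [x])) (Finsupp.lapply x) = wedge l := by
  rw [wedge_append, wedge_cons, wedge_nil, mul_one, gen]
  refine (CliffordAlgebra.contractRight_mul_ι (Q := (0 : QuadraticForm ℚ (X →₀ ℚ)))
      (Finsupp.lapply x) (Finsupp.single x 1) (wedge l)).trans ?_
  rw [contractRight_wedge x l h]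
  simp

theorem wedge_ne_zero {l : List X} (h : l.Nodup) : wedge l ≠ 0 := by
  classical
  induction l with
  | nil => simp
  | cons x l ih =>
    simp only [List.nodup_cons] at h
    intro h0
    apply ih h.2
    have := CliffordAlgebra.contractLeft_ι_mul (Q := (0 : QuadraticForm ℚ (X →₀ ℚ)))
      (Finsupp.lapply x) (Finsupp.single x 1) (wedge l)
    rw [contractLeft_wedge x l h.1] at this
    rw [wedge_cons, gen] at h0
    have h1 : CliffordAlgebra.contractLeft (Finsupp.lapply x)
      ((CliffordAlgebra.ι (0 : QuadraticForm ℚ (X →₀ ℚ))) (Finsupp.single x 1) * wedge l) = 0 := by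
      erw [h0]; simp
    rw [h1] at this
    simpa using this.symm

theorem IsOrientation.neg {s : Finset X} {o : Ext X} (h : IsOrientation s o) :
    IsOrientation s (-o) := by
  obtain ⟨l, h1, h2, h3⟩ := h
  refine ⟨l, h1, h2, ?_⟩
  rcases h3 with rfl | rfl <;> simp

theorem isOrientation_wedge {s : Finset X} {l : List X} (h1 : l.Nodup) (h2 : ∀ x, x ∈ l ↔ x ∈ s) :
    IsOrientation s (wedge l) := ⟨l, h1, h2, Or.inl rfl⟩

theorem isOrientation_gen (x : X) : IsOrientation {x} (gen x) :=
  ⟨[x], by simp, by simp, by simp⟩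

theorem isOrientation_one : IsOrientation (∅ : Finset X) 1 := ⟨[], by simp, by simp, by simp⟩

theorem IsOrientation.sign_smul {s : Finset X} {o : Ext X} (h : IsOrientation s o) (n : ℕ) :
    IsOrientation s ((-1 : ℚ) ^ n • o) := by
  rcases neg_one_pow_eq_or ℚ n with h1 | h1 <;> rw [h1]
  · simpa using h
  · simpa using h.neg

theorem IsOrientation.ne_zero {s : Finset X} {o : Ext X} (h : IsOrientation s o) : o ≠ 0 := by
  obtain ⟨l, h1, h2, h3⟩ := h
  rcases h3 with rfl | rfl
  · exact wedge_ne_zero h1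
  · exact neg_ne_zero.mpr (wedge_ne_zero h1)

theorem IsOrientation.eq_or_neg {s : Finset X} {o o' : Ext X} (h : IsOrientation s o)
    (h' : IsOrientation s o') : o' = o ∨ o' = -o := by
  obtain ⟨l, h1, h2, h3⟩ := h
  obtain ⟨l', h1', h2', h3'⟩ := h'
  have hp : l'.Perm l := (List.perm_ext_iff_of_nodup h1' h1).2 fun x => by rw [h2, h2']
  rcases wedge_perm hp with h | h <;> rcases h3 with rfl | rfl <;> rcases h3' with rfl | rfl <;>
    simp [h]

theorem IsOrientation.mul [DecidableEq X] {s t : Finset X} {o o' : Ext X} (h : IsOrientation s o)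
    (h' : IsOrientation t o') (hd : Disjoint s t) : IsOrientation (s ∪ t) (o * o') := by
  obtain ⟨l, h1, h2, h3⟩ := h
  obtain ⟨l', h1', h2', h3'⟩ := h'
  refine ⟨l ++ l', ?_, by simp [h2, h2'], ?_⟩
  · rw [List.nodup_append']
    refine ⟨h1, h1', fun x hx hx' => ?_⟩
    exact Finset.disjoint_left.1 hd ((h2 x).1 hx) ((h2' x).1 hx')
  · rcases h3 with rfl | rfl <;> rcases h3' with rfl | rfl <;> simp

theorem isOrientation_list_prod [DecidableEq Y] (f : X → Ext Y) (t : X → Finset Y) (l : List X)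
    (hl : l.Nodup) (hf : ∀ x ∈ l, IsOrientation (t x) (f x))
    (hd : ∀ x ∈ l, ∀ y ∈ l, x ≠ y → Disjoint (t x) (t y)) (u : Finset Y)
    (hu : ∀ y, y ∈ u ↔ ∃ x ∈ l, y ∈ t x) :
    IsOrientation u (l.map f).prod := by
  induction l generalizing u with
  | nil =>
    have : u = ∅ := by ext y; simp [hu]
    simpa [this] using isOrientation_one
  | cons x l ih =>
    simp only [List.nodup_cons] at hl
    classical
    have hi := ih hl.2 (fun y hy => hf y (by simp [hy]))
      (fun y hy z hz => hd y (by simp [hy]) z (by simp [hz])) (l.toFinset.biUnion t)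
      (by simp)
    have hu' : u = t x ∪ l.toFinset.biUnion t := by ext y; simp [hu]
    rw [hu', List.map_cons, List.prod_cons]
    refine (hf x (by simp)).mul hi ?_
    rw [Finset.disjoint_biUnion_right]
    intro y hy
    rw [List.mem_toFinset] at hy
    exact hd x (by simp) y (by simp [hy]) (by rintro rfl; exact hl.1 hy)

theorem IsOrientation.contractRight [DecidableEq X] {s : Finset X} {o : Ext X}
    (h : IsOrientation s o) {x : X} (hx : x ∈ s) :
    IsOrientation (s.erase x) (CliffordAlgebra.contractRight o (Finsupp.lapply x)) := by
  obtain ⟨l, h1, h2, h3⟩ := h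
  have hx' : x ∈ l := (h2 x).2 hx
  have hp : l.Perm (l.erase x ++ [x]) :=
    (List.perm_cons_erase hx').trans (List.perm_append_singleton x (l.erase x)).symm
  have hn : x ∉ l.erase x := fun h => (h1.mem_erase_iff.1 h).1 rfl
  refine ⟨l.erase x, h1.erase x, fun y => ?_, ?_⟩
  · rw [h1.mem_erase_iff, Finset.mem_erase, h2]
  · have hc := contractRight_wedge_append x (l.erase x) hn
    rcases wedge_perm hp with h | h <;> rcases h3 with rfl | rfl <;> rw [h]
    · exact Or.inl hc
    · right
      rw [← hc]
      simp only [map_neg, LinearMap.neg_apply]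
    · right
      rw [← hc]
      simp only [map_neg, LinearMap.neg_apply]
    · left
      rw [← hc, neg_neg]

end exterior

/-- The algebra morphism of exterior algebras that replaces each `x` by `f x`, where the
elements `f x` anticommute. -/
def substHom {X Y : Type*} (f : X → Ext Y) (hf : ∀ x y, f x * f y = -(f y * f x)) :
    Ext X →ₐ[ℚ] Ext Y :=
  ExteriorAlgebra.lift ℚ ⟨Finsupp.linearCombination ℚ f, by
    have key : ∀ m n : X →₀ ℚ, Finsupp.linearCombination ℚ f m * Finsupp.linearCombination ℚ f n =
        -(Finsupp.linearCombination ℚ f n * Finsupp.linearCombination ℚ f m) := by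
      intro m n
      induction m using Finsupp.induction_linear with
      | zero => simp
      | add a b ha hb => simp only [map_add, add_mul, mul_add, ha, hb]; abel
      | single x a =>
        induction n using Finsupp.induction_linear with
        | zero => simp
        | add c d hc hd => simp only [map_add, add_mul, mul_add, hc, hd]; abel
        | single y b =>
          simp only [Finsupp.linearCombination_single, smul_mul_assoc, mul_smul_comm, hf x y,
            smul_neg]
          rw [smul_comm]
    intro m
    have h2 : (2 : ℚ) • (Finsupp.linearCombination ℚ f m * Finsupp.linearCombination ℚ f m) = 0 := by
      rw [two_smul]
      exact eq_neg_iff_add_eq_zero.1 (key m m)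
    exact (smul_eq_zero.1 h2).resolve_left two_ne_zero⟩

/-- The algebra morphism of exterior algebras that renames `x` to `y` if `p x = some y`, and
kills `x` if `p x = none`. -/
def rename {X Y : Type*} (p : X → Option Y) : Ext X →ₐ[ℚ] Ext Y :=
  substHom (fun x => (p x).elim 0 gen) (by
    intro x y
    rcases p x with _ | a <;> rcases p y with _ | b
    · simp
    · simp
    · simp
    · exact gen_swap a b)

section exterior

variable {X Y Z : Type*}

@[simp] theorem substHom_gen (f : X → Ext Y) (hf) (x : X) : substHom f hf (gen x) = f x := by
  simp [substHom, gen]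

theorem substHom_wedge (f : X → Ext Y) (hf) (l : List X) :
    substHom f hf (wedge l) = (l.map f).prod := by
  induction l with
  | nil => simp
  | cons x l ih => simp [ih]

theorem IsOrientation.substHom [DecidableEq Y] {s : Finset X} {o : Ext X} (h : IsOrientation s o)
    (f : X → Ext Y) (hf : ∀ x y, f x * f y = -(f y * f x)) (t : X → Finset Y)
    (ht : ∀ x ∈ s, IsOrientation (t x) (f x))
    (hd : ∀ x ∈ s, ∀ y ∈ s, x ≠ y → Disjoint (t x) (t y)) :
    IsOrientation (s.biUnion t) (substHom f hf o) := by
  obtain ⟨l, h1, h2, h3⟩ := h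
  have := isOrientation_list_prod f t l h1 (fun x hx => ht x ((h2 x).1 hx))
    (fun x hx y hy => hd x ((h2 x).1 hx) y ((h2 y).1 hy)) (s.biUnion t) (by simp [h2])
  rw [← substHom_wedge f hf] at this
  rcases h3 with rfl | rfl
  · exact this
  · rw [map_neg]; exact this.neg

theorem IsOrientation.rename [DecidableEq Y] {s : Finset X} {o : Ext X} (h : IsOrientation s o)
    (p : X → Option Y) (u : Finset Y) (hp : ∀ x ∈ s, ∃ y, p x = some y)
    (hi : ∀ x ∈ s, ∀ x' ∈ s, p x = p x' → x = x') (hu : ∀ y, y ∈ u ↔ ∃ x ∈ s, p x = some y) :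
    IsOrientation u (rename p o) := by
  have hu' : u = s.biUnion (fun x => (p x).toFinset) := by
    ext y; simp [hu]
  rw [hu']
  refine h.substHom _ _ _ ?_ ?_
  · intro x hx
    obtain ⟨y, hy⟩ := hp x hx
    simpa [hy] using isOrientation_gen y
  · intro x hx x' hx' hne
    rw [Finset.disjoint_left]
    intro y hy hy'
    simp only [Option.mem_toFinset, Option.mem_def] at hy hy'
    exact hne (hi x hx x' hx' (hy.trans hy'.symm))

theorem wedge_mul_wedge (l l' : List X) :
    wedge l * wedge l' = (-1 : ℚ) ^ (l.length * l'.length) • (wedge l' * wedge l) := by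
  have h1 : ∀ (x : X) (l' : List X), gen x * wedge l' = (-1 : ℚ) ^ l'.length • (wedge l' * gen x) := by
    intro x l'
    induction l' with
    | nil => simp
    | cons y l' ih =>
      rw [wedge_cons, ← mul_assoc, gen_swap, neg_mul, mul_assoc, ih, mul_smul_comm, ← mul_assoc,
        List.length_cons, pow_succ]
      simp
  induction l with
  | nil => simp
  | cons x l ih =>
    rw [wedge_cons, mul_assoc, ih, mul_smul_comm, ← mul_assoc, h1, smul_mul_assoc, smul_smul,
      mul_assoc, List.length_cons, ← pow_add]
    congr 2
    ring

theorem IsOrientation.anticomm {s t : Finset X} {o o' : Ext X} (h : IsOrientation s o)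
    (h' : IsOrientation t o') (hs : Odd s.card) (ht : Odd t.card) : o * o' = -(o' * o) := by
  classical
  obtain ⟨l, h1, h2, h3⟩ := h
  obtain ⟨l', h1', h2', h3'⟩ := h'
  have e1 : l.length = s.card := by
    rw [← List.toFinset_card_of_nodup h1]; congr 1; ext x; simp [h2]
  have e2 : l'.length = t.card := by
    rw [← List.toFinset_card_of_nodup h1']; congr 1; ext x; simp [h2']
  have := wedge_mul_wedge l l'
  rw [e1, e2, (hs.mul ht).neg_one_pow] at this
  rcases h3 with rfl | rfl <;> rcases h3' with rfl | rfl <;> simp [this]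

theorem IsOrientation.mem {s : Finset X} {o : Ext X} (h : IsOrientation s o) : o ∈ detSpace s :=
  Submodule.subset_span h

end exterior

/-- The composition rule of determinants: `(x ∧ a) ∘_a y = x ∧ y`, where the elements of `X` other
than `a` are renamed by `p` and the elements of `Y` by `q`. The factor `x` is obtained from `x ∧ a`
by contracting with the coordinate form of `a` on the right. -/
def extComp {X Y Z : Type*} (a : X) (p : X → Option Z) (q : Y → Z) :
    Ext X →ₗ[ℚ] Ext Y →ₗ[ℚ] Ext Z :=
  (LinearMap.mul ℚ (Ext Z)).compl₁₂
    ((rename p).toLinearMap ∘ₗ (CliffordAlgebra.contractRight.flip (Finsupp.lapply a)))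
    (rename (fun y => some (q y))).toLinearMap

theorem extComp_apply {X Y Z : Type*} (a : X) (p : X → Option Z) (q : Y → Z) (x : Ext X)
    (y : Ext Y) : extComp a p q x y =
      rename p (CliffordAlgebra.contractRight x (Finsupp.lapply a)) *
        rename (fun y => some (q y)) y := rfl

theorem extComp_mem {X Y Z : Type*} [DecidableEq X] [DecidableEq Z] (a : X) (p : X → Option Z)
    (q : Y → Z) (s : Finset X) (t : Finset Y) (u : Finset Z) (ha : a ∈ s)
    (hp : ∀ x ∈ s, x ≠ a → ∃ z, p x = some z)
    (hpi : ∀ x ∈ s, x ≠ a → ∀ x' ∈ s, x' ≠ a → p x = p x' → x = x')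
    (hq : ∀ y ∈ t, ∀ y' ∈ t, q y = q y' → y = y')
    (hpq : ∀ x ∈ s, x ≠ a → ∀ y ∈ t, p x ≠ some (q y))
    (hu : ∀ z, z ∈ u ↔ (∃ x ∈ s, x ≠ a ∧ p x = some z) ∨ ∃ y ∈ t, q y = z)
    {x : Ext X} {y : Ext Y} (hx : x ∈ detSpace s) (hy : y ∈ detSpace t) :
    extComp a p q x y ∈ detSpace u := by
  refine LinearMap.BilinMap.apply_apply_mem_of_mem_span (detSpace u) _ _ _ ?_ x y hx hy
  intro o ho o' ho'
  rw [extComp_apply]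
  have h1 := (IsOrientation.contractRight ho ha).rename p (u.filter fun z => ∃ x ∈ s, x ≠ a ∧ p x = some z)
    (fun x hx => hp x (Finset.mem_of_mem_erase hx) (Finset.ne_of_mem_erase hx))
    (fun x hx x' hx' => hpi x (Finset.mem_of_mem_erase hx) (Finset.ne_of_mem_erase hx) x'
      (Finset.mem_of_mem_erase hx') (Finset.ne_of_mem_erase hx'))
    (by
      intro z
      simp only [Finset.mem_filter, hu, Finset.mem_erase]
      constructor
      · rintro ⟨-, x, hx, h1, h2⟩; exact ⟨x, ⟨h1, hx⟩, h2⟩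
      · rintro ⟨x, ⟨h1, hx⟩, h2⟩; exact ⟨Or.inl ⟨x, hx, h1, h2⟩, x, hx, h1, h2⟩)
  have h2 := IsOrientation.rename ho' (fun y => some (q y)) (u.filter fun z => ∃ y ∈ t, q y = z)
    (by simp) (by simpa using hq)
    (by
      intro z
      simp only [Finset.mem_filter, hu, Option.some.injEq]
      constructor
      · rintro ⟨-, h⟩; exact h
      · intro h; exact ⟨Or.inr h, h⟩)
  have h3 := h1.mul h2 (by
    rw [Finset.disjoint_left]
    rintro z hz hz'
    simp only [Finset.mem_filter] at hz hz'
    obtain ⟨-, x, hx, hxa, hxz⟩ := hz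
    obtain ⟨-, y, hy, hyz⟩ := hz'
    exact hpq x hx hxa y hy (by rw [hxz, hyz]))
  have h4 : (u.filter fun z => ∃ x ∈ s, x ≠ a ∧ p x = some z) ∪
      (u.filter fun z => ∃ y ∈ t, q y = z) = u := by
    rw [← Finset.filter_or]
    exact Finset.filter_true_of_mem fun z hz => (hu z).1 hz
  rw [h4] at h3
  exact h3.mem
/-! ### Forests of rooted binary trees -/

/-- A forest of rooted binary trees, not planar, with leaves bijectively labelled by `I`.
An edge of the forest is encoded by its cluster, the set of the leaves above it; the clusters of
a forest are exactly the nonempty pairwise nested-or-disjoint sets, containing all singletons,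
each of which is a singleton or the disjoint union of two other ones. An inner vertex is encoded by
the cluster of its outgoing edge, so that inner vertices are the clusters with at least two
elements, and the trees (or the roots) of the forest are the maximal clusters. -/
@[ext]
structure Forest (I : Type*) [Fintype I] [DecidableEq I] where
  clusters : Finset (Finset I)
  singleton_mem : ∀ i, {i} ∈ clusters
  nonempty : ∀ A ∈ clusters, A.Nonempty
  laminar : ∀ A ∈ clusters, ∀ B ∈ clusters, A ⊆ B ∨ B ⊆ A ∨ Disjoint A B
  split : ∀ A ∈ clusters, 1 < A.card →
    ∃ B ∈ clusters, ∃ C ∈ clusters, Disjoint B C ∧ B ∪ C = A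

namespace Forest

variable {I J K : Type*} [Fintype I] [DecidableEq I] [Fintype J] [DecidableEq J]
  [Fintype K] [DecidableEq K]

instance : DecidableEq (Forest I) := fun F G => decidable_of_iff (F.clusters = G.clusters)
  ⟨Forest.ext, fun h => by rw [h]⟩

instance : Fintype (Forest I) :=
  Fintype.ofInjective Forest.clusters fun _ _ h => Forest.ext h

/-- The inner vertices. -/
def verts (F : Forest I) : Finset (Finset I) := F.clusters.filter fun A => 1 < A.card

/-- The roots, i.e. the trees. -/
def roots (F : Forest I) : Finset (Finset I) :=
  F.clusters.filter fun A => ∀ B ∈ F.clusters, A ⊆ B → A = B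

/-- The edges between two inner vertices. -/
def innerEdges (F : Forest I) : Finset (Finset I) := F.verts.filter fun A => A ∉ F.roots

/-- The roots of the trees without inner vertex, where the leaf is joined to the root. -/
def trivialTrees (F : Forest I) : Finset (Finset I) := F.roots.filter fun A => A ∉ F.verts

/-- The root of the tree that contains the leaf `i`. -/
def rootOf (F : Forest I) (i : I) : Finset I := (F.clusters.filter fun A => i ∈ A).sup id

/-- The two incoming edges of the inner vertex `v`. -/
def children (F : Forest I) (v : Finset I) : Finset (Finset I) :=
  F.clusters.filter fun C => C ⊂ v ∧ ∀ D ∈ F.clusters, C ⊂ D → ¬ D ⊂ v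

/-- The inner vertices on the path from the leaf `i` to the root of its tree. -/
def path (F : Forest I) (i : I) : Finset (Finset I) := F.verts.filter fun A => i ∈ A

/-- The set of leaves of the branch that is joined, at the inner vertex `D`, to the path from the
leaf `i` to the root. -/
def branch (F : Forest I) (i : I) (D : Finset I) : Finset I :=
  D.filter fun x => ∀ E ∈ F.clusters, i ∈ E → E ⊂ D → x ∉ E

set_option linter.unusedSectionVars false

section lemmas

variable (F : Forest I)

theorem mem_verts {A : Finset I} : A ∈ F.verts ↔ A ∈ F.clusters ∧ 1 < A.card := by
  simp [verts]

theorem mem_roots {A : Finset I} :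
    A ∈ F.roots ↔ A ∈ F.clusters ∧ ∀ B ∈ F.clusters, A ⊆ B → A = B := by
  simp [roots]

theorem mem_path {i : I} {A : Finset I} :
    A ∈ F.path i ↔ A ∈ F.clusters ∧ 1 < A.card ∧ i ∈ A := by
  simp [path, mem_verts, and_assoc]

theorem mem_children {v C : Finset I} : C ∈ F.children v ↔
    C ∈ F.clusters ∧ C ⊂ v ∧ ∀ D ∈ F.clusters, C ⊂ D → ¬ D ⊂ v := by
  simp [children]

theorem mem_branch {i x : I} {D : Finset I} : x ∈ F.branch i D ↔
    x ∈ D ∧ ∀ E ∈ F.clusters, i ∈ E → E ⊂ D → x ∉ E := by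
  simp [branch]

theorem chain {A B : Finset I} (hA : A ∈ F.clusters) (hB : B ∈ F.clusters) {x : I} (h : x ∈ A)
    (h' : x ∈ B) : A ⊆ B ∨ B ⊆ A := by
  rcases F.laminar A hA B hB with h1 | h1 | h1
  · exact Or.inl h1
  · exact Or.inr h1
  · exact absurd h' (Finset.disjoint_left.1 h1 h)

theorem exists_root {A : Finset I} (hA : A ∈ F.clusters) : ∃ r ∈ F.roots, A ⊆ r := by
  obtain ⟨r, hr, hm⟩ := (F.clusters.filter fun B => A ⊆ B).exists_max_image Finset.card
    ⟨A, by simp [hA]⟩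
  simp only [Finset.mem_filter, and_imp] at hr hm
  exact ⟨r, F.mem_roots.2 ⟨hr.1, fun B hB hrB =>
    Finset.eq_of_subset_of_card_le hrB (hm B hB (hr.2.trans hrB))⟩, hr.2⟩

theorem subset_root {r C : Finset I} (hr : r ∈ F.roots) (hC : C ∈ F.clusters) {x : I}
    (h : x ∈ r) (h' : x ∈ C) : C ⊆ r := by
  rw [mem_roots] at hr
  rcases F.chain hr.1 hC h h' with h1 | h1
  · exact (hr.2 C hC h1).ge
  · exact h1

theorem root_unique {r r' : Finset I} (hr : r ∈ F.roots) (hr' : r' ∈ F.roots) {x : I}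
    (h : x ∈ r) (h' : x ∈ r') : r = r' :=
  (F.subset_root hr' (F.mem_roots.1 hr).1 h' h).antisymm
    (F.subset_root hr (F.mem_roots.1 hr').1 h h')

theorem rootOf_eq {r : Finset I} (hr : r ∈ F.roots) {i : I} (h : i ∈ r) : F.rootOf i = r := by
  apply le_antisymm
  · refine Finset.sup_le fun A hA => ?_
    simp only [Finset.mem_filter] at hA
    exact F.subset_root hr hA.1 h hA.2
  · exact Finset.le_sup (f := id) (b := r) (by simp [(F.mem_roots.1 hr).1, h])

theorem rootOf_mem (i : I) : F.rootOf i ∈ F.roots := by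
  obtain ⟨r, hr, hi⟩ := F.exists_root (F.singleton_mem i)
  rwa [F.rootOf_eq hr (hi (by simp))]

theorem mem_rootOf (i : I) : i ∈ F.rootOf i := by
  obtain ⟨r, hr, hi⟩ := F.exists_root (F.singleton_mem i)
  rw [F.rootOf_eq hr (hi (by simp))]
  exact hi (by simp)

theorem ne_rootOf {r : Finset I} (hr : r ∈ F.roots) {i : I} : r ≠ F.rootOf i ↔ i ∉ r := by
  constructor
  · exact fun h h' => h (F.rootOf_eq hr h').symm
  · rintro h rfl
    exact h (F.mem_rootOf i)

theorem exists_branch {i : I} {D : Finset I} (hD : D ∈ F.path i) :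
    ∃ B ∈ F.clusters, F.branch i D ∈ F.clusters ∧ i ∈ B ∧ Disjoint B (F.branch i D) ∧
      B ∪ F.branch i D = D := by
  rw [mem_path] at hD
  have key : ∀ B ∈ F.clusters, ∀ C ∈ F.clusters, Disjoint B C → B ∪ C = D → i ∈ B →
      F.branch i D = C := by
    intro B hB C hC hd hu hi
    ext x
    rw [mem_branch]
    constructor
    · rintro ⟨hx, h⟩
      have hBD : B ⊂ D := by
        rw [← hu]
        refine Finset.ssubset_iff_subset_ne.2 ⟨Finset.subset_union_left, fun h => ?_⟩
        obtain ⟨y, hy⟩ := F.nonempty C hC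
        exact Finset.disjoint_left.1 hd (h ▸ Finset.mem_union_right _ hy) hy
      have := h B hB hi hBD
      rw [← hu, Finset.mem_union] at hx
      tauto
    · intro hx
      refine ⟨hu ▸ Finset.mem_union_right _ hx, fun E hE hiE hED hxE => ?_⟩
      have hiC : i ∉ C := Finset.disjoint_left.1 hd hi
      rcases F.chain hE hC hxE hx with h1 | h1
      · exact hiC (h1 hiE)
      · rcases F.chain hE hB hiE hi with h2 | h2
        · exact Finset.disjoint_left.1 hd (h2 hxE) hx
        · exact hED.2 (hu ▸ Finset.union_subset h2 h1)
  obtain ⟨B, hB, C, hC, hd, hu⟩ := F.split D hD.1 hD.2.1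
  rcases Finset.mem_union.1 (hu ▸ hD.2.2 : i ∈ B ∪ C) with hi | hi
  · have := key B hB C hC hd hu hi
    exact ⟨B, hB, this ▸ hC, hi, this ▸ hd, this ▸ hu⟩
  · rw [Finset.union_comm] at hu
    have := key C hC B hB hd.symm hu hi
    exact ⟨C, hC, this ▸ hB, hi, this ▸ hd.symm, this ▸ hu⟩

theorem branch_mem {i : I} {D : Finset I} (hD : D ∈ F.path i) : F.branch i D ∈ F.clusters := by
  obtain ⟨B, hB, h1, -⟩ := F.exists_branch hD
  exact h1

theorem branch_subset {i : I} {D : Finset I} : F.branch i D ⊆ D := Finset.filter_subset _ _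

theorem notMem_branch {i : I} {D : Finset I} (hD : D ∈ F.path i) : i ∉ F.branch i D := by
  obtain ⟨B, hB, h1, hi, hd, -⟩ := F.exists_branch hD
  exact Finset.disjoint_left.1 hd hi

theorem subset_of_mem_branch {i x : I} {C D : Finset I} (hD : D ∈ F.path i)
    (hC : C ∈ F.clusters) (hi : i ∈ C) (hx : x ∈ F.branch i D) (hxC : x ∈ C) : D ⊆ C := by
  rw [mem_branch] at hx
  rcases F.chain ((F.mem_path.1 hD).1) hC (F.mem_path.1 hD).2.2 hi with h | h
  · exact h
  · by_contra h'
    exact hx.2 C hC hi ⟨h, h'⟩ hxC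

theorem branch_unique {i x : I} {D D' : Finset I} (hD : D ∈ F.path i) (hD' : D' ∈ F.path i)
    (h : x ∈ F.branch i D) (h' : x ∈ F.branch i D') : D = D' := by
  have h1 := F.mem_path.1 hD
  have h2 := F.mem_path.1 hD'
  exact (F.subset_of_mem_branch hD h2.1 h2.2.2 h (F.branch_subset h')).antisymm
    (F.subset_of_mem_branch hD' h1.1 h1.2.2 h' (F.branch_subset h))

theorem exists_mem_branch {i x : I} {C : Finset I} (hC : C ∈ F.clusters) (hi : i ∈ C) (hx : x ∈ C)
    (hxi : x ≠ i) : ∃ D ∈ F.path i, D ⊆ C ∧ x ∈ F.branch i D := by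
  obtain ⟨D, hD, hm⟩ := (F.clusters.filter fun D => i ∈ D ∧ x ∈ D).exists_min_image Finset.card
    ⟨C, by simp [hC, hi, hx]⟩
  simp only [Finset.mem_filter, and_imp] at hD hm
  have hDp : D ∈ F.path i :=
    F.mem_path.2 ⟨hD.1, Finset.one_lt_card.2 ⟨x, hD.2.2, i, hD.2.1, hxi⟩, hD.2.1⟩
  have hxb : x ∈ F.branch i D := F.mem_branch.2 ⟨hD.2.2, fun E hE hiE hED hxE =>
    absurd (Finset.card_lt_card hED) (not_lt.2 (hm E hE hiE hxE))⟩
  exact ⟨D, hDp, F.subset_of_mem_branch hDp hC hi hxb hx, hxb⟩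

theorem subset_branch {i x : I} {C D : Finset I} (hD : D ∈ F.path i) (hC : C ∈ F.clusters)
    (hi : i ∉ C) (hx : x ∈ F.branch i D) (hxC : x ∈ C) : C ⊆ F.branch i D := by
  obtain ⟨B, hB, h1, hiB, hd, hu⟩ := F.exists_branch hD
  have hDc := (F.mem_path.1 hD)
  have hCD : C ⊆ D := by
    rcases F.chain hC hDc.1 hxC (F.branch_subset hx) with h | h
    · exact h
    · exact absurd (h hDc.2.2) hi
  have hxB : x ∉ B := fun h => Finset.disjoint_left.1 hd h hx
  have hCB : Disjoint C B := by
    rcases F.laminar C hC B hB with h | h | h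
    · exact absurd (h hxC) hxB
    · exact absurd (h hiB) hi
    · exact h
  intro y hy
  have := hCD hy
  rw [← hu, Finset.mem_union] at this
  exact this.resolve_left (Finset.disjoint_left.1 hCB hy)

theorem exists_children {v : Finset I} (hv : v ∈ F.verts) : ∃ B ∈ F.clusters, ∃ C ∈ F.clusters,
    Disjoint B C ∧ B ∪ C = v ∧ B ≠ C ∧ F.children v = {B, C} := by
  rw [mem_verts] at hv
  obtain ⟨B, hB, C, hC, hd, hu⟩ := F.split v hv.1 hv.2
  obtain ⟨b, hb⟩ := F.nonempty B hB
  obtain ⟨c, hc⟩ := F.nonempty C hC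
  have hbC : b ∉ C := Finset.disjoint_left.1 hd hb
  have hcB : c ∉ B := fun h => Finset.disjoint_left.1 hd h hc
  have hBv : B ⊂ v := ⟨hu ▸ Finset.subset_union_left, fun h =>
    hcB (h (hu ▸ Finset.mem_union_right _ hc))⟩
  have hCv : C ⊂ v := ⟨hu ▸ Finset.subset_union_right, fun h =>
    hbC (h (hu ▸ Finset.mem_union_left _ hb))⟩
  refine ⟨B, hB, C, hC, hd, hu, fun h => hbC (h ▸ hb), ?_⟩
  have sub : ∀ D ∈ F.clusters, D ⊂ v → D ⊆ B ∨ D ⊆ C := by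
    intro D hD hDv
    rcases F.laminar D hD B hB with h | h | h
    · exact Or.inl h
    · rcases F.laminar D hD C hC with h' | h' | h'
      · exact Or.inr h'
      · exact absurd (hu ▸ Finset.union_subset h h') hDv.2
      · left
        intro x hx
        have := hDv.1 hx
        rw [← hu, Finset.mem_union] at this
        exact this.resolve_right (Finset.disjoint_left.1 h' hx)
    · right
      intro x hx
      have := hDv.1 hx
      rw [← hu, Finset.mem_union] at this
      exact this.resolve_left (Finset.disjoint_left.1 h hx)
  ext D
  rw [mem_children, Finset.mem_insert, Finset.mem_singleton]
  constructor
  · rintro ⟨hD, hDv, hm⟩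
    rcases sub D hD hDv with h | h
    · left
      by_contra hne
      exact hm B hB (Finset.ssubset_iff_subset_ne.2 ⟨h, hne⟩) hBv
    · right
      by_contra hne
      exact hm C hC (Finset.ssubset_iff_subset_ne.2 ⟨h, hne⟩) hCv
  · rintro (rfl | rfl)
    · refine ⟨hB, hBv, fun E hE hDE hEv => ?_⟩
      rcases sub E hE hEv with h | h
      · exact hDE.2 h
      · exact hbC (h (hDE.1 hb))
    · refine ⟨hC, hCv, fun E hE hDE hEv => ?_⟩
      rcases sub E hE hEv with h | h
      · exact hcB (h (hDE.1 hc))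
      · exact hDE.2 h

theorem children_unique {v w C : Finset I} (hv : v ∈ F.clusters) (hw : w ∈ F.clusters)
    (h : C ∈ F.children v) (h' : C ∈ F.children w) : v = w := by
  rw [mem_children] at h h'
  obtain ⟨x, hx⟩ := F.nonempty C h.1
  rcases F.chain hv hw (h.2.1.1 hx) (h'.2.1.1 hx) with h1 | h1
  · by_contra hne
    exact h'.2.2 v hv h.2.1 (Finset.ssubset_iff_subset_ne.2 ⟨h1, hne⟩)
  · by_contra hne
    exact h.2.2 w hw h'.2.1 (Finset.ssubset_iff_subset_ne.2 ⟨h1, Ne.symm hne⟩)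

theorem exists_parent {C : Finset I} (hC : C ∈ F.clusters) (hr : C ∉ F.roots) :
    ∃ v ∈ F.verts, C ∈ F.children v := by
  have : ∃ B ∈ F.clusters, C ⊂ B := by
    by_contra! hn
    exact hr (F.mem_roots.2 ⟨hC, fun B hB hCB => by
      by_contra hne
      exact hn B hB (Finset.ssubset_iff_subset_ne.2 ⟨hCB, hne⟩)⟩)
  obtain ⟨B, hB, hCB⟩ := this
  obtain ⟨v, hv, hm⟩ := (F.clusters.filter fun D => C ⊂ D).exists_min_image Finset.card
    ⟨B, by simp [hB, hCB]⟩
  simp only [Finset.mem_filter, and_imp] at hv hm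
  refine ⟨v, F.mem_verts.2 ⟨hv.1, ?_⟩, F.mem_children.2 ⟨hC, hv.2, fun D hD hCD hDv =>
    absurd (Finset.card_lt_card hDv) (not_lt.2 (hm D hD hCD))⟩⟩
  have h1 := Finset.card_lt_card hv.2
  have h2 := Finset.card_pos.2 (F.nonempty C hC)
  omega

theorem notMem_roots_of_mem_children {v C : Finset I} (hv : v ∈ F.clusters)
    (h : C ∈ F.children v) : C ∉ F.roots := by
  rw [mem_children] at h
  intro hr
  exact h.2.1.ne ((F.mem_roots.1 hr).2 v hv h.2.1.1)

theorem roots_eq (s : Finset (Finset I)) (h1 : ∀ A ∈ s, A ∈ F.clusters)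
    (h2 : ∀ A ∈ F.clusters, ∃ B ∈ s, A ⊆ B)
    (h3 : ∀ A ∈ s, ∀ B ∈ s, ∀ x, x ∈ A → x ∈ B → A = B) : F.roots = s := by
  ext A
  rw [mem_roots]
  constructor
  · rintro ⟨hA, hm⟩
    obtain ⟨B, hB, hAB⟩ := h2 A hA
    rwa [hm B (h1 B hB) hAB]
  · intro hA
    refine ⟨h1 A hA, fun B hB hAB => ?_⟩
    obtain ⟨C, hC, hBC⟩ := h2 B hB
    obtain ⟨x, hx⟩ := F.nonempty A (h1 A hA)
    have := h3 A hA C hC x hx (hBC (hAB hx))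
    exact hAB.antisymm (this ▸ hBC)

end lemmas

/-! ### Grafting -/

/-- For a bijection `e` of `(I ∖ {i}) ⊔ J` with `K`, the subset `(S ∖ {i}) ⊔ A` of `K`. -/
def glue {i : I} (e : {x : I // x ≠ i} ⊕ J ≃ K) (S : Finset I) (A : Finset J) : Finset K :=
  ((S.subtype (fun x => x ≠ i)).disjSum A).map e.toEmbedding

section glue

variable {i : I} (e : {x : I // x ≠ i} ⊕ J ≃ K)

@[simp] theorem mem_glue_inl {S : Finset I} {A : Finset J} {x : {x : I // x ≠ i}} :
    e (Sum.inl x) ∈ glue e S A ↔ x.1 ∈ S := by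
  simp [glue]

@[simp] theorem mem_glue_inr {S : Finset I} {A : Finset J} {y : J} :
    e (Sum.inr y) ∈ glue e S A ↔ y ∈ A := by
  simp [glue]

theorem forall_glue {p : K → Prop} :
    (∀ k, p k) ↔ (∀ x, p (e (Sum.inl x))) ∧ ∀ y, p (e (Sum.inr y)) := by
  rw [← e.forall_congr_right, Sum.forall]

theorem glue_subset {S S' : Finset I} {A A' : Finset J} :
    glue e S A ⊆ glue e S' A' ↔ (∀ x ∈ S, x ≠ i → x ∈ S') ∧ A ⊆ A' := by
  simp only [Finset.subset_iff, forall_glue e, mem_glue_inl, mem_glue_inr, Subtype.forall]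
  tauto

theorem glue_disjoint {S S' : Finset I} {A A' : Finset J} :
    Disjoint (glue e S A) (glue e S' A') ↔ (∀ x ∈ S, x ≠ i → x ∉ S') ∧ Disjoint A A' := by
  simp only [Finset.disjoint_left, forall_glue e, mem_glue_inl, mem_glue_inr, Subtype.forall]
  tauto

theorem glue_union {S S' : Finset I} {A A' : Finset J} :
    glue e S A ∪ glue e S' A' = glue e (S ∪ S') (A ∪ A') := by
  rw [Finset.ext_iff, forall_glue e]
  simp

theorem exists_mem_glue {S : Finset I} {A : Finset J} {p : K → Prop} :
    (∃ k ∈ glue e S A, p k) ↔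
      (∃ x, ∃ h : x ≠ i, x ∈ S ∧ p (e (Sum.inl ⟨x, h⟩))) ∨ ∃ y ∈ A, p (e (Sum.inr y)) := by
  constructor
  · rintro ⟨k, hk, hp⟩
    obtain ⟨z, rfl⟩ := e.surjective k
    rcases z with ⟨x, hx⟩ | y
    · exact Or.inl ⟨x, hx, by simpa using hk, hp⟩
    · exact Or.inr ⟨y, by simpa using hk, hp⟩
  · rintro (⟨x, hx, h1, h2⟩ | ⟨y, h1, h2⟩)
    · exact ⟨_, by simpa using h1, h2⟩
    · exact ⟨_, by simpa using h1, h2⟩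

theorem glue_singleton_left (x : {x : I // x ≠ i}) :
    glue e {x.1} ∅ = {e (Sum.inl x)} := by
  rw [Finset.ext_iff, forall_glue e]
  simp [Subtype.ext_iff]

theorem glue_singleton_right (y : J) : glue e ∅ {y} = {e (Sum.inr y)} := by
  rw [Finset.ext_iff, forall_glue e]
  simp

end glue

section graft

variable (F : Forest I) (i : I) (G : Forest J)
  (c : {D // D ∈ F.path i} → {A // A ∈ G.roots})

/-- The union of the branches that are joined to the path from `i` to the root at those inner
vertices `D ⊆ C` to which the tree `A` is assigned by `c`. -/
def lump (C : Finset I) (A : Finset J) : Finset I :=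
  (Finset.univ.filter fun D : {D // D ∈ F.path i} => D.1 ⊆ C ∧ (c D).1 = A).biUnion
    fun D => F.branch i D.1

theorem mem_lump {C : Finset I} {A : Finset J} {x : I} : x ∈ lump F i G c C A ↔
    ∃ D : {D // D ∈ F.path i}, (D.1 ⊆ C ∧ (c D).1 = A) ∧ x ∈ F.branch i D.1 := by
  simp [lump]

variable {i}
variable (e : {x : I // x ≠ i} ⊕ J ≃ K)

/-- The clusters of a graft, see `Forest.graft`. -/
def graftClusters : Finset (Finset K) :=
  ((F.clusters.filter fun C => i ∉ C).image fun C => glue e C ∅) ∪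
    (G.clusters.image fun A => glue e ∅ A) ∪
    Finset.univ.image fun D : {D // D ∈ F.path i} => glue e (lump F i G c D.1 (c D).1) (c D).1

theorem mem_graftClusters {S : Finset K} : S ∈ graftClusters F G c e ↔
    (∃ C ∈ F.clusters, i ∉ C ∧ S = glue e C ∅) ∨ (∃ A ∈ G.clusters, S = glue e ∅ A) ∨
      ∃ D : {D // D ∈ F.path i}, S = glue e (lump F i G c D.1 (c D).1) (c D).1 := by
  simp only [graftClusters, Finset.mem_union, Finset.mem_image, Finset.mem_filter,
    Finset.mem_univ, true_and, or_assoc, eq_comm (a := S), and_assoc]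

theorem lump_subset {C : Finset I} {A : Finset J} {x : I} (hC : C ∈ F.clusters) (hi : i ∉ C)
    {B : Finset I} (hx : x ∈ C) (hx' : x ∈ lump F i G c B A) : C ⊆ lump F i G c B A := by
  rw [mem_lump] at hx'
  obtain ⟨D, hD, hxD⟩ := hx'
  intro y hy
  exact (mem_lump F i G c).2 ⟨D, hD, F.subset_branch D.2 hC hi hxD hx hy⟩

theorem lump_disjoint {C C' : Finset I} {A A' : Finset J} (h : A ≠ A') {x : I}
    (hx : x ∈ lump F i G c C A) : x ∉ lump F i G c C' A' := by
  rw [mem_lump] at hx ⊢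
  rintro ⟨D', hD', hx'⟩
  obtain ⟨D, hD, hx⟩ := hx
  have : D = D' := Subtype.ext (F.branch_unique D.2 D'.2 hx hx')
  subst this
  exact h (hD.2.symm.trans hD'.2)

theorem notMem_lump {C : Finset I} {A : Finset J} : i ∉ lump F i G c C A := by
  rw [mem_lump]
  rintro ⟨D, -, h⟩
  exact F.notMem_branch D.2 h

theorem root_disjoint {A A' : Finset J} (hA : A ∈ G.roots) (hA' : A' ∈ G.roots) (h : A ≠ A') :
    Disjoint A A' := by
  rw [Finset.disjoint_left]
  exact fun x hx hx' => h (G.root_unique hA hA' hx hx')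

/-- Let `T` be the tree of `F` that contains the leaf `i`. The forest obtained by grafting the
trees of `G` into `F`, when the tree `c D` is assigned to each inner vertex `D` of the path from
`i` to the root of `T`: the trees of `F` other than `T` are kept, the path is removed from `T`, and
then, going down along the path, the branch of `T` at the inner vertex `D` is joined by a new
inner vertex to the tree that contains `c D`. The leaves are labelled by `K` through `e`. -/
def graft : Forest K where
  clusters := graftClusters F G c e
  singleton_mem := by
    rw [forall_glue e]
    refine ⟨fun x => ?_, fun y => ?_⟩
    · rw [mem_graftClusters, ← glue_singleton_left]
      exact Or.inl ⟨{x.1}, F.singleton_mem _, by simpa using x.2.symm, rfl⟩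
    · rw [mem_graftClusters, ← glue_singleton_right]
      exact Or.inr (Or.inl ⟨_, G.singleton_mem _, rfl⟩)
  nonempty := by
    intro S hS
    rw [mem_graftClusters] at hS
    rcases hS with ⟨C, hC, hi, rfl⟩ | ⟨A, hA, rfl⟩ | ⟨D, rfl⟩
    · obtain ⟨x, hx⟩ := F.nonempty C hC
      exact ⟨e (Sum.inl ⟨x, fun h => hi (h ▸ hx)⟩), by simpa using hx⟩
    · obtain ⟨y, hy⟩ := G.nonempty A hA
      exact ⟨e (Sum.inr y), by simpa using hy⟩
    · obtain ⟨y, hy⟩ := G.nonempty _ (G.mem_roots.1 (c D).2).1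
      exact ⟨e (Sum.inr y), by simpa using hy⟩
  laminar := by
    have c13 : ∀ C ∈ F.clusters, i ∉ C → ∀ D : {D // D ∈ F.path i},
        glue e C ∅ ⊆ glue e (lump F i G c D.1 (c D).1) (c D).1 ∨
        Disjoint (glue e C ∅) (glue e (lump F i G c D.1 (c D).1) (c D).1) := by
      intro C hC hi D
      rw [glue_subset, glue_disjoint]
      by_cases h : ∃ x ∈ C, x ∈ lump F i G c D.1 (c D).1
      · obtain ⟨x, hx, hx'⟩ := h
        exact Or.inl ⟨fun y hy _ => lump_subset F G c hC hi hx hx' hy, by simp⟩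
      · push Not at h
        exact Or.inr ⟨fun y hy _ => h y hy, by simp⟩
    have c23 : ∀ A ∈ G.clusters, ∀ D : {D // D ∈ F.path i},
        glue e ∅ A ⊆ glue e (lump F i G c D.1 (c D).1) (c D).1 ∨
        Disjoint (glue e ∅ A) (glue e (lump F i G c D.1 (c D).1) (c D).1) := by
      intro A hA D
      rw [glue_subset, glue_disjoint]
      by_cases h : ∃ x ∈ A, x ∈ (c D).1
      · obtain ⟨x, hx, hx'⟩ := h
        exact Or.inl ⟨by simp, G.subset_root (c D).2 hA hx' hx⟩
      · push Not at h
        exact Or.inr ⟨by simp, Finset.disjoint_left.2 h⟩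
    have c33 : ∀ D D' : {D // D ∈ F.path i}, D.1 ⊆ D'.1 →
        glue e (lump F i G c D.1 (c D).1) (c D).1 ⊆ glue e (lump F i G c D'.1 (c D').1) (c D').1 ∨
        Disjoint (glue e (lump F i G c D.1 (c D).1) (c D).1)
          (glue e (lump F i G c D'.1 (c D').1) (c D').1) := by
      intro D D' h
      rw [glue_subset, glue_disjoint]
      by_cases hc : c D = c D'
      · rw [hc]
        refine Or.inl ⟨fun x hx _ => ?_, subset_rfl⟩
        rw [mem_lump] at hx ⊢
        obtain ⟨E, hE, hx⟩ := hx
        exact ⟨E, ⟨hE.1.trans h, hE.2⟩, hx⟩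
      · have hc' : (c D).1 ≠ (c D').1 := fun h => hc (Subtype.ext h)
        exact Or.inr ⟨fun x hx _ => lump_disjoint F G c hc' hx,
          root_disjoint G (c D).2 (c D').2 hc'⟩
    intro S hS S' hS'
    rw [mem_graftClusters] at hS hS'
    rcases hS with ⟨C, hC, hi, rfl⟩ | ⟨A, hA, rfl⟩ | ⟨D, rfl⟩ <;>
      rcases hS' with ⟨C', hC', hi', rfl⟩ | ⟨A', hA', rfl⟩ | ⟨D', rfl⟩
    · simp only [glue_subset, glue_disjoint]
      rcases F.laminar C hC C' hC' with h | h | h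
      · exact Or.inl ⟨fun x hx _ => h hx, by simp⟩
      · exact Or.inr (Or.inl ⟨fun x hx _ => h hx, by simp⟩)
      · exact Or.inr (Or.inr ⟨fun x hx _ => Finset.disjoint_left.1 h hx, by simp⟩)
    · exact Or.inr (Or.inr ((glue_disjoint e).2 ⟨by simp, by simp⟩))
    · rcases c13 C hC hi D' with h | h
      · exact Or.inl h
      · exact Or.inr (Or.inr h)
    · exact Or.inr (Or.inr ((glue_disjoint e).2 ⟨by simp, by simp⟩))
    · simp only [glue_subset, glue_disjoint]
      rcases G.laminar A hA A' hA' with h | h | h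
      · exact Or.inl ⟨by simp, h⟩
      · exact Or.inr (Or.inl ⟨by simp, h⟩)
      · exact Or.inr (Or.inr ⟨by simp, h⟩)
    · rcases c23 A hA D' with h | h
      · exact Or.inl h
      · exact Or.inr (Or.inr h)
    · rcases c13 C' hC' hi' D with h | h
      · exact Or.inr (Or.inl h)
      · exact Or.inr (Or.inr h.symm)
    · rcases c23 A' hA' D with h | h
      · exact Or.inr (Or.inl h)
      · exact Or.inr (Or.inr h.symm)
    · have h1 := F.mem_path.1 D.2
      have h2 := F.mem_path.1 D'.2
      rcases F.chain h1.1 h2.1 h1.2.2 h2.2.2 with h | h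
      · rcases c33 D D' h with h | h
        · exact Or.inl h
        · exact Or.inr (Or.inr h)
      · rcases c33 D' D h with h | h
        · exact Or.inr (Or.inl h)
        · exact Or.inr (Or.inr h.symm)
  split := by
    intro S hS hcard
    rw [mem_graftClusters] at hS
    rcases hS with ⟨C, hC, hi, rfl⟩ | ⟨A, hA, rfl⟩ | ⟨D, rfl⟩
    · have hC1 : 1 < C.card := by
        obtain ⟨k, hk, k', hk', hne⟩ := Finset.one_lt_card.1 hcard
        obtain ⟨z, rfl⟩ := e.surjective k
        obtain ⟨z', rfl⟩ := e.surjective k'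
        rcases z with x | y <;> rcases z' with x' | y' <;> simp at hk hk'
        refine Finset.one_lt_card.2 ⟨x, hk, x', hk', fun h => hne ?_⟩
        rw [Subtype.ext h]
      obtain ⟨B, hB, B', hB', hd, hu⟩ := F.split C hC hC1
      refine ⟨glue e B ∅, (mem_graftClusters F G c e).2 (Or.inl ⟨B, hB, fun h => hi ?_, rfl⟩),
        glue e B' ∅, (mem_graftClusters F G c e).2 (Or.inl ⟨B', hB', fun h => hi ?_, rfl⟩),
        (glue_disjoint e).2 ⟨fun x hx _ => Finset.disjoint_left.1 hd hx, by simp⟩, ?_⟩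
      · exact hu ▸ Finset.mem_union_left _ h
      · exact hu ▸ Finset.mem_union_right _ h
      · rw [glue_union, hu]; simp
    · have hC1 : 1 < A.card := by
        obtain ⟨k, hk, k', hk', hne⟩ := Finset.one_lt_card.1 hcard
        obtain ⟨z, rfl⟩ := e.surjective k
        obtain ⟨z', rfl⟩ := e.surjective k'
        rcases z with x | y <;> rcases z' with x' | y' <;> simp at hk hk'
        exact Finset.one_lt_card.2 ⟨y, hk, y', hk', fun h => hne (by rw [h])⟩
      obtain ⟨B, hB, B', hB', hd, hu⟩ := G.split A hA hC1
      refine ⟨glue e ∅ B, (mem_graftClusters F G c e).2 (Or.inr (Or.inl ⟨B, hB, rfl⟩)),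
        glue e ∅ B', (mem_graftClusters F G c e).2 (Or.inr (Or.inl ⟨B', hB', rfl⟩)),
        (glue_disjoint e).2 ⟨by simp, hd⟩, ?_⟩
      rw [glue_union, hu]; simp
    · have hb : glue e (F.branch i D.1) ∅ ∈ graftClusters F G c e :=
        (mem_graftClusters F G c e).2
          (Or.inl ⟨_, F.branch_mem D.2, F.notMem_branch D.2, rfl⟩)
      by_cases hE : ∃ E : {D // D ∈ F.path i}, E.1 ⊂ D.1 ∧ c E = c D
      · obtain ⟨E, hE, hm⟩ := (Finset.univ.filter fun E : {D // D ∈ F.path i} =>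
          E.1 ⊂ D.1 ∧ c E = c D).exists_max_image (fun E => E.1.card)
          (by obtain ⟨E, hE⟩ := hE; exact ⟨E, by simpa using hE⟩)
        simp only [Finset.mem_filter, Finset.mem_univ, true_and, and_imp] at hE hm
        have hl : lump F i G c D.1 (c D).1 = lump F i G c E.1 (c E).1 ∪ F.branch i D.1 := by
          ext x
          rw [Finset.mem_union, mem_lump, mem_lump]
          constructor
          · rintro ⟨E', ⟨h1, h2⟩, h3⟩
            rcases h1.eq_or_ssubset with h1 | h1
            · exact Or.inr (h1 ▸ h3)
            · refine Or.inl ⟨E', ⟨?_, h2.trans (by rw [hE.2])⟩, h3⟩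
              have p1 := F.mem_path.1 E.2
              have p2 := F.mem_path.1 E'.2
              rcases F.chain p2.1 p1.1 p2.2.2 p1.2.2 with h4 | h4
              · exact h4
              · exact (Finset.eq_of_subset_of_card_le h4
                  (hm E' h1 (Subtype.ext h2))).ge
          · rintro (⟨E', ⟨h1, h2⟩, h3⟩ | h)
            · exact ⟨E', ⟨h1.trans hE.1.1, h2.trans (by rw [hE.2])⟩, h3⟩
            · exact ⟨D, ⟨subset_rfl, rfl⟩, h⟩
        refine ⟨_, (mem_graftClusters F G c e).2 (Or.inr (Or.inr ⟨E, rfl⟩)), _, hb, ?_, ?_⟩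
        · rw [glue_disjoint]
          refine ⟨fun x hx _ hx' => ?_, by simp⟩
          rw [mem_lump] at hx
          obtain ⟨E', ⟨h1, h2⟩, h3⟩ := hx
          have := F.branch_unique E'.2 D.2 h3 hx'
          rw [this] at h1
          exact hE.1.2 h1
        · rw [glue_union, hl, hE.2]
          simp
      · push Not at hE
        have hl : lump F i G c D.1 (c D).1 = F.branch i D.1 := by
          ext x
          rw [mem_lump]
          constructor
          · rintro ⟨E', ⟨h1, h2⟩, h3⟩
            rcases h1.eq_or_ssubset with h1 | h1
            · exact h1 ▸ h3
            · exact absurd (Subtype.ext h2) (hE E' h1)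
          · intro h
            exact ⟨D, ⟨subset_rfl, rfl⟩, h⟩
        refine ⟨glue e ∅ (c D).1, (mem_graftClusters F G c e).2
          (Or.inr (Or.inl ⟨_, (G.mem_roots.1 (c D).2).1, rfl⟩)), _, hb,
          (glue_disjoint e).2 ⟨by simp, by simp⟩, ?_⟩
        rw [glue_union, hl]
        simp

/-- The root, in the graft, of the tree that contains the tree `A` of `G`. -/
def graftRoot (A : Finset J) : Finset K := glue e (lump F i G c Finset.univ A) A

theorem mem_roots_graft {S : Finset K} : S ∈ (graft F G c e).roots ↔
    (∃ r ∈ F.roots, r ≠ F.rootOf i ∧ glue e r ∅ = S) ∨ ∃ A ∈ G.roots, graftRoot F G c e A = S := by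
  have : (graft F G c e).roots =
      ((F.roots.filter fun r => i ∉ r).image fun r => glue e r ∅) ∪
        G.roots.image (graftRoot F G c e) := by
    apply roots_eq
    · intro S hS
      simp only [Finset.mem_union, Finset.mem_image, Finset.mem_filter] at hS
      change S ∈ graftClusters F G c e
      rw [mem_graftClusters]
      rcases hS with ⟨r, ⟨hr, hi⟩, rfl⟩ | ⟨A, hA, rfl⟩
      · exact Or.inl ⟨r, (F.mem_roots.1 hr).1, hi, rfl⟩
      · right
        by_cases h : ∃ D, c D = ⟨A, hA⟩
        · right
          obtain ⟨D, hD, hm⟩ := (Finset.univ.filter fun D => c D = ⟨A, hA⟩).exists_max_image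
            (fun E => E.1.card) (by obtain ⟨D, hD⟩ := h; exact ⟨D, by simpa using hD⟩)
          simp only [Finset.mem_filter, Finset.mem_univ, true_and] at hD hm
          refine ⟨D, ?_⟩
          rw [hD, graftRoot]
          congr 1
          ext x
          rw [mem_lump, mem_lump]
          constructor
          · rintro ⟨E, ⟨-, h1⟩, h2⟩
            refine ⟨E, ⟨?_, h1⟩, h2⟩
            have p1 := F.mem_path.1 E.2
            have p2 := F.mem_path.1 D.2
            rcases F.chain p1.1 p2.1 p1.2.2 p2.2.2 with h4 | h4
            · exact h4
            · exact (Finset.eq_of_subset_of_card_le h4 (hm E (Subtype.ext h1))).ge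
          · rintro ⟨E, ⟨-, h1⟩, h2⟩
            exact ⟨E, ⟨Finset.subset_univ _, h1⟩, h2⟩
        · left
          refine ⟨A, (G.mem_roots.1 hA).1, ?_⟩
          rw [graftRoot]
          congr 1
          rw [Finset.eq_empty_iff_forall_notMem]
          intro x hx
          rw [mem_lump] at hx
          obtain ⟨E, ⟨-, h1⟩, h2⟩ := hx
          exact h ⟨E, Subtype.ext h1⟩
    · intro S hS
      change S ∈ graftClusters F G c e at hS
      have key : ∀ A ∈ G.roots, graftRoot F G c e A ∈
          ((F.roots.filter fun r => i ∉ r).image fun r => glue e r ∅) ∪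
            G.roots.image (graftRoot F G c e) := fun A hA =>
        Finset.mem_union_right _ (Finset.mem_image_of_mem _ hA)
      rw [mem_graftClusters] at hS
      rcases hS with ⟨C, hC, hi, rfl⟩ | ⟨A, hA, rfl⟩ | ⟨D, rfl⟩
      · obtain ⟨r, hr, hCr⟩ := F.exists_root hC
        by_cases hir : i ∈ r
        · obtain ⟨x, hx⟩ := F.nonempty C hC
          obtain ⟨D, hD, -, hxD⟩ := F.exists_mem_branch (F.mem_roots.1 hr).1 hir (hCr hx)
            (fun h => hi (h ▸ hx))
          refine ⟨_, key _ (c ⟨D, hD⟩).2, ?_⟩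
          rw [graftRoot, glue_subset]
          refine ⟨fun y hy _ => ?_, by simp⟩
          rw [mem_lump]
          exact ⟨⟨D, hD⟩, ⟨Finset.subset_univ _, rfl⟩, F.subset_branch hD hC hi hxD hx hy⟩
        · refine ⟨glue e r ∅, Finset.mem_union_left _ (Finset.mem_image_of_mem _ ?_), ?_⟩
          · simp [hr, hir]
          · exact (glue_subset e).2 ⟨fun x hx _ => hCr hx, subset_rfl⟩
      · obtain ⟨r, hr, hCr⟩ := G.exists_root hA
        exact ⟨_, key r hr, (glue_subset e).2 ⟨by simp, hCr⟩⟩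
      · refine ⟨_, key _ (c D).2, (glue_subset e).2 ⟨fun x hx _ => ?_, subset_rfl⟩⟩
        rw [mem_lump] at hx ⊢
        obtain ⟨E, ⟨-, h1⟩, h2⟩ := hx
        exact ⟨E, ⟨Finset.subset_univ _, h1⟩, h2⟩
    · have c12 : ∀ r ∈ F.roots, i ∉ r → ∀ A x, x ∈ glue e r ∅ →
          x ∉ graftRoot F G c e A := by
        intro r hr hi A x hx0
        have hd : Disjoint (glue e r ∅) (graftRoot F G c e A) := by
          rw [graftRoot, glue_disjoint]
          refine ⟨fun x hx _ hx' => hi ?_, Finset.disjoint_empty_left A⟩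
          rw [mem_lump] at hx'
          obtain ⟨E, -, h2⟩ := hx'
          have p := F.mem_path.1 E.2
          exact F.subset_root hr p.1 hx (F.branch_subset h2) p.2.2
        exact Finset.disjoint_left.1 hd hx0
      intro S hS S' hS' k hk hk'
      simp only [Finset.mem_union, Finset.mem_image, Finset.mem_filter] at hS hS'
      rcases hS with ⟨r, ⟨hr, hi⟩, rfl⟩ | ⟨A, hA, rfl⟩ <;>
        rcases hS' with ⟨r', ⟨hr', hi'⟩, rfl⟩ | ⟨A', hA', rfl⟩
      · obtain ⟨z, rfl⟩ := e.surjective k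
        rcases z with x | y <;> simp at hk hk'
        rw [F.root_unique hr hr' hk hk']
      · exact absurd hk' (c12 r hr hi _ _ hk)
      · exact absurd hk (c12 r' hr' hi' _ _ hk')
      · by_contra hne
        have hAA : A ≠ A' := fun h => hne (by rw [h])
        exact Finset.disjoint_left.1 ((glue_disjoint e).2
          ⟨fun x hx _ => lump_disjoint F G c hAA hx, root_disjoint G hA hA' hAA⟩) hk hk'
  rw [this]
  simp only [Finset.mem_union, Finset.mem_image, Finset.mem_filter]
  refine or_congr (exists_congr fun r => ?_) Iff.rfl
  constructor
  · rintro ⟨⟨h1, h2⟩, h3⟩; exact ⟨h1, (F.ne_rootOf h1).2 h2, h3⟩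
  · rintro ⟨h1, h2, h3⟩; exact ⟨⟨h1, (F.ne_rootOf h1).1 h2⟩, h3⟩

/-- The composition rule of determinants sends root-orientations of `F` and of `G` to
root-orientations of the graft. -/
theorem extComp_graft_mem {x : Ext (Finset I)} {y : Ext (Finset J)} (hx : x ∈ detSpace F.roots)
    (hy : y ∈ detSpace G.roots) :
    extComp (F.rootOf i) (fun r => some (glue e r ∅)) (graftRoot F G c e) x y ∈
      detSpace (graft F G c e).roots := by
  refine extComp_mem _ _ _ F.roots G.roots _ (F.rootOf_mem i) (fun r _ _ => ⟨_, rfl⟩) ?_ ?_ ?_ ?_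
    hx hy
  · intro r hr hri r' hr' hri' h
    obtain ⟨x, hx⟩ := F.nonempty r (F.mem_roots.1 hr).1
    have hxi : x ≠ i := fun h => (F.ne_rootOf hr).1 hri (h ▸ hx)
    have h1 : e (Sum.inl ⟨x, hxi⟩) ∈ glue e r ∅ := by simpa using hx
    rw [Option.some.inj h] at h1
    exact F.root_unique hr hr' hx (by simpa using h1)
  · intro A hA A' hA' h
    obtain ⟨y, hy⟩ := G.nonempty A (G.mem_roots.1 hA).1
    have h1 : e (Sum.inr y) ∈ graftRoot F G c e A := by simpa [graftRoot] using hy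
    rw [h] at h1
    exact G.root_unique hA hA' hy (by simpa [graftRoot] using h1)
  · intro r hr hri A hA h
    obtain ⟨y, hy⟩ := G.nonempty A (G.mem_roots.1 hA).1
    have h1 : e (Sum.inr y) ∈ graftRoot F G c e A := by simpa [graftRoot] using hy
    rw [← Option.some.inj h] at h1
    simp at h1
  · intro S
    rw [mem_roots_graft]
    simp

end graft

end Forest
set_option linter.unusedSectionVars false

/-! ### The operads -/

section operads

variable {I J K : Type*} [Fintype I] [DecidableEq I] [Fintype J] [DecidableEq J]
  [Fintype K] [DecidableEq K]

variable (I) in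
/-- The space `Det(I)` of the operad `Det`. It is in degree `|I| - 1`. -/
abbrev OpDet : Submodule ℚ (Ext I) := detSpace (Finset.univ : Finset I)

variable (I) in
/-- The space `B(I)` of the operad `B`, with basis the root-oriented forests `o ⊗ F` on `I`
(one of the two orientations `o` of the roots of `F` being fixed for each forest `F`): an element
is given by its components in the determinant lines of the sets of roots of the forests. The
component of `F` is in degree `|roots of F| - 1`. -/
abbrev OpB : Submodule ℚ (Forest I → Ext (Finset I)) :=
  Submodule.pi Set.univ fun F : Forest I => detSpace F.roots

variable (I) in
/-- The space `Bess(I)` of the operad `Bess = Det ⊗ B`. -/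
abbrev Bess : Type _ := OpDet I ⊗[ℚ] OpB I

variable {i : I} (e : {x : I // x ≠ i} ⊕ J ≃ K)

/-- The inclusion of `I ∖ {i}` in `K`. -/
def leafInl (x : I) : Option K := if h : x ≠ i then some (e (Sum.inl ⟨x, h⟩)) else none

theorem extComp_leaf_mem {x : Ext I} {y : Ext J} (hx : x ∈ OpDet I) (hy : y ∈ OpDet J) :
    extComp i (leafInl e) (fun y => e (Sum.inr y)) x y ∈ OpDet K := by
  refine extComp_mem _ _ _ Finset.univ Finset.univ _ (Finset.mem_univ _) ?_ ?_ ?_ ?_ ?_ hx hy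
  · intro x _ hx
    simp [leafInl, hx]
  · intro x _ hx x' _ hx'
    simp [leafInl, hx, hx']
  · simp
  · intro x _ hx
    simp [leafInl, hx]
  · intro z
    obtain ⟨z, rfl⟩ := e.surjective z
    rcases z with ⟨x, hx⟩ | y
    · simp only [Finset.mem_univ, true_and, true_iff]
      exact Or.inl ⟨x, hx, by simp [leafInl, hx]⟩
    · simp

/-- The composition `∘_i : Det(I) ⊗ Det(J) → Det(K)`, where `K` is the set `(I ∖ {i}) ⊔ J`, with
`(x ∧ i) ∘_i y = x ∧ y`. -/
def detComp : OpDet I →ₗ[ℚ] OpDet J →ₗ[ℚ] OpDet K :=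
  LinearMap.mk₂ ℚ
    (fun x y => ⟨extComp i (leafInl e) (fun y => e (Sum.inr y)) x y, extComp_leaf_mem e x.2 y.2⟩)
    (fun x x' y => Subtype.ext (by simp)) (fun a x y => Subtype.ext (by simp))
    (fun x y y' => Subtype.ext (by simp)) (fun a x y => Subtype.ext (by simp))

/-- The composition of `B` on families of elements of exterior algebras. -/
def bCompAux : (Forest I → Ext (Finset I)) →ₗ[ℚ] (Forest J → Ext (Finset J)) →ₗ[ℚ]
    (Forest K → Ext (Finset K)) :=
  ∑ F : Forest I, ∑ G : Forest J, ∑ c : {D // D ∈ F.path i} → {A // A ∈ G.roots},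
    ((extComp (F.rootOf i) (fun r => some (Forest.glue e r ∅)) (Forest.graftRoot F G c e)).compl₁₂
      (LinearMap.proj F) (LinearMap.proj G)).compr₂
      (LinearMap.single ℚ (fun _ : Forest K => Ext (Finset K)) (Forest.graft F G c e))

theorem bCompAux_mem {x : Forest I → Ext (Finset I)} {y : Forest J → Ext (Finset J)}
    (hx : x ∈ OpB I) (hy : y ∈ OpB J) : bCompAux e x y ∈ OpB K := by
  simp only [bCompAux, LinearMap.sum_apply]
  refine Submodule.sum_mem _ fun F _ => Submodule.sum_mem _ fun G _ =>
    Submodule.sum_mem _ fun c _ => ?_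
  simp only [LinearMap.compr₂_apply, LinearMap.compl₁₂_apply, LinearMap.proj_apply]
  intro H _
  by_cases hH : H = Forest.graft F G c e
  · subst hH
    rw [LinearMap.single_apply, Pi.single_eq_same]
    exact Forest.extComp_graft_mem F G c e (hx F trivial) (hy G trivial)
  · rw [LinearMap.single_apply, Pi.single_eq_of_ne hH]
    exact Submodule.zero_mem _

/-- The composition `∘_i : B(I) ⊗ B(J) → B(K)`, where `K` is the set `(I ∖ {i}) ⊔ J`. If `T` is the
tree of `F` that contains `i`, then `((t ∧ T) ⊗ F) ∘_i (o ⊗ G)` is obtained by composition in `Det`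
from `t` and from the composition of the tree `T` with `o ⊗ G`. The latter is given by the
distributive law of `B`, i.e. by iteration, along the path from `i` to the root of `T`, of the rule
`ω(S, t₁ ∧ ⋯ ∧ tₙ) = ∑ₖ t₁ ∧ ⋯ ∧ ω(S, tₖ) ∧ ⋯ ∧ tₙ`, which for `n = 2` is the defining relation
`ω_{i,⋆} ∘_⋆ e_{j,k} = e_{j,⋆} ∘_⋆ ω_{i,k} - e_{k,⋆} ∘_⋆ ω_{i,j}`. Hence it is a sum over all
assignments `c` of a tree of `G` to each inner vertex of this path. -/
def bComp : OpB I →ₗ[ℚ] OpB J →ₗ[ℚ] OpB K :=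
  LinearMap.mk₂ ℚ (fun x y => ⟨bCompAux e x y, bCompAux_mem e x.2 y.2⟩)
    (fun x x' y => Subtype.ext (by simp)) (fun a x y => Subtype.ext (by simp))
    (fun x y y' => Subtype.ext (by simp)) (fun a x y => Subtype.ext (by simp))

variable (I) in
/-- The map `x ↦ (-1) ^ (d * deg x) x` on `B(I)`. (The degree `|roots of F| - 1` is replaced here by
`|roots of F| + 1`, of the same parity.) -/
def bSign (d : ℕ) : OpB I →ₗ[ℚ] OpB I where
  toFun x := ⟨fun F => (-1 : ℚ) ^ (d * (F.roots.card + 1)) • x.1 F,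
    fun F _ => Submodule.smul_mem _ _ (x.2 F trivial)⟩
  map_add' _ _ := Subtype.ext (funext fun _ => smul_add _ _ _)
  map_smul' a x := Subtype.ext (funext fun F =>
    smul_comm ((-1 : ℚ) ^ (d * (F.roots.card + 1))) a (x.1 F))

/-- The composition `∘_i` of the operad `Bess = Det ⊗ B`, with the usual sign of a tensor product of
graded operads: `(a ⊗ x) ∘_i (b ⊗ y) = (-1) ^ (deg x * deg b) (a ∘_i b) ⊗ (x ∘_i y)`. The degree
`|J| - 1` of `b` is replaced by `|J| + 1`, of the same parity. -/
def bessComp : Bess I →ₗ[ℚ] Bess J →ₗ[ℚ] Bess K :=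
  TensorProduct.map₂ (detComp e) (bComp e ∘ₗ bSign I (Fintype.card J + 1))

/-- The element `o ⊗ F` of `B(I)`. -/
def rootOriented (F : Forest I) (o : detSpace F.roots) : OpB I :=
  ⟨Pi.single F o.1, fun G _ => by
    by_cases h : G = F
    · subst h
      simp
    · simp [h]⟩

end operads

/-! ### The generator `Ω` -/

/-- The tree with one inner vertex and the two leaves `⋆ = false` and `# = true`. -/
def omegaTree : Forest Bool where
  clusters := {{false}, {true}, {false, true}}
  singleton_mem := by decide
  nonempty := by decide
  laminar := by decide
  split := by decide

theorem roots_omegaTree : omegaTree.roots = {{false, true}} := by decide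

/-- The generator `Ω_{⋆,#} = (⋆ ∧ #) ⊗ ω_{⋆,#}` of `Bess`, with `⋆ = false` and `# = true`. -/
def Omega : Bess Bool :=
  (⟨wedge [false, true], (isOrientation_wedge (by simp) (by simp)).mem⟩ : OpDet Bool) ⊗ₜ[ℚ]
    rootOriented omegaTree
      ⟨gen {false, true}, by rw [roots_omegaTree]; exact (isOrientation_gen _).mem⟩

/-- The set `{⋆,#} ∖ {⋆} ⊔ I`, as the set `{#} ⊔ I`, where `#` is `none`. -/
def starEquiv (I : Type*) : {s : Bool // s ≠ false} ⊕ I ≃ Option I where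
  toFun := Sum.elim (fun _ => none) some
  invFun := fun o => o.elim (Sum.inl ⟨true, by decide⟩) Sum.inr
  left_inv := by
    rintro (⟨_ | _, h⟩ | x)
    · exact absurd rfl h
    · rfl
    · rfl
  right_inv := by rintro (_ | x) <;> rfl

/-- The set `({#} ⊔ I) ∖ {#} ⊔ J`, as the set `I ⊔ J`. -/
def sharpEquiv (I J : Type*) : {s : Option I // s ≠ none} ⊕ J ≃ I ⊕ J where
  toFun := Sum.map (fun s => s.1.get (Option.isSome_iff_ne_none.2 s.2)) id
  invFun := Sum.map (fun x => ⟨some x, by simp⟩) id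
  left_inv := by rintro (⟨_ | x, h⟩ | y) <;> simp at *
  right_inv := by rintro (x | y) <;> rfl

/-! ### Inner-oriented forests -/

section inner

variable {I J : Type*} [Fintype I] [DecidableEq I] [Fintype J] [DecidableEq J]

/-- The half-edges at the inner vertex `v`. The half-edges of the edge `C` are `(C, true)`, the
upper one, and `(C, false)`, the lower one. -/
def Forest.halfEdges (F : Forest I) (v : Finset I) : Finset (Finset I × Bool) :=
  insert (v, true) ((F.children v).image fun C => (C, false))

theorem Forest.mem_halfEdges (F : Forest I) {v : Finset I} {h : Finset I × Bool} :
    h ∈ F.halfEdges v ↔ h = (v, true) ∨ ∃ C ∈ F.children v, h = (C, false) := by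
  simp [Forest.halfEdges, eq_comm]

theorem Forest.card_halfEdges (F : Forest I) {v : Finset I} (hv : v ∈ F.verts) :
    (F.halfEdges v).card = 3 := by
  obtain ⟨B, -, C, -, -, -, hne, h⟩ := F.exists_children hv
  rw [Forest.halfEdges, h, Finset.card_insert_of_notMem (by simp), Finset.image_insert,
    Finset.image_singleton, Finset.card_pair (by simpa using hne)]

variable (I) in
/-- An inner-oriented forest: a forest `F` with a global orientation, i.e. an orientation of the set
of its inner vertices (`some v`) and the auxiliary element `R` (`none`), and with a local
orientation at each inner vertex `v`, i.e. an orientation of the three half-edges at `v`. -/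
structure InnerOrientedForest where
  forest : Forest I
  glob : Ext (Option (Finset I))
  isOrientation_glob : IsOrientation (Finset.insertNone forest.verts) glob
  loc : Finset I → Ext (Finset I × Bool)
  isOrientation_loc : ∀ v ∈ forest.verts, IsOrientation (forest.halfEdges v) (loc v)

namespace InnerOrientedForest

/-- What replaces `R` and the inner vertices in the global orientation: `R` itself, and the local
orientations. -/
def expand (x : InnerOrientedForest I) : Option (Finset I) → Ext (Option (Finset I × Bool))
  | none => gen none
  | some v => if v ∈ x.forest.verts then rename (fun h => some (some h)) (x.loc v) else 0

/-- The set of half-edges that replaces an inner vertex. -/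
def expandSet (F : Forest I) : Option (Finset I) → Finset (Option (Finset I × Bool))
  | none => {none}
  | some v => (F.halfEdges v).map Function.Embedding.some

theorem isOrientation_expand (x : InnerOrientedForest I) (v : Option (Finset I))
    (hv : v ∈ Finset.insertNone x.forest.verts) :
    IsOrientation (expandSet x.forest v) (x.expand v) := by
  rcases v with _ | v
  · exact isOrientation_gen _
  · have hv' : v ∈ x.forest.verts := by simpa using hv
    simp only [expand, hv', if_true]
    refine (x.isOrientation_loc v hv').rename _ _ (by simp) (by simp) (by simp [expandSet])

theorem expand_swap (x : InnerOrientedForest I) (v w : Option (Finset I)) :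
    x.expand v * x.expand w = -(x.expand w * x.expand v) := by
  have key : ∀ v : Option (Finset I), v ∈ Finset.insertNone x.forest.verts ∨ x.expand v = 0 := by
    rintro (_ | v)
    · simp
    · by_cases h : v ∈ x.forest.verts
      · left; simpa using h
      · right; simp [expand, h]
  have card : ∀ v ∈ Finset.insertNone x.forest.verts, Odd (expandSet x.forest v).card := by
    rintro (_ | v) hv
    · simp [expandSet]
    · have hv' : v ∈ x.forest.verts := by simpa using hv
      simp only [expandSet, Finset.card_map, x.forest.card_halfEdges hv']
      decide
  rcases key v with hv | hv
  · rcases key w with hw | hw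
    · exact (x.isOrientation_expand v hv).anticomm (x.isOrientation_expand w hw) (card v hv)
        (card w hw)
    · simp [hw]
  · simp [hv]

end InnerOrientedForest

/-- The product of the pairs `C⁺ ∧ C⁻` of half-edges, over all edges `C` between two inner vertices
(in any order, the factors being of even degree). -/
def innerEdgePairs (F : Forest I) : Ext (Option (Finset I × Bool)) :=
  (F.innerEdges.toList.map fun C => gen (some (C, true)) * gen (some (C, false))).prod

/-- The product of the pairs `ℓ ∧ r`, over all leaves `ℓ` and roots `r` that are related by an
edge (in any order, the factors being of even degree). -/
def leafRootPairs (F : Forest I) : Ext (Option (Finset I × Bool)) :=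
  (F.trivialTrees.toList.map fun C => gen (some (C, false)) * gen (some (C, true))).prod

/-- The exterior product `o₁ ∧ R ∧ o₂` of an outer orientation, where the leaf `x` is
identified with the lower half-edge of its edge, and a root with the upper half-edge of its edge. -/
def outerProduct (o₁ : Ext I) (o₂ : Ext (Finset I)) : Ext (Option (Finset I × Bool)) :=
  rename (fun x => some (some ({x}, false))) o₁ * gen none *
    rename (fun C => some (some (C, true))) o₂

namespace InnerOrientedForest

/-- The outer orientation `o₁ ⊗ o₂` is identified with the inner orientation of `x`: after removing
the pairs `ℓ ∧ r` from `o₁ ∧ R ∧ o₂` and adding the pairs `C⁺ ∧ C⁻`, one gets the exterior product of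
`R` and all half-edges that is obtained from the global orientation by replacing each inner vertex
by its local orientation. -/
def Matches (x : InnerOrientedForest I) (o₁ : Ext I) (o₂ : Ext (Finset I)) : Prop :=
  outerProduct o₁ o₂ * innerEdgePairs x.forest =
    leafRootPairs x.forest * substHom x.expand x.expand_swap x.glob

/-- `t` is the element `o₁ ⊗ o₂ ⊗ F` of `Bess(I)`, where `o₁ ⊗ o₂` is the outer orientation
identified with the inner orientation of `x`, and `F` is the forest of `x`. -/
def IsOuterForm (x : InnerOrientedForest I) (t : Bess I) : Prop :=
  ∃ (o₁ : OpDet I) (o₂ : detSpace x.forest.roots), IsOrientation Finset.univ o₁.1 ∧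
    IsOrientation x.forest.roots o₂.1 ∧ x.Matches o₁ o₂ ∧ t = o₁ ⊗ₜ[ℚ] rootOriented x.forest o₂

/-- The half-edges, with the leaves and the roots of the trees without inner vertex, and `R`. -/
def allHalfEdges (F : Forest I) : Finset (Option (Finset I × Bool)) :=
  F.trivialTrees.biUnion (fun C => {some (C, false), some (C, true)}) ∪
    (Finset.insertNone F.verts).biUnion (expandSet F)

theorem mem_expandSet_some {F : Forest I} {v : Finset I} {h : Finset I × Bool} :
    some h ∈ expandSet F (some v) ↔ h ∈ F.halfEdges v := by
  simp [expandSet]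

theorem none_notMem_expandSet {F : Forest I} {v : Finset I} : none ∉ expandSet F (some v) := by
  simp [expandSet]

theorem isOrientation_right (x : InnerOrientedForest I) : IsOrientation (allHalfEdges x.forest)
    (leafRootPairs x.forest * substHom x.expand x.expand_swap x.glob) := by
  have h1 : IsOrientation (x.forest.trivialTrees.biUnion
      (fun C => ({some (C, false), some (C, true)} : Finset (Option (Finset I × Bool)))))
      (leafRootPairs x.forest) := by
    refine isOrientation_list_prod _ (fun C => {some (C, false), some (C, true)}) _
      (Finset.nodup_toList _) ?_ ?_ _ (by simp)
    · intro C _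
      exact (isOrientation_gen _).mul (isOrientation_gen _) (by simp)
    · intro C _ D _ hCD
      simp [hCD.symm]
  have h2 := x.isOrientation_glob.substHom x.expand x.expand_swap (expandSet x.forest)
    (fun v hv => x.isOrientation_expand v hv) (by
      rintro (_ | v) hv (_ | w) hw hne
      · exact absurd rfl hne
      · rw [Finset.disjoint_left]
        intro a ha
        have : a = none := by simpa [expandSet] using ha
        rw [this]
        exact none_notMem_expandSet
      · rw [Finset.disjoint_right]
        intro a ha
        have : a = none := by simpa [expandSet] using ha
        rw [this]
        exact none_notMem_expandSet
      · have hv' : v ∈ x.forest.verts := by simpa using hv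
        have hw' : w ∈ x.forest.verts := by simpa using hw
        rw [Finset.disjoint_left]
        rintro (_ | h) ha hb
        · exact none_notMem_expandSet ha
        · rw [mem_expandSet_some, Forest.mem_halfEdges] at ha hb
          rcases ha with rfl | ⟨C, hC, rfl⟩
          · rcases hb with h | ⟨D, hD, h⟩
            · exact hne (by rw [(Prod.mk.inj h).1])
            · simp at h
          · rcases hb with h | ⟨D, hD, h⟩
            · simp at h
            · rw [← (Prod.mk.inj h).1] at hD
              exact hne (by rw [x.forest.children_unique (x.forest.mem_verts.1 hv').1
                (x.forest.mem_verts.1 hw').1 hC hD]))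
  refine h1.mul h2 ?_
  rw [Finset.disjoint_left]
  intro a ha hb
  simp only [Finset.mem_biUnion, Finset.mem_insert, Finset.mem_singleton] at ha hb
  obtain ⟨C, hC, ha⟩ := ha
  obtain ⟨w, hw, hb⟩ := hb
  have hC' := Finset.mem_filter.1 hC
  rcases w with _ | w
  · rcases ha with rfl | rfl <;> simp [expandSet] at hb
  · have hw' : w ∈ x.forest.verts := by simpa using hw
    rcases ha with rfl | rfl <;> rw [mem_expandSet_some, Forest.mem_halfEdges] at hb
    · rcases hb with h | ⟨D, hD, h⟩
      · simp at h
      · rw [← (Prod.mk.inj h).1] at hD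
        exact x.forest.notMem_roots_of_mem_children (x.forest.mem_verts.1 hw').1 hD hC'.1
    · rcases hb with h | ⟨D, hD, h⟩
      · rw [(Prod.mk.inj h).1] at hC'
        exact hC'.2 hw'
      · simp at h

theorem isOrientation_left (F : Forest I) {o₁ : Ext I} {o₂ : Ext (Finset I)}
    (h₁ : IsOrientation Finset.univ o₁) (h₂ : IsOrientation F.roots o₂) :
    IsOrientation (allHalfEdges F) (outerProduct o₁ o₂ * innerEdgePairs F) := by
  have a1 := h₁.rename (fun x => some (some (({x} : Finset I), false)))
    (Finset.univ.image fun x => some ({x}, false)) (by simp) (by simp) (by simp)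
  have a2 := h₂.rename (fun C => some (some (C, true)))
    (F.roots.image fun C => some (C, true)) (by simp) (by simp) (by simp)
  have a3 : IsOrientation (F.innerEdges.biUnion
      (fun C => ({some (C, true), some (C, false)} : Finset (Option (Finset I × Bool)))))
      (innerEdgePairs F) := by
    refine isOrientation_list_prod _ (fun C => {some (C, true), some (C, false)}) _
      (Finset.nodup_toList _) ?_ ?_ _ (by simp)
    · intro C _
      exact (isOrientation_gen _).mul (isOrientation_gen _) (by simp)
    · intro C _ D _ hCD
      simp [hCD.symm]
  have single : ∀ x : I, ({x} : Finset I) ∉ F.verts := by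
    intro x h
    have := (F.mem_verts.1 h).2
    simp at this
  have b1 := a1.mul (isOrientation_gen (none : Option (Finset I × Bool))) (by simp)
  have b2 := b1.mul a2 (by
    rw [Finset.disjoint_left]
    simp)
  have b3 := b2.mul a3 (by
    rw [Finset.disjoint_left]
    simp only [Finset.mem_union, Finset.mem_image, Finset.mem_univ, true_and,
      Finset.mem_singleton, Finset.mem_biUnion, Finset.mem_insert, Forest.innerEdges,
      Finset.mem_filter]
    rintro a ((⟨x, rfl⟩ | rfl) | ⟨C, hC, rfl⟩) ⟨D, ⟨hD, hD'⟩, h⟩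
    · have : {x} = D := by simpa using h
      exact single x (this ▸ hD)
    · simp at h
    · have : C = D := by simpa using h
      exact hD' (this ▸ hC))
  have hset : allHalfEdges F = (Finset.univ.image fun x => some ({x}, false)) ∪ {none} ∪
      (F.roots.image fun C => some (C, true)) ∪
      F.innerEdges.biUnion fun C => {some (C, true), some (C, false)} := ?_
  · rw [hset]
    exact b3
  ext a
  simp only [allHalfEdges, Finset.mem_union, Finset.mem_image, Finset.mem_univ, true_and,
      Finset.mem_singleton, Finset.mem_biUnion, Finset.mem_insert, Forest.innerEdges,
      Forest.trivialTrees, Finset.mem_filter]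
  have hsingle : ∀ C ∈ F.clusters, C ∉ F.verts → ∃ x, {x} = C := by
    intro C hC hv
    have h1 := Finset.card_pos.2 (F.nonempty C hC)
    have h2 : ¬ 1 < C.card := fun h => hv (F.mem_verts.2 ⟨hC, h⟩)
    obtain ⟨x, hx⟩ := Finset.card_eq_one.1 (show C.card = 1 by omega)
    exact ⟨x, hx.symm⟩
  have hparent : ∀ C ∈ F.clusters, C ∉ F.roots →
      ∃ v ∈ Finset.insertNone F.verts, some (C, false) ∈ expandSet F v := by
    intro C hC hr
    obtain ⟨v, hv, h⟩ := F.exists_parent hC hr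
    exact ⟨some v, by simpa using hv, mem_expandSet_some.2 (F.mem_halfEdges.2 (Or.inr ⟨C, h, rfl⟩))⟩
  have hvert : ∀ C ∈ F.verts, ∃ v ∈ Finset.insertNone F.verts, some (C, true) ∈ expandSet F v :=
    fun C hC => ⟨some C, by simpa using hC, mem_expandSet_some.2 (F.mem_halfEdges.2 (Or.inl rfl))⟩
  constructor
  · rintro (⟨C, ⟨hC, hC'⟩, h⟩ | ⟨v, hv, h⟩)
    · obtain ⟨x, rfl⟩ := hsingle C (F.mem_roots.1 hC).1 hC'
      rcases h with rfl | rfl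
      · exact Or.inl (Or.inl (Or.inl ⟨x, rfl⟩))
      · exact Or.inl (Or.inr ⟨_, hC, rfl⟩)
    · rcases v with _ | v
      · exact Or.inl (Or.inl (Or.inr (by simpa [expandSet] using h)))
      · have hv' : v ∈ F.verts := by simpa using hv
        rcases a with _ | a
        · exact absurd h none_notMem_expandSet
        · rw [mem_expandSet_some, Forest.mem_halfEdges] at h
          rcases h with rfl | ⟨C, hC, rfl⟩
          · by_cases hr : v ∈ F.roots
            · exact Or.inl (Or.inr ⟨v, hr, rfl⟩)
            · exact Or.inr ⟨v, ⟨hv', hr⟩, Or.inl rfl⟩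
          · by_cases hCv : C ∈ F.verts
            · exact Or.inr ⟨C, ⟨hCv, F.notMem_roots_of_mem_children (F.mem_verts.1 hv').1 hC⟩,
                Or.inr rfl⟩
            · obtain ⟨x, rfl⟩ := hsingle C (F.mem_children.1 hC).1 hCv
              exact Or.inl (Or.inl (Or.inl ⟨x, rfl⟩))
  · rintro (((⟨x, rfl⟩ | rfl) | ⟨C, hC, rfl⟩) | ⟨C, ⟨hC, hC'⟩, rfl | rfl⟩)
    · by_cases hr : {x} ∈ F.roots
      · exact Or.inl ⟨_, ⟨hr, single x⟩, Or.inl rfl⟩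
      · exact Or.inr (hparent _ (F.singleton_mem x) hr)
    · exact Or.inr ⟨none, by simp, by simp [expandSet]⟩
    · by_cases hv : C ∈ F.verts
      · exact Or.inr (hvert C hv)
      · exact Or.inl ⟨C, ⟨hC, hv⟩, Or.inr rfl⟩
    · exact Or.inr (hvert C hC)
    · exact Or.inr (hparent C (F.mem_verts.1 hC).1 hC')

theorem existsUnique_isOuterForm (x : InnerOrientedForest I) : ∃! t, x.IsOuterForm t := by
  have hl : ∀ (o₁ : Ext I) (o₂ : Ext (Finset I)),
      outerProduct (-o₁) o₂ * innerEdgePairs x.forest =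
        -(outerProduct o₁ o₂ * innerEdgePairs x.forest) := by
    intro o₁ o₂
    simp [outerProduct]
  have hr : ∀ (o₁ : Ext I) (o₂ : Ext (Finset I)),
      outerProduct o₁ (-o₂) * innerEdgePairs x.forest =
        -(outerProduct o₁ o₂ * innerEdgePairs x.forest) := by
    intro o₁ o₂
    simp [outerProduct]
  have hR := x.isOrientation_right
  refine existsUnique_of_exists_of_unique ?_ ?_
  · have h1 : IsOrientation (Finset.univ : Finset I) (wedge Finset.univ.toList) :=
      isOrientation_wedge (Finset.nodup_toList _) (by simp)
    have h2 : IsOrientation x.forest.roots (wedge x.forest.roots.toList) :=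
      isOrientation_wedge (Finset.nodup_toList _) (by simp)
    rcases (isOrientation_left x.forest h1 h2).eq_or_neg hR with h | h
    · exact ⟨_, ⟨_, h1.mem⟩, ⟨_, h2.mem⟩, h1, h2, h.symm, rfl⟩
    · exact ⟨_, ⟨_, h1.neg.mem⟩, ⟨_, h2.mem⟩, h1.neg, h2, (hl _ _).trans h.symm, rfl⟩
  · rintro t t' ⟨o₁, o₂, h1, h2, hm, rfl⟩ ⟨o₁', o₂', h1', h2', hm', rfl⟩
    have hne := hR.ne_zero
    have hrn : ∀ o : detSpace x.forest.roots,
        rootOriented x.forest (-o) = -rootOriented x.forest o := by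
      intro o
      exact Subtype.ext (Pi.single_neg (f := fun _ : Forest I => Ext (Finset I)) x.forest o.1)
    have absurd' : ∀ z : Ext (Option (Finset I × Bool)), z ≠ 0 → -z = z → False := by
      intro z hz h
      have h2 : (2 : ℚ) • z = 0 := by
        rw [two_smul]
        nth_rewrite 1 [← h]
        simp
      exact hz ((smul_eq_zero.1 h2).resolve_left two_ne_zero)
    unfold Matches at hm hm'
    rcases h1.eq_or_neg h1' with ha | ha <;> rcases h2.eq_or_neg h2' with hb | hb
    · rw [Subtype.ext ha, Subtype.ext hb]
    · rw [ha, hb, hr, hm] at hm'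
      exact (absurd' _ hne hm').elim
    · rw [ha, hb, hl, hm] at hm'
      exact (absurd' _ hne hm').elim
    · have ha' : o₁' = -o₁ := Subtype.ext ha
      have hb' : o₂' = -o₂ := Subtype.ext hb
      rw [ha', hb', hrn, TensorProduct.neg_tmul, TensorProduct.tmul_neg]
      exact (neg_neg (o₁ ⊗ₜ[ℚ] rootOriented x.forest o₂ : Bess I)).symm

/-- The element of `Bess(I)` given by an inner-oriented forest. -/
def toBess (x : InnerOrientedForest I) : Bess I := x.existsUnique_isOuterForm.choose

theorem isOuterForm_toBess (x : InnerOrientedForest I) : x.IsOuterForm x.toBess :=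
  x.existsUnique_isOuterForm.choose_spec.1

end InnerOrientedForest
/-! ### The operation `∨` -/

/-- The subset `A ⊔ B` of `I ⊔ J`. -/
def sumSet (A : Finset I) (B : Finset J) : Finset (I ⊕ J) := A.disjSum B

@[simp] theorem inl_mem_sumSet {A : Finset I} {B : Finset J} {x : I} :
    Sum.inl x ∈ sumSet A B ↔ x ∈ A := Finset.inl_mem_disjSum

@[simp] theorem inr_mem_sumSet {A : Finset I} {B : Finset J} {x : J} :
    Sum.inr x ∈ sumSet A B ↔ x ∈ B := Finset.inr_mem_disjSum

theorem sumSet_subset {A A' : Finset I} {B B' : Finset J} :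
    sumSet A B ⊆ sumSet A' B' ↔ A ⊆ A' ∧ B ⊆ B' := by
  simp [Finset.subset_iff]

theorem sumSet_disjoint {A A' : Finset I} {B B' : Finset J} :
    Disjoint (sumSet A B) (sumSet A' B') ↔ Disjoint A A' ∧ Disjoint B B' := by
  simp [Finset.disjoint_left]

theorem sumSet_union {A A' : Finset I} {B B' : Finset J} :
    sumSet A B ∪ sumSet A' B' = sumSet (A ∪ A') (B ∪ B') := by
  ext (x | x) <;> simp

@[simp] theorem toLeft_sumSet {A : Finset I} {B : Finset J} : (sumSet A B).toLeft = A := by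
  ext x; simp

@[simp] theorem toRight_sumSet {A : Finset I} {B : Finset J} : (sumSet A B).toRight = B := by
  ext x; simp

@[simp] theorem card_sumSet {A : Finset I} {B : Finset J} :
    (sumSet A B).card = A.card + B.card := Finset.card_disjSum _ _

theorem sumSet_inj {A A' : Finset I} {B B' : Finset J} :
    sumSet A B = sumSet A' B' ↔ A = A' ∧ B = B' := by
  constructor
  · intro h
    exact ⟨by simpa using congrArg Finset.toLeft h, by simpa using congrArg Finset.toRight h⟩
  · rintro ⟨rfl, rfl⟩
    rfl

/-- The forest obtained from the disjoint union of the forests `F` and `G` by replacing the tree of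
`F` with root `A` and the tree of `G` with root `B` by the tree where they are grafted on the two
leaves of the tree with one inner vertex. -/
def Forest.vee (F : Forest I) (G : Forest J) (A : {A // A ∈ F.roots}) (B : {B // B ∈ G.roots}) :
    Forest (I ⊕ J) where
  clusters := insert (sumSet A.1 B.1) ((F.clusters.image fun C => sumSet C ∅) ∪
    G.clusters.image fun D => sumSet ∅ D)
  singleton_mem := by
    rintro (x | y)
    · refine Finset.mem_insert_of_mem (Finset.mem_union_left _
        (Finset.mem_image.2 ⟨{x}, F.singleton_mem x, ?_⟩))
      ext (z | z) <;> simp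
    · refine Finset.mem_insert_of_mem (Finset.mem_union_right _
        (Finset.mem_image.2 ⟨{y}, G.singleton_mem y, ?_⟩))
      ext (z | z) <;> simp
  nonempty := by
    have hA := F.nonempty A.1 (F.mem_roots.1 A.2).1
    intro S hS
    simp only [Finset.mem_insert, Finset.mem_union, Finset.mem_image] at hS
    rcases hS with rfl | ⟨C, hC, rfl⟩ | ⟨D, hD, rfl⟩
    · obtain ⟨x, hx⟩ := hA
      exact ⟨Sum.inl x, by simpa using hx⟩
    · obtain ⟨x, hx⟩ := F.nonempty C hC
      exact ⟨Sum.inl x, by simpa using hx⟩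
    · obtain ⟨x, hx⟩ := G.nonempty D hD
      exact ⟨Sum.inr x, by simpa using hx⟩
  laminar := by
    have hl : ∀ C ∈ F.clusters, C ⊆ A.1 ∨ Disjoint C A.1 := by
      intro C hC
      by_cases h : ∃ x ∈ C, x ∈ A.1
      · obtain ⟨x, hx, hx'⟩ := h
        exact Or.inl (F.subset_root A.2 hC hx' hx)
      · push Not at h
        exact Or.inr (Finset.disjoint_left.2 h)
    have hr : ∀ C ∈ G.clusters, C ⊆ B.1 ∨ Disjoint C B.1 := by
      intro C hC
      by_cases h : ∃ x ∈ C, x ∈ B.1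
      · obtain ⟨x, hx, hx'⟩ := h
        exact Or.inl (G.subset_root B.2 hC hx' hx)
      · push Not at h
        exact Or.inr (Finset.disjoint_left.2 h)
    intro S hS S' hS'
    simp only [Finset.mem_insert, Finset.mem_union, Finset.mem_image] at hS hS'
    rcases hS with rfl | ⟨C, hC, rfl⟩ | ⟨D, hD, rfl⟩ <;>
      rcases hS' with rfl | ⟨C', hC', rfl⟩ | ⟨D', hD', rfl⟩ <;>
      simp only [sumSet_subset, sumSet_disjoint, Finset.empty_subset, and_true, true_and,
        Finset.disjoint_empty_left, Finset.disjoint_empty_right, or_true, subset_rfl, true_or]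
    · rcases hl C' hC' with h | h
      · simp [h]
      · simp [h.symm]
    · rcases hr D' hD' with h | h
      · simp [h]
      · simp [h.symm]
    · rcases hl C hC with h | h <;> simp [h]
    · exact F.laminar C hC C' hC'
    · rcases hr D hD with h | h <;> simp [h]
    · exact G.laminar D hD D' hD'
  split := by
    intro S hS hcard
    simp only [Finset.mem_insert, Finset.mem_union, Finset.mem_image] at hS ⊢
    rcases hS with rfl | ⟨C, hC, rfl⟩ | ⟨D, hD, rfl⟩
    · exact ⟨_, Or.inr (Or.inl ⟨A.1, (F.mem_roots.1 A.2).1, rfl⟩), _,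
        Or.inr (Or.inr ⟨B.1, (G.mem_roots.1 B.2).1, rfl⟩),
        by simp [sumSet_disjoint], by simp [sumSet_union]⟩
    · obtain ⟨C₁, h₁, C₂, h₂, hd, hu⟩ := F.split C hC (by simpa using hcard)
      exact ⟨_, Or.inr (Or.inl ⟨C₁, h₁, rfl⟩), _, Or.inr (Or.inl ⟨C₂, h₂, rfl⟩),
        by simpa [sumSet_disjoint] using hd, by simp [sumSet_union, hu]⟩
    · obtain ⟨C₁, h₁, C₂, h₂, hd, hu⟩ := G.split D hD (by simpa using hcard)
      exact ⟨_, Or.inr (Or.inr ⟨C₁, h₁, rfl⟩), _, Or.inr (Or.inr ⟨C₂, h₂, rfl⟩),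
        by simpa [sumSet_disjoint] using hd, by simp [sumSet_union, hu]⟩

namespace Forest

section vee

variable (F : Forest I) (G : Forest J) (A : {A // A ∈ F.roots}) (B : {B // B ∈ G.roots})

theorem mem_clusters_vee {S : Finset (I ⊕ J)} : S ∈ (F.vee G A B).clusters ↔
    S = sumSet A.1 B.1 ∨ (∃ C ∈ F.clusters, sumSet C ∅ = S) ∨
      ∃ D ∈ G.clusters, sumSet ∅ D = S := by
  simp [vee]

theorem root_nonempty {A : Finset I} (h : A ∈ F.roots) : A.Nonempty :=
  F.nonempty A (F.mem_roots.1 h).1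

theorem mem_verts_vee {S : Finset (I ⊕ J)} : S ∈ (F.vee G A B).verts ↔
    S = sumSet A.1 B.1 ∨ (∃ C ∈ F.verts, sumSet C ∅ = S) ∨
      ∃ D ∈ G.verts, sumSet ∅ D = S := by
  have hA := Finset.card_pos.2 (F.root_nonempty A.2)
  have hB := Finset.card_pos.2 (G.root_nonempty B.2)
  rw [mem_verts, mem_clusters_vee]
  constructor
  · rintro ⟨rfl | ⟨C, hC, rfl⟩ | ⟨D, hD, rfl⟩, h⟩
    · exact Or.inl rfl
    · exact Or.inr (Or.inl ⟨C, F.mem_verts.2 ⟨hC, by simpa using h⟩, rfl⟩)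
    · exact Or.inr (Or.inr ⟨D, G.mem_verts.2 ⟨hD, by simpa using h⟩, rfl⟩)
  · rintro (rfl | ⟨C, hC, rfl⟩ | ⟨D, hD, rfl⟩)
    · refine ⟨Or.inl rfl, ?_⟩
      rw [card_sumSet]
      omega
    · rw [mem_verts] at hC
      exact ⟨Or.inr (Or.inl ⟨C, hC.1, rfl⟩), by simpa using hC.2⟩
    · rw [mem_verts] at hD
      exact ⟨Or.inr (Or.inr ⟨D, hD.1, rfl⟩), by simpa using hD.2⟩

theorem sumSet_ssubset_left {C D : Finset I} :
    sumSet C (∅ : Finset J) ⊂ sumSet D ∅ ↔ C ⊂ D := by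
  simp [Finset.ssubset_def, sumSet_subset]

theorem sumSet_ssubset_right {C D : Finset J} :
    sumSet (∅ : Finset I) C ⊂ sumSet ∅ D ↔ C ⊂ D := by
  simp [Finset.ssubset_def, sumSet_subset]

theorem cluster_left {S : Finset (I ⊕ J)} (hS : S ∈ (F.vee G A B).clusters) {C : Finset I}
    (h : S ⊆ sumSet C ∅) : ∃ D ∈ F.clusters, sumSet D ∅ = S := by
  rw [mem_clusters_vee] at hS
  rcases hS with rfl | h1 | ⟨D, hD, rfl⟩
  · rw [sumSet_subset, Finset.subset_empty] at h
    exact absurd h.2 (G.root_nonempty B.2).ne_empty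
  · exact h1
  · rw [sumSet_subset, Finset.subset_empty] at h
    exact absurd h.2 (G.nonempty D hD).ne_empty

theorem cluster_right {S : Finset (I ⊕ J)} (hS : S ∈ (F.vee G A B).clusters) {C : Finset J}
    (h : S ⊆ sumSet ∅ C) : ∃ D ∈ G.clusters, sumSet ∅ D = S := by
  rw [mem_clusters_vee] at hS
  rcases hS with rfl | ⟨D, hD, rfl⟩ | h1
  · rw [sumSet_subset, Finset.subset_empty] at h
    exact absurd h.1 (F.root_nonempty A.2).ne_empty
  · rw [sumSet_subset, Finset.subset_empty] at h
    exact absurd h.1 (F.nonempty D hD).ne_empty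
  · exact h1

theorem children_vee_left (C : Finset I) : (F.vee G A B).children (sumSet C ∅) =
    (F.children C).image fun D => sumSet D ∅ := by
  ext S
  rw [mem_children, Finset.mem_image]
  constructor
  · rintro ⟨h1, h2, h3⟩
    obtain ⟨D, hD, rfl⟩ := cluster_left F G A B h1 h2.1
    refine ⟨D, F.mem_children.2 ⟨hD, sumSet_ssubset_left.1 h2, fun E hE hDE hEC => ?_⟩, rfl⟩
    exact h3 (sumSet E ∅) ((mem_clusters_vee F G A B).2 (Or.inr (Or.inl ⟨E, hE, rfl⟩)))
      (sumSet_ssubset_left.2 hDE) (sumSet_ssubset_left.2 hEC)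
  · rintro ⟨D, hD, rfl⟩
    rw [mem_children] at hD
    refine ⟨(mem_clusters_vee F G A B).2 (Or.inr (Or.inl ⟨D, hD.1, rfl⟩)),
      sumSet_ssubset_left.2 hD.2.1, fun E hE hDE hEC => ?_⟩
    obtain ⟨E, hE', rfl⟩ := cluster_left F G A B hE hEC.1
    exact hD.2.2 E hE' (sumSet_ssubset_left.1 hDE) (sumSet_ssubset_left.1 hEC)

theorem children_vee_right (C : Finset J) : (F.vee G A B).children (sumSet ∅ C) =
    (G.children C).image fun D => sumSet ∅ D := by
  ext S
  rw [mem_children, Finset.mem_image]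
  constructor
  · rintro ⟨h1, h2, h3⟩
    obtain ⟨D, hD, rfl⟩ := cluster_right F G A B h1 h2.1
    refine ⟨D, G.mem_children.2 ⟨hD, sumSet_ssubset_right.1 h2, fun E hE hDE hEC => ?_⟩, rfl⟩
    exact h3 (sumSet ∅ E) ((mem_clusters_vee F G A B).2 (Or.inr (Or.inr ⟨E, hE, rfl⟩)))
      (sumSet_ssubset_right.2 hDE) (sumSet_ssubset_right.2 hEC)
  · rintro ⟨D, hD, rfl⟩
    rw [mem_children] at hD
    refine ⟨(mem_clusters_vee F G A B).2 (Or.inr (Or.inr ⟨D, hD.1, rfl⟩)),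
      sumSet_ssubset_right.2 hD.2.1, fun E hE hDE hEC => ?_⟩
    obtain ⟨E, hE', rfl⟩ := cluster_right F G A B hE hEC.1
    exact hD.2.2 E hE' (sumSet_ssubset_right.1 hDE) (sumSet_ssubset_right.1 hEC)

theorem children_vee_new : (F.vee G A B).children (sumSet A.1 B.1) =
    {sumSet A.1 ∅, sumSet ∅ B.1} := by
  have hA := (F.root_nonempty A.2).ne_empty
  have hB := (G.root_nonempty B.2).ne_empty
  have sA : sumSet A.1 (∅ : Finset J) ⊂ sumSet A.1 B.1 := by
    simp [Finset.ssubset_def, sumSet_subset, hB]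
  have sB : sumSet (∅ : Finset I) B.1 ⊂ sumSet A.1 B.1 := by
    simp [Finset.ssubset_def, sumSet_subset, hA]
  have cA : sumSet A.1 (∅ : Finset J) ∈ (F.vee G A B).clusters :=
    (mem_clusters_vee F G A B).2 (Or.inr (Or.inl ⟨A.1, (F.mem_roots.1 A.2).1, rfl⟩))
  have cB : sumSet (∅ : Finset I) B.1 ∈ (F.vee G A B).clusters :=
    (mem_clusters_vee F G A B).2 (Or.inr (Or.inr ⟨B.1, (G.mem_roots.1 B.2).1, rfl⟩))
  have sub : ∀ S ∈ (F.vee G A B).clusters, S ⊂ sumSet A.1 B.1 →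
      S ⊆ sumSet A.1 ∅ ∨ S ⊆ sumSet ∅ B.1 := by
    intro S hS h
    rw [mem_clusters_vee] at hS
    rcases hS with rfl | ⟨D, hD, rfl⟩ | ⟨D, hD, rfl⟩
    · exact absurd h (ssubset_irrefl _)
    · exact Or.inl (sumSet_subset.2 ⟨(sumSet_subset.1 h.1).1, subset_rfl⟩)
    · exact Or.inr (sumSet_subset.2 ⟨subset_rfl, (sumSet_subset.1 h.1).2⟩)
  ext S
  rw [mem_children, Finset.mem_insert, Finset.mem_singleton]
  constructor
  · rintro ⟨h1, h2, h3⟩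
    rcases sub S h1 h2 with h | h
    · rcases h.eq_or_ssubset with h | h
      · exact Or.inl h
      · exact absurd sA (h3 _ cA h)
    · rcases h.eq_or_ssubset with h | h
      · exact Or.inr h
      · exact absurd sB (h3 _ cB h)
  · rintro (rfl | rfl)
    · refine ⟨cA, sA, fun E hE h1 h2 => ?_⟩
      rcases sub E hE h2 with h | h
      · exact h1.2 h
      · exact hA (Finset.subset_empty.1 (sumSet_subset.1 (h1.1.trans h)).1)
    · refine ⟨cB, sB, fun E hE h1 h2 => ?_⟩
      rcases sub E hE h2 with h | h
      · exact hB (Finset.subset_empty.1 (sumSet_subset.1 (h1.1.trans h)).2)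
      · exact h1.2 h

end vee

end Forest

namespace InnerOrientedForest

variable (x : InnerOrientedForest I) (y : InnerOrientedForest J)
  (A : {A // A ∈ x.forest.roots}) (B : {B // B ∈ y.forest.roots})

/-- The global orientation `o₁ ∨ o₂` of the forest where the trees with roots `A` and `B` are
replaced by their `∨` product: the exterior product `(-1) ^ (deg o₁) o₁ ∧ o₂`, where `R₁ ∧ R₂` is
replaced by `R ∧ v` (i.e. `R₁` by `R` and `R₂` by `v`) for the new inner vertex `v`. The degree of
`o₁` is its number of wedge signs, i.e. the number of inner vertices of the first forest. -/
def veeGlob : Ext (Option (Finset (I ⊕ J))) :=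
  (-1 : ℚ) ^ x.forest.verts.card •
    (rename (fun v => some (v.elim none fun C => some (sumSet C ∅))) x.glob *
      rename (fun v => some (v.elim (some (sumSet A.1 B.1)) fun C => some (sumSet ∅ C)))
        y.glob)

/-- The local orientations: they are unchanged at the inner vertices of the two forests, and
`v⁺ ∧ e₁⁻ ∧ e₂⁻` at the new inner vertex `v`, where `v⁺` is its outgoing half-edge, and `e₁⁻` and
`e₂⁻` its incoming half-edges on the side of the first and of the second forest. -/
def veeLoc (v : Finset (I ⊕ J)) : Ext (Finset (I ⊕ J) × Bool) :=
  if v = sumSet A.1 B.1 then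
    gen (v, true) * gen (sumSet A.1 ∅, false) * gen (sumSet ∅ B.1, false)
  else if v.toRight = ∅ then
    rename (fun h => some (h.1.disjSum ∅, h.2)) (x.loc v.toLeft)
  else
    rename (fun h => some (sumSet ∅ h.1, h.2)) (y.loc v.toRight)

/-- The inner-oriented forest `(o₁ ∨ o₂) ⊗ F`, where `F` is the term of `F₁ ∨ F₂` that belongs to
the tree of `F₁` with root `A` and the tree of `F₂` with root `B`. -/
def vee : InnerOrientedForest (I ⊕ J) where
  forest := x.forest.vee y.forest A B
  glob := veeGlob x y A B
  isOrientation_glob := by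
    have hA := (x.forest.root_nonempty A.2).ne_empty
    have hB := (y.forest.root_nonempty B.2).ne_empty
    have h1 := x.isOrientation_glob.rename
      (fun v => some (v.elim none fun C => some (sumSet C (∅ : Finset J))))
      (Finset.insertNone (x.forest.verts.image fun C => sumSet C ∅)) (by simp)
      (by
        rintro (_ | v) _ (_ | w) _ h <;> simp [sumSet_inj] at h ⊢
        exact h)
      (by
        rintro (_ | S)
        · simp only [Finset.none_mem_insertNone, true_iff]
          exact ⟨none, by simp, rfl⟩
        · simp [Finset.mem_insertNone, Option.exists])
    have h2 := y.isOrientation_glob.rename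
      (fun v => some (v.elim (some (sumSet A.1 B.1)) fun C =>
        some (sumSet (∅ : Finset I) C)))
      ((insert (sumSet A.1 B.1) (y.forest.verts.image fun C => sumSet ∅ C)).map
        Function.Embedding.some) (by simp)
      (by
        rintro (_ | v) _ (_ | w) _ h <;> simp [sumSet_inj, hA, Ne.symm hA] at h ⊢
        exact h)
      (by
        rintro (_ | S)
        · simp [Finset.mem_insertNone, Option.forall]
        · simp [Finset.mem_insertNone, Option.exists, eq_comm])
    have h3 := (h1.mul h2 (by
      rw [Finset.disjoint_right]
      rintro (_ | S)
      · simp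
      · simp only [Finset.mem_map, Finset.mem_insert, Finset.mem_image,
          Function.Embedding.some_apply, Option.some.injEq, exists_eq_right,
          Finset.some_mem_insertNone]
        rintro (rfl | ⟨D, hD, rfl⟩) ⟨C, hC, h⟩
        · exact hB (sumSet_inj.1 h).2.symm
        · have := (y.forest.mem_verts.1 hD).1
          exact (y.forest.nonempty D this).ne_empty (sumSet_inj.1 h).2.symm)).sign_smul
            x.forest.verts.card
    have hset : Finset.insertNone (x.forest.vee y.forest A B).verts =
        Finset.insertNone (x.forest.verts.image fun C => sumSet C ∅) ∪
        (insert (sumSet A.1 B.1) (y.forest.verts.image fun C => sumSet ∅ C)).map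
          Function.Embedding.some := by
      ext (_ | S)
      · simp
      · simp only [Finset.some_mem_insertNone, Forest.mem_verts_vee, Finset.mem_union,
          Finset.mem_image, Finset.mem_map, Finset.mem_insert, Function.Embedding.some_apply,
          Option.some.injEq, exists_eq_right]
        rw [or_left_comm]
    rw [hset]
    exact h3
  loc := veeLoc x y A B
  isOrientation_loc := by
    have hA := (x.forest.root_nonempty A.2).ne_empty
    have hB := (y.forest.root_nonempty B.2).ne_empty
    intro S hS
    rw [Forest.mem_verts_vee] at hS
    rcases hS with rfl | ⟨C, hC, rfl⟩ | ⟨D, hD, rfl⟩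
    · rw [veeLoc, if_pos rfl, Forest.halfEdges, Forest.children_vee_new]
      have h := ((isOrientation_gen (sumSet A.1 B.1, true)).mul
        (isOrientation_gen (sumSet A.1 (∅ : Finset J), false)) (by simp)).mul
        (isOrientation_gen (sumSet (∅ : Finset I) B.1, false))
        (by simp [sumSet_inj, Ne.symm hA])
      have hset : (insert (sumSet A.1 B.1, true) (Finset.image (fun C => (C, false))
          {sumSet A.1 (∅ : Finset J), sumSet (∅ : Finset I) B.1})) =
          ({(sumSet A.1 B.1, true)} ∪ {(sumSet A.1 ∅, false)}) ∪
            {(sumSet ∅ B.1, false)} := by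
        ext a
        simp only [Finset.mem_insert, Finset.mem_image, Finset.mem_union, Finset.mem_singleton]
        constructor
        · rintro (h | ⟨_, rfl | rfl, rfl⟩)
          · exact Or.inl (Or.inl h)
          · exact Or.inl (Or.inr rfl)
          · exact Or.inr rfl
        · rintro ((h | h) | h)
          · exact Or.inl h
          · exact Or.inr ⟨_, Or.inl rfl, h.symm⟩
          · exact Or.inr ⟨_, Or.inr rfl, h.symm⟩
      rw [hset]
      exact h
    · have hne : sumSet C ∅ ≠ sumSet A.1 B.1 := fun h => hB (sumSet_inj.1 h).2.symm
      rw [veeLoc, if_neg hne, if_pos (by simp), toLeft_sumSet]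
      refine (x.isOrientation_loc C hC).rename _ _ (by simp) ?_ ?_
      · rintro ⟨C₁, b₁⟩ _ ⟨C₂, b₂⟩ _ h
        simpa [sumSet_inj] using h
      · intro a
        rw [Forest.mem_halfEdges, Forest.children_vee_left]
        constructor
        · rintro (rfl | ⟨S, hS, rfl⟩)
          · exact ⟨(C, true), (Forest.mem_halfEdges _).2 (Or.inl rfl), rfl⟩
          · obtain ⟨D, hD, rfl⟩ := Finset.mem_image.1 hS
            exact ⟨(D, false), (Forest.mem_halfEdges _).2 (Or.inr ⟨D, hD, rfl⟩), rfl⟩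
        · rintro ⟨h, hh, h'⟩
          rw [← Option.some.inj h']
          rcases (Forest.mem_halfEdges _).1 hh with rfl | ⟨D, hD, rfl⟩
          · exact Or.inl rfl
          · exact Or.inr ⟨_, Finset.mem_image_of_mem _ hD, rfl⟩
    · have hne : sumSet ∅ D ≠ sumSet A.1 B.1 := fun h => hA (sumSet_inj.1 h).1.symm
      have hD0 : D ≠ ∅ :=
        (y.forest.nonempty D (y.forest.mem_verts.1 hD).1).ne_empty
      rw [veeLoc, if_neg hne, if_neg (by simpa using hD0), toRight_sumSet]
      refine (y.isOrientation_loc D hD).rename _ _ (by simp) ?_ ?_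
      · rintro ⟨C₁, b₁⟩ _ ⟨C₂, b₂⟩ _ h
        simpa [sumSet_inj] using h
      · intro a
        rw [Forest.mem_halfEdges, Forest.children_vee_right]
        constructor
        · rintro (rfl | ⟨S, hS, rfl⟩)
          · exact ⟨(D, true), (Forest.mem_halfEdges _).2 (Or.inl rfl), rfl⟩
          · obtain ⟨E, hE, rfl⟩ := Finset.mem_image.1 hS
            exact ⟨(E, false), (Forest.mem_halfEdges _).2 (Or.inr ⟨E, hE, rfl⟩), rfl⟩
        · rintro ⟨h, hh, h'⟩
          rw [← Option.some.inj h']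
          rcases (Forest.mem_halfEdges _).1 hh with rfl | ⟨E, hE, rfl⟩
          · exact Or.inl rfl
          · exact Or.inr ⟨_, Finset.mem_image_of_mem _ hE, rfl⟩

end InnerOrientedForest

end inner

end BesselOperad

end

noncomputable section

namespace BesselOperad

/-! ### Signs and substitutions in exterior algebras -/

section exterior

variable {X Y Z : Type*}

/-! On the underlying forests the identity is a computation of two graftings. In `Ω` the path from
`⋆` to the root has a single inner vertex, so composing with a forest `F` amounts to choosing one
root `A` of `F` and joining its tree to the leaf `#`. Afterwards the path from `#` to its root again
has a single inner vertex, and the second composition chooses one root `B` of the other forest `G`.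
The outcome is the term of the `∨` product that belongs to `A` and `B` (`Forest.graft_starGraft`).
Hence both sides are double sums over `A` and `B`, and they are compared term by term.

What remains is a sign. An inner-oriented forest has exactly one outer form, so it is enough that
each term of the composite is an outer form of `x.vee y A B` (`isOuterForm_vee`), i.e. that it
satisfies `Matches`. Let `a`, `b` be the orientations of the leaves and write those of the roots as
`s ∧ A` and `t ∧ B`. Up to sign, the composite has the leaf orientation `a ∧ b` and the root
orientation `s ∧ t ∧ (A ⊔ B)`. The sign comes from the composition of the leaves
(`extComp_sharp_star_leaves`) and from the Koszul sign of the tensor product; the composition of the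
roots contributes none (`extComp_sharp_star_roots`).

For the inner orientation, the root `A` is opened (`Matches.open_root`): the upper half-edge `A⁺` on
the side of the roots is traded for the lower one `A⁻` on the side of the vertices. If `A` is an
inner vertex, then `A⁺ ∧ A⁻` is the pair of an edge that becomes inner in the `∨` product; if the
tree is a single leaf, then `A⁺` is cancelled against the pair `A⁻ ∧ A⁺`. Both cases give the same
equation. The same is done for `B`, with `R` replaced by the upper half-edge `v⁺` of the new vertex.
As the local orientation at `v` is `v⁺ ∧ A⁻ ∧ B⁻`, the product of the two opened equations is, up to
order, the matching equation of the `∨` product. All pairs are central, so only three exchanges of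
blocks cost a sign (`mul_mul_eq_of_commute`). In `matches_vee` these signs are compared modulo 2,
using that the number of inner vertices has the parity of the number of leaves plus the number of
roots (`Matches.card_modEq`). -/

theorem IsOrientation.algHom_congr {s : Finset X} {o : Ext X} (h : IsOrientation s o)
    {A : Type*} [Ring A] [Algebra ℚ A] (φ ψ : Ext X →ₐ[ℚ] A)
    (hφ : ∀ x ∈ s, φ (gen x) = ψ (gen x)) : φ o = ψ o := by
  obtain ⟨l, -, h2, h3⟩ := h
  -- Only generators from `s` occur in `o`, so the two morphisms may differ elsewhere; this is what
  -- allows one renaming to be exchanged for another that agrees with it on `s`.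
  have key : φ (wedge l) = ψ (wedge l) := by
    rw [wedge, map_list_prod, map_list_prod, List.map_map, List.map_map]
    congr 1
    exact List.map_congr_left fun x hx => hφ x ((h2 x).1 hx)
  rcases h3 with rfl | rfl
  · exact key
  · rw [map_neg, map_neg, key]

@[simp] theorem rename_gen (p : X → Option Y) (x : X) :
    rename p (gen x) = (p x).elim 0 gen := substHom_gen _ _ _

/-- Contraction on the right with the coordinate form of `x`. -/
def contractGen [DecidableEq X] (x : X) : Ext X →ₗ[ℚ] Ext X :=
  CliffordAlgebra.contractRight.flip (Finsupp.lapply x)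

theorem contractGen_mul_gen [DecidableEq X] (x y : X) (z : Ext X) :
    contractGen x (z * gen y) = (if y = x then z else 0) - contractGen x z * gen y := by
  refine (CliffordAlgebra.contractRight_mul_ι (Q := (0 : QuadraticForm ℚ (X →₀ ℚ)))
    (Finsupp.lapply x) (Finsupp.single y 1) z).trans ?_
  congr 1
  by_cases h : y = x
  · subst h
    rw [if_pos rfl]
    simp
  · rw [if_neg h]
    simp [h]

theorem IsOrientation.contractGen_eq_zero [DecidableEq X] {s : Finset X} {o : Ext X}
    (h : IsOrientation s o) {x : X} (hx : x ∉ s) : contractGen x o = 0 := by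
  obtain ⟨l, -, h2, h3⟩ := h
  have key : contractGen x (wedge l) = 0 := contractRight_wedge x l (fun h => hx ((h2 x).1 h))
  rcases h3 with rfl | rfl <;> simp [key]

theorem IsOrientation.contractGen_mul_gen [DecidableEq X] {s : Finset X} {o : Ext X}
    (h : IsOrientation s o) {x : X} (hx : x ∉ s) : contractGen x (o * gen x) = o := by
  rw [BesselOperad.contractGen_mul_gen, if_pos rfl, h.contractGen_eq_zero hx]
  simp

/-- Moving `x` to the end costs only a sign, which is absorbed into `o'`. This is the form in which
the composition of `Det` is defined, with the composed element in last position. -/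
theorem IsOrientation.exists_mul_gen [DecidableEq X] {s : Finset X} {o : Ext X}
    (h : IsOrientation s o) {x : X} (hx : x ∈ s) :
    ∃ o', IsOrientation (s.erase x) o' ∧ o = o' * gen x := by
  obtain ⟨l, h1, h2, h3⟩ := h
  have hx' : x ∈ l := (h2 x).2 hx
  have hp : l.Perm (l.erase x ++ [x]) :=
    (List.perm_cons_erase hx').trans (List.perm_append_singleton x (l.erase x)).symm
  have ho : IsOrientation (s.erase x) (wedge (l.erase x)) :=
    isOrientation_wedge (h1.erase x) fun y => by
      rw [h1.mem_erase_iff, Finset.mem_erase, h2]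
  have hw : wedge (l.erase x ++ [x]) = wedge (l.erase x) * gen x := by simp
  have : o = wedge (l.erase x) * gen x ∨ o = -wedge (l.erase x) * gen x := by
    rw [neg_mul, ← hw]
    rcases wedge_perm hp with h | h <;> rcases h3 with rfl | rfl <;> simp [h]
  rcases this with h | h
  · exact ⟨_, ho, h⟩
  · exact ⟨_, ho.neg, h⟩

/-- Substitution of `0` for the generator `x`. -/
def killGen [DecidableEq X] (x : X) : Ext X →ₐ[ℚ] Ext X :=
  rename fun y => if y = x then none else some y

theorem killGen_gen [DecidableEq X] {x y : X} (h : y ≠ x) : killGen x (gen y) = gen y := by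
  simp [killGen, h]

theorem contractGen_killGen [DecidableEq X] (x : X) (z : Ext X) :
    contractGen x (killGen x z) = 0 := by
  -- The left factor `w` is needed for the induction: the case of a product is then two successive
  -- applications of the hypotheses. The claim is the case `w = 1`.
  have key : ∀ w : Ext X, contractGen x w = 0 →
      contractGen x (w * killGen x z) = 0 := by
    induction z using ExteriorAlgebra.induction with
    | algebraMap r =>
      intro w hw
      rw [AlgHom.commutes, ← Algebra.commutes, ← Algebra.smul_def, map_smul, hw, smul_zero]
    | ι m =>
      intro w hw
      induction m using Finsupp.induction_linear with
      | zero => simp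
      | add a b ha hb => rw [map_add, map_add, mul_add, map_add, ha, hb, add_zero]
      | single y r =>
        have : ExteriorAlgebra.ι ℚ (Finsupp.single y r) = r • gen y := by
          rw [gen, ← map_smul, Finsupp.smul_single, smul_eq_mul, mul_one]
        rw [this, map_smul, mul_smul_comm, map_smul]
        by_cases h : y = x
        · simp [killGen, h]
        · rw [killGen_gen h, BesselOperad.contractGen_mul_gen, if_neg h, hw]
          simp
    | mul a b ha hb =>
      intro w hw
      rw [map_mul (killGen x), ← mul_assoc]
      exact hb _ (ha _ hw)
    | add a b ha hb =>
      intro w hw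
      rw [map_add, mul_add, map_add, ha w hw, hb w hw, add_zero]
  have h1 : contractGen x (1 : Ext X) = 0 :=
    isOrientation_one.contractGen_eq_zero (Finset.notMem_empty x)
  simpa using key 1 h1

/-- Invariance under `killGen x` expresses that `x` does not occur; contraction with `x` then undoes
the multiplication by `x`. -/
theorem mul_gen_cancel [DecidableEq X] {x : X} {z w : Ext X} (hz : killGen x z = z)
    (hw : killGen x w = w) (h : z * gen x = w * gen x) : z = w := by
  have key : ∀ u : Ext X, killGen x u = u → contractGen x (u * gen x) = u := by
    intro u hu
    rw [BesselOperad.contractGen_mul_gen, if_pos rfl, ← hu, contractGen_killGen]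
    simp
  rw [← key z hz, h, key w hw]

/-- Elements of degree 2 are central. Hence the pairs of half-edges can be moved freely, and no sign
ever comes from them. -/
theorem commute_gen_mul_gen (x y : X) (z : Ext X) : Commute (gen x * gen y) z := by
  induction z using ExteriorAlgebra.induction with
  | algebraMap r => exact Algebra.commute_algebraMap_right _ _
  | ι m =>
    have h : ∀ t : X, gen t * ExteriorAlgebra.ι ℚ m = -(ExteriorAlgebra.ι ℚ m * gen t) := fun t =>
      eq_neg_of_add_eq_zero_left (ExteriorAlgebra.ι_add_mul_swap _ _)
    rw [commute_iff_eq, mul_assoc, h y, mul_neg, ← mul_assoc, h x, neg_mul, neg_neg, mul_assoc]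
  | mul a b ha hb => exact ha.mul_right hb
  | add a b ha hb => exact ha.add_right hb

/-- Up to sign, `z` is an exterior product of elements whose number has the parity of `n`. -/
def HasParity (n : ℕ) (z : Ext X) : Prop :=
  ∃ l : List X, l.length ≡ n [MOD 2] ∧ (z = wedge l ∨ z = -wedge l)

theorem neg_one_pow_congr_mod {m n : ℕ} (h : m ≡ n [MOD 2]) : (-1 : ℚ) ^ m = (-1) ^ n := by
  rw [neg_one_pow_eq_pow_mod_two, h, ← neg_one_pow_eq_pow_mod_two]

theorem HasParity.of_modEq {m n : ℕ} {z : Ext X} (h : HasParity m z) (hmn : m ≡ n [MOD 2]) :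
    HasParity n z := by
  obtain ⟨l, h1, h2⟩ := h
  exact ⟨l, h1.trans hmn, h2⟩

theorem IsOrientation.hasParity {s : Finset X} {o : Ext X} (h : IsOrientation s o) :
    HasParity s.card o := by
  classical
  obtain ⟨l, h1, h2, h3⟩ := h
  refine ⟨l, ?_, h3⟩
  rw [← List.toFinset_card_of_nodup h1]
  have : l.toFinset = s := by ext x; simp [h2]
  rw [this]

theorem hasParity_gen (x : X) : HasParity 1 (gen x) := ⟨[x], rfl, by simp⟩

theorem HasParity.mul {m n : ℕ} {z w : Ext X} (hz : HasParity m z) (hw : HasParity n w) :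
    HasParity (m + n) (z * w) := by
  obtain ⟨l, h1, h2⟩ := hz
  obtain ⟨l', h1', h2'⟩ := hw
  refine ⟨l ++ l', ?_, ?_⟩
  · rw [List.length_append]
    exact h1.add h1'
  · rcases h2 with rfl | rfl <;> rcases h2' with rfl | rfl <;> simp

theorem HasParity.list_prod (f : X → Ext Y) (l : List X) {n : ℕ}
    (hf : ∀ x ∈ l, HasParity n (f x)) : HasParity (l.length * n) (l.map f).prod := by
  induction l with
  | nil => exact ⟨[], by simp; rfl, by simp⟩
  | cons x l ih =>
    have := (hf x (by simp)).mul (ih fun y hy => hf y (by simp [hy]))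
    rw [List.map_cons, List.prod_cons, List.length_cons, add_mul, one_mul, add_comm]
    exact this

theorem HasParity.neg {n : ℕ} {z : Ext X} (h : HasParity n z) : HasParity n (-z) := by
  obtain ⟨l, h1, h2⟩ := h
  refine ⟨l, h1, ?_⟩
  rcases h2 with rfl | rfl <;> simp

theorem HasParity.rename {n : ℕ} {z : Ext X} (h : HasParity n z) (q : X → Y) :
    HasParity n (rename (fun x => some (q x)) z) := by
  obtain ⟨l, h1, h2⟩ := h
  have key : BesselOperad.rename (fun x => some (q x)) (wedge l) = wedge (l.map q) := by
    rw [BesselOperad.rename, substHom_wedge, wedge, List.map_map]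
    rfl
  refine ⟨l.map q, by simpa using h1, ?_⟩
  rcases h2 with rfl | rfl <;> simp [key]

theorem HasParity.mul_comm {m n : ℕ} {z w : Ext X} (hz : HasParity m z) (hw : HasParity n w) :
    z * w = (-1 : ℚ) ^ (m * n) • (w * z) := by
  obtain ⟨l, h1, h2⟩ := hz
  obtain ⟨l', h1', h2'⟩ := hw
  rw [← neg_one_pow_congr_mod (h1.mul h1')]
  have := wedge_mul_wedge l l'
  rcases h2 with rfl | rfl <;> rcases h2' with rfl | rfl <;> simp [this]

/-- The automorphism that negates every generator acts on `z` both by `(-1) ^ m` and by `(-1) ^ n`.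
The element 0 has to be excluded: lists with repetitions are allowed in `HasParity`, so 0 can have
both parities. -/
theorem HasParity.modEq {m n : ℕ} {z : Ext X} (hz : HasParity m z) (hz' : HasParity n z)
    (h0 : z ≠ 0) : m ≡ n [MOD 2] := by
  have key : ∀ n, HasParity n z →
      substHom (fun x : X => -gen x) (fun x y => by simpa using gen_swap x y) z =
        (-1 : ℚ) ^ n • z := by
    rintro n ⟨l, h1, h2⟩
    have hl : ∀ l : List X,
        substHom (fun x : X => -gen x) (fun x y => by simpa using gen_swap x y) (wedge l) =
        (-1 : ℚ) ^ l.length • wedge l := by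
      intro l
      induction l with
      | nil => simp
      | cons x l ih => rw [wedge_cons, map_mul, ih, substHom_gen, List.length_cons, pow_succ]; simp
    rw [← neg_one_pow_congr_mod h1]
    rcases h2 with rfl | rfl <;> simp [hl]
  have h := (key m hz).symm.trans (key n hz')
  have h' : (-1 : ℚ) ^ m = (-1) ^ n := smul_left_injective ℚ h0 h
  rw [neg_one_pow_eq_pow_mod_two, neg_one_pow_eq_pow_mod_two (n := n)] at h'
  rcases Nat.mod_two_eq_zero_or_one m with h1 | h1 <;>
    rcases Nat.mod_two_eq_zero_or_one n with h2 | h2 <;> rw [h1, h2] at h' <;>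
    first | exact h1.trans h2.symm | norm_num at h'

end exterior

/-! ### Products of pairs of half-edges -/

section pairs

variable {X Y : Type*}

/-- The product of the pairs `f C ∧ g C` for `C` in the finite set `s`. -/
def pairProd {D : Type*} (f g : D → X) (s : Finset D) : Ext X :=
  (s.toList.map fun C => gen (f C) * gen (g C)).prod

theorem commute_pairProd {D : Type*} (f g : D → X) (s : Finset D) (z : Ext X) :
    Commute (pairProd f g s) z := by
  refine Commute.list_prod_left _ _ fun w hw => ?_
  obtain ⟨C, -, rfl⟩ := List.mem_map.1 hw
  exact commute_gen_mul_gen _ _ _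

/-- Centrality of the pairs makes the product independent of the arbitrary order chosen by
`Finset.toList`. -/
theorem prod_pairs_perm {D : Type*} (f g : D → X) {l l' : List D} (h : l.Perm l') :
    (l.map fun C => gen (f C) * gen (g C)).prod = (l'.map fun C => gen (f C) * gen (g C)).prod := by
  refine (h.map _).prod_eq' ?_
  rw [List.pairwise_map]
  exact List.pairwise_of_forall fun _ _ => commute_gen_mul_gen _ _ _

theorem pairProd_insert {D : Type*} [DecidableEq D] (f g : D → X) {s : Finset D} {C : D}
    (h : C ∉ s) : pairProd f g (insert C s) = gen (f C) * gen (g C) * pairProd f g s := by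
  rw [pairProd, prod_pairs_perm f g (Finset.toList_insert h)]
  simp [pairProd]

theorem pairProd_empty {D : Type*} (f g : D → X) : pairProd f g ∅ = 1 := by
  simp [pairProd]

theorem pairProd_union {D : Type*} [DecidableEq D] (f g : D → X) {s t : Finset D}
    (h : Disjoint s t) : pairProd f g (s ∪ t) = pairProd f g s * pairProd f g t := by
  induction s using Finset.induction_on with
  | empty => simp [pairProd_empty]
  | insert C s hC ih =>
    rw [Finset.disjoint_insert_left] at h
    rw [Finset.insert_union, pairProd_insert f g (by simp [hC, h.1]), pairProd_insert f g hC,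
      ih h.2]
    simp only [mul_assoc]

theorem pairProd_image {D E : Type*} [DecidableEq D] [DecidableEq E] (f g : E → X) (q : D → E)
    (hq : Function.Injective q) (s : Finset D) :
    pairProd f g (s.image q) = pairProd (fun C => f (q C)) (fun C => g (q C)) s := by
  induction s using Finset.induction_on with
  | empty => simp [pairProd_empty]
  | insert C s hC ih =>
    rw [Finset.image_insert, pairProd_insert _ _ (by simpa [hq.eq_iff] using hC),
      pairProd_insert _ _ hC, ih]

theorem rename_pairProd {D : Type*} (f g : D → X) (q : X → Y) (s : Finset D) :
    rename (fun x => some (q x)) (pairProd f g s) =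
      pairProd (fun C => q (f C)) (fun C => q (g C)) s := by
  rw [pairProd, map_list_prod, List.map_map]
  simp [pairProd, Function.comp_def]

theorem hasParity_pairProd {D : Type*} (f g : D → X) (s : Finset D) :
    HasParity 0 (pairProd f g s) := by
  refine (HasParity.list_prod _ _ (n := 2) fun C _ =>
    (hasParity_gen _).mul (hasParity_gen _)).of_modEq ?_
  simp [Nat.ModEq]

end pairs

/-! ### Compositions along a path with one inner vertex -/

section operads

variable {I J K : Type*} [Fintype I] [DecidableEq I] [Fintype J] [DecidableEq J]
  [Fintype K] [DecidableEq K] {i : I} (e : {x : I // x ≠ i} ⊕ J ≃ K)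

theorem bCompAux_single (F : Forest I) (G : Forest J) (u : Ext (Finset I)) (w : Ext (Finset J)) :
    bCompAux e (Pi.single F u) (Pi.single G w) =
      ∑ c : {D // D ∈ F.path i} → {A // A ∈ G.roots},
        Pi.single (Forest.graft F G c e) (extComp (F.rootOf i)
          (fun r => some (Forest.glue e r ∅)) (Forest.graftRoot F G c e) u w) := by
  simp only [bCompAux, LinearMap.sum_apply, LinearMap.compr₂_apply, LinearMap.compl₁₂_apply,
    LinearMap.proj_apply, LinearMap.single_apply]
  -- Any other pair of forests has a zero component, and the composition of determinants is
  -- bilinear.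
  rw [Finset.sum_eq_single F, Finset.sum_eq_single G]
  · simp
  · intro G' _ h
    refine Finset.sum_eq_zero fun c _ => ?_
    rw [Pi.single_eq_of_ne (M := fun _ => Ext (Finset J)) h]
    simp
  · simp
  · intro F' _ h
    refine Finset.sum_eq_zero fun G' _ => Finset.sum_eq_zero fun c _ => ?_
    rw [Pi.single_eq_of_ne (M := fun _ => Ext (Finset I)) h]
    simp
  · simp

/-- The orientation of the roots of a graft that is composed from orientations of the roots. -/
def graftOrientation (F : Forest I) (G : Forest J)
    (c : {D // D ∈ F.path i} → {A // A ∈ G.roots}) (u : detSpace F.roots)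
    (w : detSpace G.roots) : detSpace (Forest.graft F G c e).roots :=
  ⟨extComp (F.rootOf i) (fun r => some (Forest.glue e r ∅)) (Forest.graftRoot F G c e) u.1 w.1,
    Forest.extComp_graft_mem F G c e u.2 w.2⟩

/-- An assignment of roots to the vertices of a path with one vertex is just the choice of one root.
Both compositions in the theorem are of this kind, so longer assignments never arise. -/
theorem bComp_rootOriented_of_path {F : Forest I} {D : Finset I} (hD : F.path i = {D})
    (G : Forest J) (u : detSpace F.roots) (w : detSpace G.roots) :
    bComp e (rootOriented F u) (rootOriented G w) =
      ∑ A : {A // A ∈ G.roots}, rootOriented (Forest.graft F G (fun _ => A) e)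
        (graftOrientation e F G (fun _ => A) u w) := by
  apply Subtype.ext
  refine (bCompAux_single e F G u.1 w.1).trans ?_
  rw [AddSubmonoidClass.coe_finsetSum]
  have : Unique {D // D ∈ F.path i} :=
    ⟨⟨⟨D, by simp [hD]⟩⟩, fun E => Subtype.ext (by simpa [hD] using E.2)⟩
  refine (Fintype.sum_equiv (Equiv.funUnique {D // D ∈ F.path i} {A // A ∈ G.roots}).symm _ _
    fun A => ?_).symm
  rfl

theorem bSign_rootOriented (d : ℕ) (F : Forest I) (o : detSpace F.roots) :
    bSign I d (rootOriented F o) = (-1 : ℚ) ^ (d * (F.roots.card + 1)) • rootOriented F o := by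
  apply Subtype.ext
  funext G
  change (-1 : ℚ) ^ (d * (G.roots.card + 1)) • (Pi.single F o.1 : Forest I → Ext (Finset I)) G =
    (-1 : ℚ) ^ (d * (F.roots.card + 1)) • (Pi.single F o.1 : Forest I → Ext (Finset I)) G
  by_cases h : G = F
  · rw [h]
  · rw [Pi.single_eq_of_ne h, smul_zero, smul_zero]

/-- The orientations live in types that depend on the forest; comparing them in the ambient exterior
algebra avoids a transport. -/
theorem rootOriented_congr {F G : Forest I} (h : F = G) {o : detSpace F.roots}
    {o' : detSpace G.roots} (ho : o.1 = o'.1) : rootOriented F o = rootOriented G o' := by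
  subst h
  rw [Subtype.ext ho]

end operads

/-! ### The two graftings on the leaves of `Ω` -/

/-- The orientation of the leaves in `Ω`. -/
def omegaLeaves : OpDet Bool :=
  ⟨wedge [false, true], (isOrientation_wedge (by simp) (by simp)).mem⟩

/-- The orientation of the root in `Ω`. -/
def omegaRoots : detSpace omegaTree.roots :=
  ⟨gen {false, true}, by rw [roots_omegaTree]; exact (isOrientation_gen _).mem⟩

theorem Omega_eq : Omega = omegaLeaves ⊗ₜ[ℚ] rootOriented omegaTree omegaRoots := rfl

namespace Forest

variable {I J : Type*} [Fintype I] [DecidableEq I] [Fintype J] [DecidableEq J]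

theorem path_omegaTree : omegaTree.path false = {{false, true}} := by decide

theorem branch_omegaTree : omegaTree.branch false {false, true} = {true} := by decide

theorem mem_clusters_omegaTree_and_notMem :
    ∀ C, C ∈ omegaTree.clusters ∧ false ∉ C ↔ C = {true} := by decide

/-- The leaf `#` is `true` in `Bool` and becomes `none` in `Option I`. -/
theorem glue_starEquiv_of_mem {S : Finset Bool} (h : true ∈ S) (A : Finset I) :
    glue (starEquiv I) S A = Finset.insertNone A := by
  ext k
  obtain ⟨z, rfl⟩ := (starEquiv I).surjective k
  rcases z with ⟨_ | _, hx⟩ | y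
  · exact absurd rfl hx
  · rw [mem_glue_inl]
    simpa [starEquiv] using h
  · rw [mem_glue_inr]
    simp [starEquiv]

theorem glue_starEquiv_of_notMem {S : Finset Bool} (h : true ∉ S) (A : Finset I) :
    glue (starEquiv I) S A = A.map Function.Embedding.some := by
  ext k
  obtain ⟨z, rfl⟩ := (starEquiv I).surjective k
  rcases z with ⟨_ | _, hx⟩ | y
  · exact absurd rfl hx
  · rw [mem_glue_inl]
    simpa [starEquiv] using h
  · rw [mem_glue_inr]
    simp [starEquiv]

theorem glue_sharpEquiv (S : Finset (Option I)) (B : Finset J) :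
    glue (sharpEquiv I J) S B = sumSet (Finset.eraseNone S) B := by
  ext k
  obtain ⟨z, rfl⟩ := (sharpEquiv I J).surjective k
  rcases z with ⟨_ | x, hx⟩ | y
  · exact absurd rfl hx
  · rw [mem_glue_inl]
    simp [sharpEquiv]
  · rw [mem_glue_inr]
    simp [sharpEquiv]

variable (F : Forest I) (G : Forest J) (A : {A // A ∈ F.roots}) (B : {B // B ∈ G.roots})

/-- The forest obtained from `F` by joining the tree with root `A` to a new leaf `none`. -/
abbrev starGraft : Forest (Option I) := graft omegaTree F (fun _ => A) (starEquiv I)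

theorem lump_omegaTree (C : Finset Bool) (A' : Finset I) :
    lump omegaTree false F (fun _ => A) C A' =
      if {false, true} ⊆ C ∧ A.1 = A' then {true} else ∅ := by
  ext x
  rw [mem_lump]
  constructor
  · rintro ⟨⟨D, hD⟩, h1, h2⟩
    rw [path_omegaTree, Finset.mem_singleton] at hD
    subst hD
    rw [if_pos h1]
    simpa [branch_omegaTree] using h2
  · intro h
    split_ifs at h with h1
    · exact ⟨⟨{false, true}, by simp [path_omegaTree]⟩, h1, by simpa [branch_omegaTree] using h⟩
    · simp at h

theorem mem_clusters_starGraft {S : Finset (Option I)} : S ∈ (starGraft F A).clusters ↔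
    S = {none} ∨ (∃ C ∈ F.clusters, S = C.map Function.Embedding.some) ∨
      S = Finset.insertNone A.1 := by
  change S ∈ graftClusters omegaTree F (fun _ => A) (starEquiv I) ↔ _
  rw [mem_graftClusters]
  -- The three kinds of clusters of a graft: those of `ω` that avoid `⋆`, which is only the leaf
  -- `#`; those of `F`; and the one that comes from the single vertex of the path, where `#` is
  -- joined to `A`.
  refine or_congr ?_ (or_congr ?_ ?_)
  · simp only [← and_assoc, mem_clusters_omegaTree_and_notMem, exists_eq_left]
    rw [glue_starEquiv_of_mem (by simp)]
    rfl
  · simp only [glue_starEquiv_of_notMem (Finset.notMem_empty _)]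
  · have : ∀ D : {D // D ∈ omegaTree.path false},
        glue (starEquiv I) (lump omegaTree false F (fun _ => A) D.1 A.1) A.1 =
          Finset.insertNone A.1 := by
      rintro ⟨D, hD⟩
      rw [path_omegaTree, Finset.mem_singleton] at hD
      subst hD
      rw [lump_omegaTree, if_pos ⟨subset_rfl, rfl⟩, glue_starEquiv_of_mem (by simp)]
    simp only [this]
    exact ⟨fun ⟨_, h⟩ => h, fun h => ⟨⟨{false, true}, by simp [path_omegaTree]⟩, h⟩⟩

theorem graftRoot_omegaTree (A' : Finset I) :
    graftRoot omegaTree F (fun _ => A) (starEquiv I) A' =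
      if A' = A.1 then Finset.insertNone A' else A'.map Function.Embedding.some := by
  rw [graftRoot, lump_omegaTree]
  by_cases h : A' = A.1
  · rw [if_pos ⟨Finset.subset_univ _, h.symm⟩, if_pos h, glue_starEquiv_of_mem (by simp)]
  · rw [if_neg fun h' => h h'.2.symm, if_neg h, glue_starEquiv_of_notMem (by simp)]

theorem mem_roots_starGraft {S : Finset (Option I)} : S ∈ (starGraft F A).roots ↔
    S = Finset.insertNone A.1 ∨ ∃ C ∈ F.roots.erase A.1, S = C.map Function.Embedding.some := by
  rw [starGraft, mem_roots_graft]
  constructor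
  · rintro (⟨r, hr, hne, -⟩ | ⟨C, hC, rfl⟩)
    · rw [roots_omegaTree, Finset.mem_singleton] at hr
      subst hr
      exact absurd (by decide) hne
    · rw [graftRoot_omegaTree]
      by_cases h : C = A.1
      · left
        rw [if_pos h, h]
      · right
        exact ⟨C, Finset.mem_erase.2 ⟨h, hC⟩, if_neg h⟩
  · rintro (rfl | ⟨C, hC, rfl⟩)
    · refine Or.inr ⟨A.1, A.2, ?_⟩
      rw [graftRoot_omegaTree, if_pos rfl]
    · rw [Finset.mem_erase] at hC
      refine Or.inr ⟨C, hC.2, ?_⟩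
      rw [graftRoot_omegaTree, if_neg hC.1]

/-- The Koszul sign of the second composition depends on the first composite only through this
number. -/
theorem card_roots_starGraft : (starGraft F A).roots.card = F.roots.card := by
  have : (starGraft F A).roots = insert (Finset.insertNone A.1)
      ((F.roots.erase A.1).image fun C => C.map Function.Embedding.some) := by
    ext S
    rw [mem_roots_starGraft]
    simp [eq_comm]
  rw [this, Finset.card_insert_of_notMem, Finset.card_image_of_injective,
    Finset.card_erase_add_one A.2]
  · exact Finset.map_injective _
  · intro h
    obtain ⟨C, -, h⟩ := Finset.mem_image.1 h
    have : none ∈ Finset.insertNone A.1 := by simp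
    rw [← h] at this
    simp at this

theorem rootOf_starGraft : (starGraft F A).rootOf none = Finset.insertNone A.1 :=
  rootOf_eq _ ((mem_roots_starGraft F A).2 (Or.inl rfl)) (by simp)

/-- Only the new vertex lies below the leaf `none`, so `bComp_rootOriented_of_path` applies to the
second composition as well. -/
theorem path_starGraft : (starGraft F A).path none = {Finset.insertNone A.1} := by
  ext S
  rw [mem_path, mem_clusters_starGraft, Finset.mem_singleton]
  constructor
  · rintro ⟨rfl | ⟨C, hC, rfl⟩ | rfl, h1, h2⟩
    · simp at h1
    · simp at h2
    · rfl
  · rintro rfl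
    refine ⟨Or.inr (Or.inr rfl), ?_, by simp⟩
    have := Finset.card_pos.2 (F.root_nonempty A.2)
    rw [Finset.card_insertNone]
    omega

theorem branch_starGraft : (starGraft F A).branch none (Finset.insertNone A.1) =
    A.1.map Function.Embedding.some := by
  have hA : Finset.insertNone A.1 ∈ (starGraft F A).path none := by simp [path_starGraft]
  ext x
  rw [mem_branch]
  constructor
  · rintro ⟨h1, h2⟩
    rcases x with _ | x
    · refine absurd (Finset.mem_singleton_self none) (h2 {none}
        ((mem_clusters_starGraft F A).2 (Or.inl rfl)) (by simp) ?_)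
      obtain ⟨a, ha⟩ := F.root_nonempty A.2
      refine Finset.ssubset_iff_subset_ne.2 ⟨by simp, fun h => ?_⟩
      have : some a ∈ Finset.insertNone A.1 := by simpa using ha
      rw [← h] at this
      simp at this
    · simpa using h1
  · intro hx
    obtain ⟨a, ha, rfl⟩ := Finset.mem_map.1 hx
    refine ⟨by simpa using ha, fun E hE hiE hEA hxE => ?_⟩
    rw [mem_clusters_starGraft] at hE
    rcases hE with rfl | ⟨C, hC, rfl⟩ | rfl
    · simp at hxE
    · simp at hiE
    · exact hEA.2 subset_rfl

theorem lump_starGraft (C : Finset (Option I)) (B' : Finset J) :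
    lump (starGraft F A) none G (fun _ => B) C B' =
      if Finset.insertNone A.1 ⊆ C ∧ B.1 = B' then A.1.map Function.Embedding.some else ∅ := by
  ext x
  rw [mem_lump]
  constructor
  · rintro ⟨⟨D, hD⟩, h1, h2⟩
    rw [path_starGraft, Finset.mem_singleton] at hD
    subst hD
    rw [if_pos h1]
    simpa only [branch_starGraft] using h2
  · intro h
    split_ifs at h with h1
    · exact ⟨⟨Finset.insertNone A.1, by simp [path_starGraft]⟩, h1,
        by simpa only [branch_starGraft] using h⟩
    · simp at h

/-- This is the theorem without orientations. The clusters that avoid `none` are those of `F`, the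
clusters of `G` are kept, and the single vertex of the path turns into `A ⊔ B`: the leaf `none` is
removed from it and the chosen root `B` is put in. -/
theorem graft_starGraft :
    graft (starGraft F A) G (fun _ => B) (sharpEquiv I J) = F.vee G A B := by
  apply Forest.ext
  ext S
  change S ∈ graftClusters (starGraft F A) G (fun _ => B) (sharpEquiv I J) ↔ _
  rw [mem_graftClusters, mem_clusters_vee]
  have h1 : (∃ C ∈ (starGraft F A).clusters, none ∉ C ∧ S = glue (sharpEquiv I J) C ∅) ↔
      ∃ C ∈ F.clusters, sumSet C ∅ = S := by
    constructor
    · rintro ⟨C, hC, hn, rfl⟩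
      rw [mem_clusters_starGraft] at hC
      rcases hC with rfl | ⟨C, hC, rfl⟩ | rfl
      · simp at hn
      · exact ⟨C, hC, by simp [glue_sharpEquiv]⟩
      · simp at hn
    · rintro ⟨C, hC, rfl⟩
      exact ⟨C.map Function.Embedding.some,
        (mem_clusters_starGraft F A).2 (Or.inr (Or.inl ⟨C, hC, rfl⟩)), by simp,
        by simp [glue_sharpEquiv]⟩
  have h2 : (∃ D ∈ G.clusters, S = glue (sharpEquiv I J) ∅ D) ↔
      ∃ D ∈ G.clusters, sumSet ∅ D = S := by
    simp [glue_sharpEquiv, eq_comm]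
  have h3 : (∃ D : {D // D ∈ (starGraft F A).path none}, S = glue (sharpEquiv I J)
      (lump (starGraft F A) none G (fun _ => B) D.1 B.1) B.1) ↔ S = sumSet A.1 B.1 := by
    have : ∀ D : {D // D ∈ (starGraft F A).path none}, glue (sharpEquiv I J)
        (lump (starGraft F A) none G (fun _ => B) D.1 B.1) B.1 = sumSet A.1 B.1 := by
      rintro ⟨D, hD⟩
      rw [path_starGraft, Finset.mem_singleton] at hD
      subst hD
      rw [lump_starGraft, if_pos ⟨subset_rfl, rfl⟩, glue_sharpEquiv]
      simp
    simp only [this]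
    exact ⟨fun ⟨_, h⟩ => h, fun h => ⟨⟨Finset.insertNone A.1, by simp [path_starGraft]⟩, h⟩⟩
  rw [h1, h2, h3, or_comm, or_assoc, or_comm, or_assoc]

theorem graftRoot_starGraft (B' : Finset J) :
    graftRoot (starGraft F A) G (fun _ => B) (sharpEquiv I J) B' =
      if B' = B.1 then sumSet A.1 B' else sumSet ∅ B' := by
  rw [graftRoot, lump_starGraft]
  by_cases h : B' = B.1
  · rw [if_pos ⟨Finset.subset_univ _, h.symm⟩, if_pos h, glue_sharpEquiv]
    simp
  · rw [if_neg fun h' => h h'.2.symm, if_neg h, glue_sharpEquiv]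
    simp

end Forest

/-! ### Identifying inner and outer orientations with an open root -/

section exterior

variable {X Y Z : Type*}

theorem rename_rename (p : X → Y) (q : Y → Z) (z : Ext X) :
    rename (fun y => some (q y)) (rename (fun x => some (p x)) z) =
      rename (fun x => some (q (p x))) z := by
  have : (rename fun y => some (q y)).comp (rename fun x => some (p x)) =
      rename fun x => some (q (p x)) := by
    apply ExteriorAlgebra.hom_ext
    apply Finsupp.lhom_ext'
    intro x
    apply LinearMap.ext_ring
    change rename (fun y => some (q y)) (rename (fun x => some (p x)) (gen x)) =
      rename (fun x => some (q (p x))) (gen x)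
    simp
  exact DFunLike.congr_fun this z

theorem killGen_pairProd [DecidableEq X] {D : Type*} {x : X} (f g : D → X) (s : Finset D)
    (h : ∀ C ∈ s, f C ≠ x ∧ g C ≠ x) : killGen x (pairProd f g s) = pairProd f g s := by
  rw [pairProd, map_list_prod, List.map_map]
  congr 1
  refine List.map_congr_left fun C hC => ?_
  have := h C (Finset.mem_toList.1 hC)
  simp [killGen_gen this.1, killGen_gen this.2]

theorem IsOrientation.killGen_rename [DecidableEq Y] {s : Finset X} {o : Ext X}
    (h : IsOrientation s o) (p : X → Y) {y : Y} (hp : ∀ x ∈ s, p x ≠ y) :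
    killGen y (BesselOperad.rename (fun x => some (p x)) o) =
      BesselOperad.rename (fun x => some (p x)) o := by
  refine h.algHom_congr ((killGen y).comp (BesselOperad.rename fun x => some (p x))) _
    fun x hx => ?_
  simp [killGen_gen (hp x hx)]

theorem hasParity_outerProduct {a : Ext X} {r : Ext (Finset X)} {m n : ℕ} (ha : HasParity m a)
    (hr : HasParity n r) : HasParity (m + 1 + n) (outerProduct a r) :=
  ((ha.rename _).mul (hasParity_gen _)).mul (hr.rename _)

end exterior

section inner

variable {I J : Type*} [Fintype I] [DecidableEq I] [Fintype J] [DecidableEq J]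

/-- The edges below the inner vertices, except the roots of the trees other than `A`. -/
def Forest.openEdges (F : Forest I) (A : Finset I) : Finset (Finset I) :=
  F.verts.filter fun C => C ∉ F.roots.erase A

/-- Once a vertex is attached below `A`, the edge `A` joins two inner vertices exactly when `A` is
itself one; otherwise its upper end is a leaf, and no inner edge is gained. -/
theorem Forest.openEdges_of_mem {F : Forest I} {A : Finset I} (hA : A ∈ F.verts) :
    F.openEdges A = insert A F.innerEdges := by
  ext C
  simp only [openEdges, innerEdges, Finset.mem_filter, Finset.mem_erase, Finset.mem_insert]
  by_cases h : C = A
  · subst h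
    simp [hA]
  · simp [h]

theorem Forest.openEdges_of_notMem {F : Forest I} {A : Finset I} (hA : A ∉ F.verts) :
    F.openEdges A = F.innerEdges := by
  ext C
  simp only [openEdges, innerEdges, Finset.mem_filter, Finset.mem_erase]
  refine and_congr_right fun h => ?_
  have : C ≠ A := by rintro rfl; exact hA h
  simp [this]

namespace InnerOrientedForest

variable (x : InnerOrientedForest I)

/-- `R` is replaced by one element and a vertex by three; both numbers are odd, so the parity is
that of the number of factors of the global orientation. -/
theorem hasParity_expand : HasParity (x.forest.verts.card + 1)
    (substHom x.expand x.expand_swap x.glob) := by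
  obtain ⟨l, h1, h2, h3⟩ := x.isOrientation_glob
  have hl : HasParity (l.length * 1) (l.map x.expand).prod := by
    refine HasParity.list_prod _ _ fun v hv => ?_
    have hv' := (h2 v).1 hv
    refine (x.isOrientation_expand v hv').hasParity.of_modEq ?_
    rcases v with _ | v
    · rfl
    · rw [expandSet, Finset.card_map, x.forest.card_halfEdges (by simpa using hv')]
      rfl
  have hc : l.length = x.forest.verts.card + 1 := by
    rw [← List.toFinset_card_of_nodup h1, ← Finset.card_insertNone]
    congr 1
    ext v
    rw [List.mem_toFinset, h2]
  rw [mul_one, hc, ← substHom_wedge x.expand x.expand_swap] at hl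
  rcases h3 with h | h <;> rw [h]
  · exact hl
  · rw [map_neg]
    exact hl.neg

/-- An upper half-edge occurs in the expansion only at an inner vertex, and there it belongs to that
vertex. -/
theorem killGen_expand {A : Finset I} (hA : A ∉ x.forest.verts) :
    killGen (some (A, true)) (substHom x.expand x.expand_swap x.glob) =
      substHom x.expand x.expand_swap x.glob := by
  refine x.isOrientation_glob.algHom_congr
    ((killGen (some (A, true))).comp (substHom x.expand x.expand_swap)) _ ?_
  rintro (_ | v) hv
  · simp [expand, killGen_gen]
  · have hv' : v ∈ x.forest.verts := by simpa using hv
    simp only [AlgHom.comp_apply, substHom_gen, expand, hv', if_true]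
    refine (x.isOrientation_loc v hv').killGen_rename (fun h => some h) fun h hh h' => ?_
    rw [Option.some.inj h', Forest.mem_halfEdges] at hh
    rcases hh with h | ⟨C, -, h⟩
    · exact hA ((Prod.mk.inj h).1 ▸ hv')
    · simp at h

variable {x}

/-- Both sides of the matching equation have the same parity. The pairs count for nothing, and the
element `R` contributes 1 on each side. -/
theorem Matches.card_modEq {a : Ext I} {r : Ext (Finset I)} (ha : IsOrientation Finset.univ a)
    (hr : IsOrientation x.forest.roots r) (h : x.Matches a r) :
    Fintype.card I + x.forest.roots.card ≡ x.forest.verts.card [MOD 2] := by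
  have h1 := (hasParity_outerProduct ha.hasParity hr.hasParity).mul
    (hasParity_pairProd (fun C => some (C, true)) (fun C => some (C, false)) x.forest.innerEdges)
  have h2 := (hasParity_pairProd (fun C => some (C, false)) (fun C => some (C, true))
    x.forest.trivialTrees).mul x.hasParity_expand
  -- `innerEdgePairs` and `leafRootPairs` are instances of `pairProd` by definition, so the
  -- hypothesis can be used as it is.
  have h0 : outerProduct a r * pairProd (fun C => some (C, true)) (fun C => some (C, false))
      x.forest.innerEdges = _ := h
  rw [h0] at h1
  have h3 := h1.modEq h2 x.isOrientation_right.ne_zero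
  rw [Finset.card_univ, add_zero, zero_add, add_right_comm] at h3
  exact Nat.ModEq.add_right_cancel' 1 h3

/-- The identification of an inner with an outer orientation, where the upper half-edge of the
root `A` is replaced by the lower one, on the other side. -/
theorem Matches.open_root {A : Finset I} (hA : A ∈ x.forest.roots) {a : Ext I}
    {s : Ext (Finset I)} (ha : IsOrientation Finset.univ a)
    (hs : IsOrientation (x.forest.roots.erase A) s) (h : x.Matches a (s * gen A)) :
    outerProduct a s * pairProd (fun C => some (C, true)) (fun C => some (C, false))
        (x.forest.openEdges A) =
      pairProd (fun C => some (C, false)) (fun C => some (C, true)) (x.forest.trivialTrees.erase A) *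
        substHom x.expand x.expand_swap x.glob * gen (some (A, false)) := by
  have h' : outerProduct a s * gen (some (A, true)) *
      pairProd (fun C => some (C, true)) (fun C => some (C, false)) x.forest.innerEdges =
      pairProd (fun C => some (C, false)) (fun C => some (C, true)) x.forest.trivialTrees *
        substHom x.expand x.expand_swap x.glob := by
    refine Eq.trans ?_ h
    simp only [outerProduct, map_mul, rename_gen, Option.elim_some, mul_assoc]
    rfl
  -- For an inner vertex `A`, multiply by `A⁻` on the right: together with the `A⁺` already present
  -- it forms the pair of the newly inner edge `A`. No pair of `A` occurs in the trivial trees.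
  by_cases hv : A ∈ x.forest.verts
  · rw [Forest.openEdges_of_mem hv, pairProd_insert, Finset.erase_eq_of_notMem, ← h']
    · rw [mul_assoc (outerProduct a s * _) _ (gen _), (commute_pairProd _ _ _ (gen _)).eq]
      simp only [mul_assoc]
    · simp [Forest.trivialTrees, hv]
    · simp [Forest.innerEdges, hA]
  · rw [Forest.openEdges_of_notMem hv]
    have hT : A ∈ x.forest.trivialTrees := Finset.mem_filter.2 ⟨hA, hv⟩
    -- Here `A` is a leaf joined to its root. It suffices to compare after multiplication by `A⁺`,
    -- which occurs on neither side: on the right, `A⁻ ∧ A⁺` then restores the pair erased from the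
    -- trivial trees.
    refine mul_gen_cancel (x := some (A, true)) ?_ ?_ ?_
    · have e1 := ha.killGen_rename (fun i => some (({i} : Finset I), false))
        (y := some (A, true)) (by simp)
      have e2 := hs.killGen_rename (fun C => some (C, true)) (y := some (A, true))
        (by simp +contextual)
      rw [map_mul, killGen_pairProd]
      · rw [outerProduct, map_mul, map_mul, killGen_gen (by simp), e1, e2]
      · intro C hC
        have : C ≠ A := by
          rintro rfl
          exact hv (Finset.mem_filter.1 hC).1
        simpa using this
    · rw [map_mul, map_mul, killGen_pairProd, x.killGen_expand hv, killGen_gen (by simp)]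
      intro C hC
      simpa using Finset.ne_of_mem_erase hC
    · rw [← Finset.insert_erase hT, pairProd_insert _ _ (Finset.notMem_erase _ _)] at h'
      rw [mul_assoc, (commute_pairProd _ _ _ (gen _)).eq, ← mul_assoc, h', mul_assoc,
        (commute_gen_mul_gen _ _ _).eq]
      simp only [mul_assoc]

end InnerOrientedForest

end inner

/-! ### Roots, inner edges and trivial trees of a `∨` product -/

section inner

variable {I J : Type*} [Fintype I] [DecidableEq I] [Fintype J] [DecidableEq J]

namespace Forest

variable (F : Forest I) (G : Forest J) (A : {A // A ∈ F.roots}) (B : {B // B ∈ G.roots})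

/-- The roots are read off from the description of the `∨` product as an iterated graft, where they
are already known. -/
theorem mem_roots_vee {S : Finset (I ⊕ J)} : S ∈ (F.vee G A B).roots ↔
    S = sumSet A.1 B.1 ∨ (∃ C ∈ F.roots.erase A.1, sumSet C ∅ = S) ∨
      ∃ D ∈ G.roots.erase B.1, sumSet ∅ D = S := by
  rw [← graft_starGraft, mem_roots_graft, rootOf_starGraft]
  constructor
  · rintro (⟨r, hr, hne, rfl⟩ | ⟨D, hD, rfl⟩)
    · rcases (mem_roots_starGraft F A).1 hr with h | ⟨C, hC, rfl⟩
      · exact absurd h hne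
      · exact Or.inr (Or.inl ⟨C, hC, by simp [glue_sharpEquiv]⟩)
    · rw [graftRoot_starGraft]
      by_cases h : D = B.1
      · rw [if_pos h, h]
        exact Or.inl rfl
      · rw [if_neg h]
        exact Or.inr (Or.inr ⟨D, Finset.mem_erase.2 ⟨h, hD⟩, rfl⟩)
  · rintro (rfl | ⟨C, hC, rfl⟩ | ⟨D, hD, rfl⟩)
    · exact Or.inr ⟨B.1, B.2, by rw [graftRoot_starGraft, if_pos rfl]⟩
    · refine Or.inl ⟨C.map Function.Embedding.some,
        (mem_roots_starGraft F A).2 (Or.inr ⟨C, hC, rfl⟩), fun h => ?_, by simp [glue_sharpEquiv]⟩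
      have : none ∈ Finset.insertNone A.1 := by simp
      rw [← h] at this
      simp at this
    · rw [Finset.mem_erase] at hD
      exact Or.inr ⟨D, hD.2, by rw [graftRoot_starGraft, if_neg hD.1]⟩

theorem sumSet_left_mem_roots_vee {C : Finset I} (hC : C.Nonempty) :
    sumSet C ∅ ∈ (F.vee G A B).roots ↔ C ∈ F.roots.erase A.1 := by
  have hB := (G.root_nonempty B.2).ne_empty
  rw [mem_roots_vee]
  simp [sumSet_inj, hB.symm, hC.ne_empty.symm]

theorem sumSet_right_mem_roots_vee {D : Finset J} (hD : D.Nonempty) :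
    sumSet ∅ D ∈ (F.vee G A B).roots ↔ D ∈ G.roots.erase B.1 := by
  have hA := (F.root_nonempty A.2).ne_empty
  rw [mem_roots_vee]
  simp [sumSet_inj, hA.symm, hD.ne_empty.symm]

theorem sumSet_left_mem_verts_vee {C : Finset I} :
    sumSet C ∅ ∈ (F.vee G A B).verts ↔ C ∈ F.verts := by
  have hB := (G.root_nonempty B.2).ne_empty
  rw [mem_verts_vee]
  simp only [sumSet_inj, hB.symm, and_false, false_or, and_true, exists_eq_right]
  refine or_iff_left_of_imp ?_
  -- Subsets coming from the two forests can agree only if both are empty, and the empty set is not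
  -- an inner vertex.
  rintro ⟨D, hD, -, rfl⟩
  simp [mem_verts] at hD

theorem sumSet_right_mem_verts_vee {D : Finset J} :
    sumSet ∅ D ∈ (F.vee G A B).verts ↔ D ∈ G.verts := by
  have hA := (F.root_nonempty A.2).ne_empty
  rw [mem_verts_vee]
  simp only [sumSet_inj, hA.symm, false_and, false_or, true_and, exists_eq_right]
  refine or_iff_right_of_imp ?_
  rintro ⟨C, hC, rfl, -⟩
  simp [mem_verts] at hC

theorem verts_nonempty {C : Finset I} (hC : C ∈ F.verts) : C.Nonempty :=
  F.nonempty C (F.mem_verts.1 hC).1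

/-- `A` and `B` cease to be roots, so the edges below them become inner if they start at an inner
vertex; the new vertex is itself a root and adds no inner edge. -/
theorem innerEdges_vee : (F.vee G A B).innerEdges =
    ((F.openEdges A.1).image fun C => sumSet C ∅) ∪
      (G.openEdges B.1).image fun D => sumSet ∅ D := by
  ext S
  simp only [innerEdges, openEdges, Finset.mem_union, Finset.mem_image, Finset.mem_filter]
  constructor
  · rintro ⟨hv, hr⟩
    rcases (mem_verts_vee F G A B).1 hv with rfl | ⟨C, hC, rfl⟩ | ⟨D, hD, rfl⟩
    · exact absurd ((mem_roots_vee F G A B).2 (Or.inl rfl)) hr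
    · rw [sumSet_left_mem_roots_vee F G A B (F.verts_nonempty hC)] at hr
      exact Or.inl ⟨C, ⟨hC, hr⟩, rfl⟩
    · rw [sumSet_right_mem_roots_vee F G A B (G.verts_nonempty hD)] at hr
      exact Or.inr ⟨D, ⟨hD, hr⟩, rfl⟩
  · rintro (⟨C, ⟨hC, hr⟩, rfl⟩ | ⟨D, ⟨hD, hr⟩, rfl⟩)
    · rw [sumSet_left_mem_roots_vee F G A B (F.verts_nonempty hC), sumSet_left_mem_verts_vee]
      exact ⟨hC, hr⟩
    · rw [sumSet_right_mem_roots_vee F G A B (G.verts_nonempty hD), sumSet_right_mem_verts_vee]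
      exact ⟨hD, hr⟩

/-- The trees of `A` and `B` are absorbed into a tree that has an inner vertex, hence are lost from
the trivial ones. -/
theorem trivialTrees_vee : (F.vee G A B).trivialTrees =
    ((F.trivialTrees.erase A.1).image fun C => sumSet C ∅) ∪
      (G.trivialTrees.erase B.1).image fun D => sumSet ∅ D := by
  ext S
  simp only [trivialTrees, Finset.mem_union, Finset.mem_image, Finset.mem_filter,
    ← Finset.filter_erase]
  constructor
  · rintro ⟨hr, hv⟩
    rcases (mem_roots_vee F G A B).1 hr with rfl | ⟨C, hC, rfl⟩ | ⟨D, hD, rfl⟩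
    · exact absurd ((mem_verts_vee F G A B).2 (Or.inl rfl)) hv
    · rw [sumSet_left_mem_verts_vee] at hv
      exact Or.inl ⟨C, ⟨hC, hv⟩, rfl⟩
    · rw [sumSet_right_mem_verts_vee] at hv
      exact Or.inr ⟨D, ⟨hD, hv⟩, rfl⟩
  · rintro (⟨C, ⟨hC, hv⟩, rfl⟩ | ⟨D, ⟨hD, hv⟩, rfl⟩)
    · rw [sumSet_left_mem_verts_vee]
      exact ⟨(mem_roots_vee F G A B).2 (Or.inr (Or.inl ⟨C, hC, rfl⟩)), hv⟩
    · rw [sumSet_right_mem_verts_vee]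
      exact ⟨(mem_roots_vee F G A B).2 (Or.inr (Or.inr ⟨D, hD, rfl⟩)), hv⟩

theorem disjoint_image_sumSet {s : Finset (Finset I)} {t : Finset (Finset J)}
    (hs : ∀ C ∈ s, C.Nonempty) :
    Disjoint (s.image fun C => sumSet C (∅ : Finset J)) (t.image fun D => sumSet ∅ D) := by
  rw [Finset.disjoint_left]
  intro S hS hS'
  obtain ⟨C, hC, rfl⟩ := Finset.mem_image.1 hS
  obtain ⟨D, -, h⟩ := Finset.mem_image.1 hS'
  exact (hs C hC).ne_empty (sumSet_inj.1 h).1.symm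

theorem pairProd_vee {X : Type*} (f g : Finset (I ⊕ J) → X) {s : Finset (Finset I)}
    {t : Finset (Finset J)} (hs : ∀ C ∈ s, C.Nonempty) :
    pairProd f g ((s.image fun C => sumSet C (∅ : Finset J)) ∪ t.image fun D => sumSet ∅ D) =
      pairProd (fun C => f (sumSet C ∅)) (fun C => g (sumSet C ∅)) s *
        pairProd (fun D => f (sumSet ∅ D)) (fun D => g (sumSet ∅ D)) t := by
  rw [pairProd_union _ _ (disjoint_image_sumSet hs), pairProd_image _ _ _ fun C D h =>
    (sumSet_inj.1 h).1, pairProd_image _ _ _ fun C D h => (sumSet_inj.1 h).2]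

end Forest

/-! ### Expansion of the inner orientation of a `∨` product -/

namespace InnerOrientedForest

/-- The half-edge of the first forest as a half-edge of the `∨` product. -/
def veeInl : Option (Finset I × Bool) → Option (Finset (I ⊕ J) × Bool) :=
  Option.map fun h => (sumSet h.1 ∅, h.2)

/-- The half-edge of the second forest as a half-edge of the `∨` product, where the auxiliary
element is replaced by the upper half-edge at `v`. -/
def veeInr (v : Finset (I ⊕ J)) (h : Option (Finset J × Bool)) : Option (Finset (I ⊕ J) × Bool) :=
  some (h.elim (v, true) fun h => (sumSet ∅ h.1, h.2))

variable (x : InnerOrientedForest I) (y : InnerOrientedForest J)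
  (A : {A // A ∈ x.forest.roots}) (B : {B // B ∈ y.forest.roots})

theorem expand_vee_left {C : Finset I} (hC : C ∈ x.forest.verts) :
    (x.vee y A B).expand (some (sumSet C ∅)) =
      rename (fun h => some (veeInl h)) (x.expand (some C)) := by
  have hB := (y.forest.root_nonempty B.2).ne_empty
  have h1 : sumSet C ∅ ∈ (x.vee y A B).forest.verts :=
    (Forest.sumSet_left_mem_verts_vee _ _ A B).2 hC
  have h2 : (x.vee y A B).loc (sumSet C ∅) =
      rename (fun h => some (h.1.disjSum ∅, h.2)) (x.loc C) := by
    change veeLoc x y A B _ = _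
    -- The vertex differs from the new one because `B` is nonempty, and its right part is empty, so
    -- `veeLoc` takes its second branch.
    rw [veeLoc, if_neg (by simp [sumSet_inj, hB.symm]), if_pos (by simp), toLeft_sumSet]
  simp only [expand, h1, hC, if_true]
  rw [h2, rename_rename, rename_rename]
  rfl

theorem expand_vee_right {D : Finset J} (hD : D ∈ y.forest.verts) :
    (x.vee y A B).expand (some (sumSet ∅ D)) =
      rename (fun h => some (veeInr (sumSet A.1 B.1) h)) (y.expand (some D)) := by
  have hA := (x.forest.root_nonempty A.2).ne_empty
  have h1 : sumSet ∅ D ∈ (x.vee y A B).forest.verts :=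
    (Forest.sumSet_right_mem_verts_vee _ _ A B).2 hD
  have h2 : (x.vee y A B).loc (sumSet ∅ D) =
      rename (fun h => some (sumSet ∅ h.1, h.2)) (y.loc D) := by
    change veeLoc x y A B _ = _
    rw [veeLoc, if_neg (by simp [sumSet_inj, hA.symm]), if_neg
      (by simpa using (y.forest.verts_nonempty hD).ne_empty), toRight_sumSet]
  simp only [expand, h1, hD, if_true]
  rw [h2, rename_rename, rename_rename]
  rfl

theorem expand_vee_new : (x.vee y A B).expand (some (sumSet A.1 B.1)) =
    gen (some (sumSet A.1 B.1, true)) *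
      (gen (some (sumSet A.1 ∅, false)) * gen (some (sumSet ∅ B.1, false))) := by
  have h1 : sumSet A.1 B.1 ∈ (x.vee y A B).forest.verts :=
    (Forest.mem_verts_vee _ _ A B).2 (Or.inl rfl)
  have h2 : (x.vee y A B).loc (sumSet A.1 B.1) = gen (sumSet A.1 B.1, true) *
      gen (sumSet A.1 ∅, false) * gen (sumSet ∅ B.1, false) := if_pos rfl
  simp only [expand, h1, if_true]
  rw [h2, map_mul, map_mul]
  simp [mul_assoc]

/-- The global orientation of the `∨` product, after the replacement of each inner vertex by its
local orientation. -/
theorem substHom_expand_vee : substHom (x.vee y A B).expand (x.vee y A B).expand_swap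
      (x.vee y A B).glob =
    (-1 : ℚ) ^ x.forest.verts.card •
      (rename (fun h => some (veeInl h)) (substHom x.expand x.expand_swap x.glob) *
        (rename (fun h => some (veeInr (sumSet A.1 B.1) h))
            (substHom y.expand y.expand_swap y.glob) *
          (gen (some (sumSet A.1 ∅, false)) * gen (some (sumSet ∅ B.1, false))))) := by
  have h1 : substHom (x.vee y A B).expand (x.vee y A B).expand_swap
      (rename (fun v => some (v.elim none fun C => some (sumSet C ∅))) x.glob) =
      rename (fun h => some (veeInl h)) (substHom x.expand x.expand_swap x.glob) := by
    refine x.isOrientation_glob.algHom_congr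
      ((substHom (x.vee y A B).expand (x.vee y A B).expand_swap).comp (rename _))
      ((rename _).comp (substHom x.expand x.expand_swap)) ?_
    rintro (_ | C) hC
    · simp [expand, veeInl]
    · simpa using expand_vee_left x y A B (by simpa using hC)
  have h2 : substHom (x.vee y A B).expand (x.vee y A B).expand_swap
      (rename (fun v => some (v.elim (some (sumSet A.1 B.1)) fun C => some (sumSet ∅ C)))
        y.glob) =
      rename (fun h => some (veeInr (sumSet A.1 B.1) h))
        (substHom y.expand y.expand_swap y.glob) *
          (gen (some (sumSet A.1 ∅, false)) * gen (some (sumSet ∅ B.1, false))) := by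
    -- `R` is the one generator whose image is not just renamed: it becomes `v`, hence `v⁺ ∧ A⁻ ∧
    -- B⁻`, whereas `veeInr` supplies only `v⁺`. With `R` in last position the surplus `A⁻ ∧ B⁻`
    -- appears on the right, and the vertices are treated one generator at a time.
    obtain ⟨o, ho, h⟩ := y.isOrientation_glob.exists_mul_gen (x := none) (by simp)
    have ho' : substHom (x.vee y A B).expand (x.vee y A B).expand_swap
        (rename (fun v => some (v.elim (some (sumSet A.1 B.1)) fun C => some (sumSet ∅ C))) o) =
        rename (fun h => some (veeInr (sumSet A.1 B.1) h))
          (substHom y.expand y.expand_swap o) := by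
      refine ho.algHom_congr
        ((substHom (x.vee y A B).expand (x.vee y A B).expand_swap).comp (rename _))
        ((rename _).comp (substHom y.expand y.expand_swap)) ?_
      rintro (_ | C) hC
      · simp at hC
      · simpa using expand_vee_right x y A B (by simpa using hC)
    rw [h]
    simp only [map_mul, ho', rename_gen, substHom_gen, Option.elim_some, Option.elim_none,
      expand_vee_new]
    simp only [expand, rename_gen, Option.elim_some, mul_assoc]
    rfl
  change substHom (x.vee y A B).expand (x.vee y A B).expand_swap (veeGlob x y A B) = _
  rw [veeGlob, map_smul, map_mul, h1, h2]

end InnerOrientedForest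

end inner

/-! ### The matching equation of a `∨` product -/

/-- The hypotheses `h₁` and `h₂` stand for the two matching equations with open roots: `aᵢ` leaves,
`sᵢ` remaining roots, `Pᵢ` and `Lᵢ` pairs, `gᵢ` expanded global orientations, `p` and `q` the lower
half-edges of the opened roots, and `V` the upper half-edge of the new vertex. They are multiplied
together. The three scalars pay for moving `p` past `g₂`, then `a₂` past `R ∧ s₁`, and `V` past
`s₂`; the pairs move for free. -/
theorem mul_mul_eq_of_commute {E : Type*} [Ring E] [Algebra ℚ E]
    {a₁ a₂ R V s₁ s₂ P₁ P₂ L₁ L₂ g₁ g₂ p q : E} {ε₁ ε₂ ε₃ : ℚ}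
    (hP : ∀ z, Commute P₁ z) (hL : ∀ z, Commute L₂ z) (h₁ : a₁ * R * s₁ * P₁ = L₁ * g₁ * p)
    (h₂ : a₂ * V * s₂ * P₂ = L₂ * g₂ * q) (hg : g₂ * p = ε₁ • (p * g₂))
    (hs : R * s₁ * a₂ = ε₂ • (a₂ * (R * s₁))) (hV : V * s₂ = ε₃ • (s₂ * V)) :
    L₁ * L₂ * (g₁ * (g₂ * (p * q))) =
      (ε₁ * ε₂ * ε₃) • (a₁ * a₂ * R * (s₁ * (s₂ * V)) * (P₁ * P₂)) := by
  calc L₁ * L₂ * (g₁ * (g₂ * (p * q))) = L₁ * (L₂ * (g₁ * (g₂ * p))) * q := by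
        simp only [mul_assoc]
    _ = ε₁ • (L₁ * (L₂ * (g₁ * p)) * g₂ * q) := by
        rw [hg]
        simp only [mul_smul_comm, smul_mul_assoc, mul_assoc]
    _ = ε₁ • ((L₁ * g₁ * p) * (L₂ * g₂ * q)) := by
        rw [(hL _).eq]
        simp only [mul_assoc]
    _ = ε₁ • (a₁ * (R * s₁) * (P₁ * (a₂ * (V * s₂))) * P₂) := by
        rw [← h₁, ← h₂]
        simp only [mul_assoc]
    _ = ε₁ • (a₁ * ((R * s₁ * a₂) * (V * s₂)) * (P₁ * P₂)) := by
        rw [(hP _).eq]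
        simp only [mul_assoc]
    _ = _ := by
        rw [hs, hV]
        simp only [mul_smul_comm, smul_mul_assoc, smul_smul, mul_assoc, mul_comm ε₃]

/-- The left side is the form produced by the composition, in which only the chosen root `B` is
enlarged; with `B` split off, the other roots are merely renamed. -/
theorem rename_mul_gen_sumSet {I J : Type*} [DecidableEq J] {s : Finset (Finset J)} {B : Finset J}
    {t : Ext (Finset J)} (ht : IsOrientation (s.erase B) t) (A : Finset I) :
    rename (fun D => some (if D = B then sumSet A D else sumSet ∅ D)) (t * gen B) =
      rename (fun D => some (sumSet ∅ D)) t * gen (sumSet A B) := by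
  rw [map_mul, rename_gen, if_pos rfl]
  congr 1
  refine ht.algHom_congr _ _ fun D hD => ?_
  simp [Finset.ne_of_mem_erase hD]

section inner

variable {I J : Type*} [Fintype I] [DecidableEq I] [Fintype J] [DecidableEq J]

namespace InnerOrientedForest

theorem IsOuterForm.eq_toBess {x : InnerOrientedForest I} {t : Bess I} (h : x.IsOuterForm t) :
    t = x.toBess :=
  x.existsUnique_isOuterForm.unique h x.isOuterForm_toBess

variable {x : InnerOrientedForest I} {y : InnerOrientedForest J}
  {A : {A // A ∈ x.forest.roots}} {B : {B // B ∈ y.forest.roots}}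

/-- The sign in front of `a ∧ b` is the total sign of the composite in `Bess`. It has to agree with
`(-1) ^ deg o₁` from the definition of `o₁ ∨ o₂` times the three signs of `mul_mul_eq_of_commute`.
-/
theorem matches_vee {a : Ext I} {b : Ext J} {s : Ext (Finset I)} {t : Ext (Finset J)}
    (ha : IsOrientation Finset.univ a) (hb : IsOrientation Finset.univ b)
    (hr : IsOrientation x.forest.roots (s * gen A.1))
    (hs : IsOrientation (x.forest.roots.erase A.1) s)
    (hq : IsOrientation y.forest.roots (t * gen B.1))
    (ht : IsOrientation (y.forest.roots.erase B.1) t)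
    (hx : x.Matches a (s * gen A.1)) (hy : y.Matches b (t * gen B.1)) :
    (x.vee y A B).Matches
      ((-1 : ℚ) ^ (Fintype.card I + x.forest.roots.card + Fintype.card J +
          Fintype.card J * x.forest.roots.card) •
        (rename (fun i => some (Sum.inl i)) a * rename (fun j => some (Sum.inr j)) b))
      (rename (fun C => some (sumSet C ∅)) s *
        rename (fun D => some (if D = B.1 then sumSet A.1 D else sumSet ∅ D)) (t * gen B.1)) := by
  have hnx := hx.card_modEq ha hr
  have hny := hy.card_modEq hb hq
  have kx := Finset.card_erase_add_one A.2
  have ky := Finset.card_erase_add_one B.2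
  -- Both equations are carried into the exterior algebra of the `∨` product. In the first `R` stays
  -- `R`; in the second it becomes `v⁺`.
  have h₁ := congrArg (rename fun h => some (veeInl (J := J) h)) (hx.open_root A.2 ha hs)
  have h₂ := congrArg (rename fun h => some (veeInr (sumSet A.1 B.1) h)) (hy.open_root B.2 hb ht)
  simp only [outerProduct, map_mul, rename_rename, rename_pairProd, rename_gen,
    Option.elim_some] at h₁ h₂
  have hV := (hasParity_gen (some (sumSet A.1 B.1, true))).mul_comm
    (ht.hasParity.rename fun D => some (sumSet (∅ : Finset I) D, true))
  have hsb := ((hasParity_gen none).mul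
    (hs.hasParity.rename fun C => some (sumSet C (∅ : Finset J), true))).mul_comm
      (hb.hasParity.rename fun j => some (({Sum.inr j} : Finset (I ⊕ J)), false))
  have hg := (y.hasParity_expand.rename (veeInr (sumSet A.1 B.1))).mul_comm
    (hasParity_gen (some (sumSet A.1 (∅ : Finset J), false)))
  -- A leaf is encoded as the lower half-edge of its singleton, so singletons of the two parts have
  -- to be recognised as singletons of the sum.
  have eI : ∀ i : I, sumSet {i} (∅ : Finset J) = {Sum.inl i} := fun i => by
    ext (z | z) <;> simp
  have eJ : ∀ j : J, sumSet (∅ : Finset I) {j} = {Sum.inr j} := fun j => by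
    ext (z | z) <;> simp
  have key := mul_mul_eq_of_commute (commute_pairProd _ _ _) (commute_pairProd _ _ _) h₁ h₂ hg
    (by simpa only [veeInl, veeInr, Option.map_some, Option.map_none, Option.elim_some, eJ]
      using hsb) hV
  have hP : innerEdgePairs (x.vee y A B).forest = _ :=
    (congrArg _ (Forest.innerEdges_vee x.forest y.forest A B)).trans
      (Forest.pairProd_vee (fun C => some (C, true)) (fun C => some (C, false)) fun C hC =>
        x.forest.verts_nonempty (Finset.mem_filter.1 hC).1)
  have hL : leafRootPairs (x.vee y A B).forest = _ :=
    (congrArg _ (Forest.trivialTrees_vee x.forest y.forest A B)).trans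
      (Forest.pairProd_vee (fun C => some (C, false)) (fun C => some (C, true)) fun C hC =>
        x.forest.root_nonempty (Finset.mem_filter.1 (Finset.mem_of_mem_erase hC)).1)
  rw [Matches, substHom_expand_vee, hP, hL, rename_mul_gen_sumSet ht, outerProduct]
  simp only [map_mul, map_smul, rename_rename, rename_gen, Option.elim_some, mul_smul_comm,
    smul_mul_assoc]
  refine Eq.trans ?_ (congrArg (fun z => (-1 : ℚ) ^ x.forest.verts.card • z) key).symm
  rw [smul_smul]
  simp only [veeInl, veeInr, Option.map_some, Option.map_none, Option.elim_some, Option.elim_none,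
    eI, eJ]
  congr 1
  rw [← pow_add, ← pow_add, ← pow_add]
  apply neg_one_pow_congr_mod
  rw [← ZMod.natCast_eq_natCast_iff] at hnx hny ⊢
  have h2 : (2 : ZMod 2) = 0 := rfl
  rw [← ky] at hny
  rw [← kx] at hnx ⊢
  simp only [Finset.card_univ]
  push_cast at hnx hny ⊢
  -- Modulo 2, `hnx` and `hny` replace the numbers of inner vertices by numbers of leaves and roots;
  -- the number of roots of the second forest then occurs twice and drops out.
  linear_combination hnx + hny - ((y.forest.roots.erase B.1).card + 1 : ZMod 2) * h2

end InnerOrientedForest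

end inner

/-! ### The orientations produced by the two compositions -/

/-- One sign comes from bringing `⋆` to the end of `⋆ ∧ #`, the other `|I|` from bringing `#` past
`a` so that it can be composed in its turn. -/
theorem extComp_sharp_star_leaves {I J : Type*} [Fintype I] [DecidableEq I]
    {a : Ext I} (ha : IsOrientation Finset.univ a) (b : Ext J) :
    extComp none (leafInl (sharpEquiv I J)) (fun y => sharpEquiv I J (Sum.inr y))
      (extComp false (leafInl (starEquiv I)) (fun y => starEquiv I (Sum.inr y))
        (wedge [false, true]) a) b =
      (-1 : ℚ) ^ (Fintype.card I + 1) •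
        (rename (fun i => some (Sum.inl i)) a * rename (fun j => some (Sum.inr j)) b) := by
  have h1 : CliffordAlgebra.contractRight (wedge [false, true]) (Finsupp.lapply false) =
      -gen true := by
    have h := (isOrientation_gen true).neg.contractGen_mul_gen (x := false) (by simp)
    rw [neg_mul, gen_swap, neg_neg] at h
    rw [wedge_cons, wedge_cons, wedge_nil, mul_one]
    exact h
  have h2 : rename (leafInl (starEquiv I)) (gen true) = gen none := by
    simp [leafInl, starEquiv]
  have h3 : IsOrientation (Finset.univ.map Function.Embedding.some)
      (rename (fun i => some (some i)) a) :=
    ha.rename _ _ (by simp) (by simp) (by simp)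
  have h4 := h3.contractGen_mul_gen (x := none) (by simp)
  have h5 := (hasParity_gen none).mul_comm (ha.hasParity.rename some)
  have h6 : rename (leafInl (sharpEquiv I J)) (rename (fun i => some (some i)) a) =
      rename (fun i => some (Sum.inl i)) a := by
    -- `leafInl` kills the composed leaf `none`, but only the elements `some i` occur here.
    refine ha.algHom_congr ((rename (leafInl (sharpEquiv I J))).comp (rename _)) _ fun i _ => ?_
    simp [leafInl, sharpEquiv]
  rw [extComp_apply, extComp_apply, h1, map_neg, h2, neg_mul]
  change rename _ (contractGen none (-(gen none * rename (fun i => some (some i)) a))) * _ = _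
  rw [h5, map_neg, map_smul, h4, map_neg, map_smul, h6, one_mul, Finset.card_univ, pow_succ]
  simp [sharpEquiv]

section inner

variable {I J : Type*} [Fintype I] [DecidableEq I] [Fintype J] [DecidableEq J]

/-- There is no sign: `ω` has a single root, so the first composition only enlarges the last factor
`A` to the root that contains `#`, and this root is still in last position when the second
composition removes it. -/
theorem extComp_sharp_star_roots (F : Forest I) (G : Forest J) (A : {A // A ∈ F.roots})
    (B : {B // B ∈ G.roots}) {s : Ext (Finset I)} (hs : IsOrientation (F.roots.erase A.1) s)
    (w : Ext (Finset J)) :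
    extComp ((Forest.starGraft F A).rootOf none)
      (fun r => some (Forest.glue (sharpEquiv I J) r ∅))
      (Forest.graftRoot (Forest.starGraft F A) G (fun _ => B) (sharpEquiv I J))
      (extComp (omegaTree.rootOf false) (fun r => some (Forest.glue (starEquiv I) r ∅))
        (Forest.graftRoot omegaTree F (fun _ => A) (starEquiv I)) (gen {false, true})
        (s * gen A.1)) w =
      rename (fun C => some (sumSet C ∅)) s *
        rename (fun D => some (if D = B.1 then sumSet A.1 D else sumSet ∅ D)) w := by
  have hroot : omegaTree.rootOf false = {false, true} := by decide
  have h1 : CliffordAlgebra.contractRight (gen ({false, true} : Finset Bool))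
      (Finsupp.lapply {false, true}) = 1 := by
    have := isOrientation_one.contractGen_mul_gen
      (Finset.notMem_empty ({false, true} : Finset Bool))
    rwa [one_mul] at this
  have h2 : rename (fun C => some (Forest.graftRoot omegaTree F (fun _ => A) (starEquiv I) C)) s =
      rename (fun C => some (C.map Function.Embedding.some)) s := by
    refine hs.algHom_congr _ _ fun C hC => ?_
    simp [Forest.graftRoot_omegaTree, Finset.ne_of_mem_erase hC]
  have h3 : IsOrientation ((F.roots.erase A.1).image fun C => C.map Function.Embedding.some)
      (rename (fun C => some (C.map Function.Embedding.some)) s) :=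
    hs.rename _ _ (by simp) (by simp) (by simp)
  have h4 : Finset.insertNone A.1 ∉
      (F.roots.erase A.1).image fun C => C.map Function.Embedding.some := by
    intro h
    obtain ⟨C, -, h⟩ := Finset.mem_image.1 h
    have : none ∈ Finset.insertNone A.1 := by simp
    rw [← h] at this
    simp at this
  have h5 := h3.contractGen_mul_gen h4
  change CliffordAlgebra.contractRight _ _ = _ at h5
  rw [extComp_apply, extComp_apply, hroot, h1, map_one, one_mul, Forest.rootOf_starGraft, map_mul,
    h2, rename_gen, Option.elim_some, Forest.graftRoot_omegaTree, if_pos rfl, h5, rename_rename]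
  simp only [Forest.graftRoot_starGraft, Forest.glue_sharpEquiv, Finset.eraseNone_map_some]

namespace InnerOrientedForest

variable (x : InnerOrientedForest I) (y : InnerOrientedForest J)

/-- The Koszul sign is trivial here because `ω` has one root, hence degree 0 in `B`; in the shifted
convention of `bSign` the exponent is a multiple of 2. -/
theorem bessComp_Omega_tmul (a : OpDet I) (F : Forest I) (r : detSpace F.roots) :
    bessComp (i := false) (starEquiv I) Omega (a ⊗ₜ[ℚ] rootOriented F r) =
      ∑ A : {A // A ∈ F.roots}, detComp (starEquiv I) omegaLeaves a ⊗ₜ[ℚ]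
        rootOriented (Forest.starGraft F A)
          (graftOrientation (starEquiv I) omegaTree F (fun _ => A) omegaRoots r) := by
  have h : (-1 : ℚ) ^ ((Fintype.card I + 1) * (omegaTree.roots.card + 1)) = 1 := by
    rw [roots_omegaTree, Finset.card_singleton, pow_mul']
    simp
  rw [Omega_eq, bessComp, TensorProduct.map₂_apply_tmul, LinearMap.comp_apply, bSign_rootOriented, h,
    one_smul, TensorProduct.map_tmul, bComp_rootOriented_of_path _ Forest.path_omegaTree,
    TensorProduct.tmul_sum]

/-- Here the Koszul sign is the product of the shifted degrees of the forest and of `b`. It is moved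
to the leaf factor, so that the root factor stays a plain root-oriented forest. -/
theorem bessComp_starGraft_tmul (d : OpDet (Option I)) (b : OpDet J) (F : Forest I)
    (A : {A // A ∈ F.roots}) (r : detSpace (Forest.starGraft F A).roots) (G : Forest J)
    (w : detSpace G.roots) :
    bessComp (i := none) (sharpEquiv I J) (d ⊗ₜ[ℚ] rootOriented (Forest.starGraft F A) r)
        (b ⊗ₜ[ℚ] rootOriented G w) =
      ∑ B : {B // B ∈ G.roots},
        ((-1 : ℚ) ^ ((Fintype.card J + 1) * (F.roots.card + 1)) •
          detComp (sharpEquiv I J) d b) ⊗ₜ[ℚ]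
          rootOriented (Forest.graft (Forest.starGraft F A) G (fun _ => B) (sharpEquiv I J))
            (graftOrientation (sharpEquiv I J) (Forest.starGraft F A) G (fun _ => B) r w) := by
  rw [bessComp, TensorProduct.map₂_apply_tmul, LinearMap.comp_apply, bSign_rootOriented,
    map_smul, TensorProduct.map_tmul, LinearMap.smul_apply,
    bComp_rootOriented_of_path _ (Forest.path_starGraft F A), Forest.card_roots_starGraft, ← TensorProduct.smul_tmul, TensorProduct.tmul_sum]

/-- This holds for any outer forms of `x` and `y`, in the exact shape in which the two preceding
compositions deliver their terms. Each choice of `A` and `B` needs its own decomposition of the root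
orientations. -/
theorem isOuterForm_vee {a : OpDet I} {r : detSpace x.forest.roots} {b : OpDet J}
    {w : detSpace y.forest.roots} (ha : IsOrientation Finset.univ a.1)
    (hr : IsOrientation x.forest.roots r.1) (hx : x.Matches a r)
    (hb : IsOrientation Finset.univ b.1) (hw : IsOrientation y.forest.roots w.1)
    (hy : y.Matches b w) (A : {A // A ∈ x.forest.roots}) (B : {B // B ∈ y.forest.roots}) :
    (x.vee y A B).IsOuterForm
      (((-1 : ℚ) ^ ((Fintype.card J + 1) * (x.forest.roots.card + 1)) •
        detComp (sharpEquiv I J) (detComp (starEquiv I) omegaLeaves a) b) ⊗ₜ[ℚ]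
        rootOriented (Forest.graft (Forest.starGraft x.forest A) y.forest (fun _ => B)
            (sharpEquiv I J))
          (graftOrientation (sharpEquiv I J) (Forest.starGraft x.forest A) y.forest (fun _ => B)
            (graftOrientation (starEquiv I) omegaTree x.forest (fun _ => A) omegaRoots r) w)) := by
  obtain ⟨s, hs, hrs⟩ := hr.exists_mul_gen A.2
  obtain ⟨t, ht, hwt⟩ := hw.exists_mul_gen B.2
  have hA := (x.forest.root_nonempty A.2).ne_empty
  have hB := (y.forest.root_nonempty B.2).ne_empty
  have ho₁ : IsOrientation Finset.univ
      (rename (fun i => some (Sum.inl i)) a.1 *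
        rename (fun j => some (Sum.inr j)) b.1 : Ext (I ⊕ J)) := by
    have h1 := ha.rename (fun i => some (Sum.inl i : I ⊕ J)) (Finset.univ.image Sum.inl)
      (by simp) (by simp) (by simp)
    have h2 := hb.rename (fun j => some (Sum.inr j : I ⊕ J)) (Finset.univ.image Sum.inr)
      (by simp) (by simp) (by simp)
    have h3 := h1.mul h2 (by simp [Finset.disjoint_left])
    have : (Finset.univ : Finset (I ⊕ J)) =
        Finset.univ.image Sum.inl ∪ Finset.univ.image Sum.inr := by
      ext (z | z) <;> simp
    rwa [this]
  have ho₂ : IsOrientation (x.vee y A B).forest.roots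
      (rename (fun C => some (sumSet C ∅)) s *
        rename (fun D => some (if D = B.1 then sumSet A.1 D else sumSet ∅ D)) w.1) := by
    have h1 := hs.rename (fun C => some (sumSet C (∅ : Finset J)))
      ((x.forest.roots.erase A.1).image fun C => sumSet C ∅) (by simp)
      (by simp +contextual [sumSet_inj]) (by simp)
    have h2 := ht.rename (fun D => some (sumSet (∅ : Finset I) D))
      ((y.forest.roots.erase B.1).image fun D => sumSet ∅ D) (by simp)
      (by simp +contextual [sumSet_inj]) (by simp)
    have h3 := h1.mul (h2.mul (isOrientation_gen (sumSet A.1 B.1))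
      (by simp [sumSet_inj, hA.symm])) (by
        rw [Finset.disjoint_union_right]
        refine ⟨Forest.disjoint_image_sumSet fun C hC =>
          x.forest.root_nonempty (Finset.mem_of_mem_erase hC), ?_⟩
        simp [sumSet_inj, hB.symm])
    rw [hwt, rename_mul_gen_sumSet ht]
    convert h3 using 1
    ext S
    refine (Forest.mem_roots_vee x.forest y.forest A B).trans ?_
    simp only [Finset.mem_union, Finset.mem_image, Finset.mem_singleton]
    rw [or_comm, or_assoc]
  -- The Koszul sign times the sign from the leaves: the two exponents differ by 2.
  have hsign : (-1 : ℚ) ^ ((Fintype.card J + 1) * (x.forest.roots.card + 1)) *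
      (-1) ^ (Fintype.card I + 1) = (-1) ^ (Fintype.card I + x.forest.roots.card + Fintype.card J +
          Fintype.card J * x.forest.roots.card) := by
    rw [← pow_add]
    apply neg_one_pow_congr_mod
    rw [← ZMod.natCast_eq_natCast_iff]
    have h2 : (2 : ZMod 2) = 0 := rfl
    push_cast
    linear_combination h2
  have hdet : ((-1 : ℚ) ^ ((Fintype.card J + 1) * (x.forest.roots.card + 1)) •
        detComp (sharpEquiv I J) (detComp (starEquiv I) omegaLeaves a) b).1 =
      (-1 : ℚ) ^ (Fintype.card I + x.forest.roots.card + Fintype.card J +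
          Fintype.card J * x.forest.roots.card) •
        (rename (fun i => some (Sum.inl i)) a.1 * rename (fun j => some (Sum.inr j)) b.1) := by
    rw [← hsign, mul_smul]
    exact congrArg _ (extComp_sharp_star_leaves ha b.1)
  -- The leaf orientation is taken as it stands, scalar included; on the root factor the iterated
  -- graft is exchanged for the `∨` product.
  refine ⟨_, ⟨_, ho₂.mem⟩, ?_, ho₂, ?_, congrArg _ (rootOriented_congr
    (Forest.graft_starGraft x.forest y.forest A B) ?_)⟩
  · rw [hdet]
    exact ho₁.sign_smul _
  · rw [hdet]
    simp only [hwt]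
    rw [hrs] at hr hx
    rw [hwt] at hw hy
    exact matches_vee ha hb hr hs hw ht hx hy
  · refine Eq.trans ?_ (extComp_sharp_star_roots x.forest y.forest A B hs w.1)
    rw [← hrs]
    rfl

end InnerOrientedForest

end inner

end BesselOperad

end

theorem mainTheorem11 {I₁ I₂ : Type*} [Fintype I₁] [DecidableEq I₁] [Fintype I₂] [DecidableEq I₂]
    (x₁ : BesselOperad.InnerOrientedForest I₁) (x₂ : BesselOperad.InnerOrientedForest I₂) :
    BesselOperad.bessComp (i := none) (BesselOperad.sharpEquiv I₁ I₂)
        (BesselOperad.bessComp (i := false) (BesselOperad.starEquiv I₁)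
          BesselOperad.Omega x₁.toBess)
        x₂.toBess =
      ∑ A : {A // A ∈ x₁.forest.roots}, ∑ B : {B // B ∈ x₂.forest.roots},
        (x₁.vee x₂ A B).toBess := by
  -- `toBess` is obtained by choice, so it is accessible only through an outer form; uniqueness of
  -- outer forms leads back to `toBess` at the end.
  obtain ⟨a, r, ha, hr, hx, ex⟩ := x₁.isOuterForm_toBess
  obtain ⟨b, w, hb, hw, hy, ey⟩ := x₂.isOuterForm_toBess
  rw [ex, ey, BesselOperad.InnerOrientedForest.bessComp_Omega_tmul, map_sum, LinearMap.sum_apply]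
  refine Finset.sum_congr rfl fun A _ => ?_
  rw [BesselOperad.InnerOrientedForest.bessComp_starGraft_tmul]
  exact Finset.sum_congr rfl fun B _ =>
    (BesselOperad.InnerOrientedForest.isOuterForm_vee x₁ x₂ ha hr hx hb hw hy A B).eq_toBess
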